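/- All graphs are finite, simple and undirected. An instance $(G,S,T,k)$ of Token Sliding consists of a graph $G$, an integer $k\ge 1$, and two independent sets $S,T$ of $G$ with $|S|=|T|=k$. It is a yes-instance if $S\leftrightsquigarrow T$, that is, if there is a sequence of independent sets $S=S_0,S_1,\dots,S_\ell=T$ of $G$ such that for every $i<\ell$ one has $S_{i+1}=(S_i\setminus\{u\})\cup\{v\}$ for some edge $uv$ of $G$ with $u\in S_i$, $v\notin S_i$. A graph is $C_4$-free if it contains no induced cycle on four vertices. An independent set $I$ of $G$ is unlocked if no vertex belongs to all the independent sets $I'$ with $I\leftrightsquigarrow I'$. A pendant neighbour of a vertex is a neighbour of degree one. **Theorem.** 1. Token Sliding, parameterized by $k$, admits a kernel with $\mathcal{O}(k^{12})$ vertices on bipartite $C_4$-free graphs. That is, there are a constant $C$ and an algorithm that, given an instance $(G,S,T,k)$ with $G$ bipartite and $C_4$-free, computes, in time polynomial in $|V(G)|$, an instance $(G',S',T',k')$ with $G'$ bipartite and $C_4$-free and $|V(G')|\le C\,k^{12}$ (hence also $k'\le C\,k^{12}$), such that $(G',S',T',k')$ is a yes-instance if and only if $(G,S,T,k)$ is a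 yes-instance. 2. Let $(G,S,T,k)$ be an instance of Token Sliding such that $G$ is connected, bipartite and $C_4$-free, $S$ and $T$ are unlocked, and every vertex of $G$ has at most one pendant neighbour. If $G$ has a vertex of degree at least $k^2+k+1$, then $(G,S,T,k)$ is a yes-instance. -/

import Mathlib

namespace TokenSliding

/-! ### Token sliding -/

section Reconfiguration

variable {V : Type*} [DecidableEq V]

/-- One reconfiguration step between independent sets: a single token slides from a vertex `u`
to a vertex `v` along the edge `uv`. -/
def Step (G : SimpleGraph V) (A B : Finset V) : Prop :=
  G.IsIndepSet (A : Set V) ∧ G.IsIndepSet (B : Set V) ∧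
    ∃ u v, G.Adj u v ∧ u ∈ A ∧ v ∉ A ∧ B = insert v (A.erase u)

/-- There is a (finite, possibly empty) sequence of slides from `A` to `B`. -/
def Reach (G : SimpleGraph V) (A B : Finset V) : Prop :=
  Relation.ReflTransGen (Step G) A B

/-- The vertices that are rigid with respect to `G` and `A`: those that carry a token in every
independent set reachable from `A`. -/
def rigid (G : SimpleGraph V) (A : Finset V) : Set V :=
  {v | ∀ B, Reach G A B → v ∈ B}

/-- `A` is unlocked if it has no rigid vertex. -/
def Unlocked (G : SimpleGraph V) (A : Finset V) : Prop :=
  rigid G A = ∅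

end Reconfiguration

/-- `G` has no induced cycle on four vertices. -/
def C4Free {V : Type*} (G : SimpleGraph V) : Prop :=
  ¬ (SimpleGraph.cycleGraph 4).IsIndContained G

/-- The degree of a vertex of a finite graph. -/
noncomputable def deg {V : Type*} (G : SimpleGraph V) (v : V) : ℕ :=
  (G.neighborSet v).ncard

/-- Every vertex has at most one pendant neighbour, i.e. at most one neighbour of degree one. -/
def AtMostOnePendant {V : Type*} (G : SimpleGraph V) : Prop :=
  ∀ v p q, G.Adj v p → G.Adj v q → deg G p = 1 → deg G q = 1 → p = q

/-- An instance `(G, S, T, k)` of Token Sliding, on the vertex set `{0, …, n - 1}`. -/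
structure Instance where
  n : ℕ
  graph : SimpleGraph (Fin n)
  S : Finset (Fin n)
  T : Finset (Fin n)
  k : ℕ
  one_le_k : 1 ≤ k
  indep_S : graph.IsIndepSet (S : Set (Fin n))
  indep_T : graph.IsIndepSet (T : Set (Fin n))
  card_S : S.card = k
  card_T : T.card = k

/-- The instance is a yes-instance. -/
def Instance.IsYes (I : Instance) : Prop :=
  Reach I.graph I.S I.T

/-- The graph of the instance is bipartite and `C₄`-free. -/
def Instance.BipartiteC4Free (I : Instance) : Prop :=
  I.graph.IsBipartite ∧ C4Free I.graph

/-! ### Random access machines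

Structured programs for a random access machine with finitely many registers and finitely many
one-dimensional arrays (those that the program text mentions), all holding natural numbers.
Every elementary operation and every test costs one step. The only arithmetic is addition and
truncated subtraction, so that polynomial time in this model is polynomial time on a Turing
machine. -/

/-- A memory state: the contents `reg x` of the registers, and the entries `arr a i` of the
arrays. -/
structure State where
  reg : ℕ → ℕ
  arr : ℕ → ℕ → ℕ

/-- Register assignment. -/
def State.setReg (s : State) (x c : ℕ) : State :=
  { s with reg := Function.update s.reg x c }

/-- Array assignment. -/
def State.setArr (s : State) (a i c : ℕ) : State :=
  { s with arr := Function.update s.arr a (Function.update (s.arr a) i c) }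

/-- Programs. Registers and arrays are named by numbers that are fixed in the program text. -/
inductive Prog where
  /-- do nothing -/
  | skip : Prog
  /-- `x := c` -/
  | const (x c : ℕ) : Prog
  /-- `x := y` -/
  | copy (x y : ℕ) : Prog
  /-- `x := y + z` -/
  | plus (x y z : ℕ) : Prog
  /-- `x := max (y - z) 0` -/
  | minus (x y z : ℕ) : Prog
  /-- `x := a[y]` -/
  | load (x a y : ℕ) : Prog
  /-- `a[y] := x` -/
  | store (a y x : ℕ) : Prog
  /-- `p; q` -/
  | seq (p q : Prog) : Prog
  /-- if `x ≠ 0` then `p` else `q` -/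
  | ite (x : ℕ) (p q : Prog) : Prog
  /-- while `x ≠ 0` do `p` -/
  | loop (x : ℕ) (p : Prog) : Prog

/-- `Exec p s s' t`: started in the state `s`, the program `p` halts in the state `s'` after
exactly `t` steps. -/
inductive Exec : Prog → State → State → ℕ → Prop where
  | skip (s : State) : Exec .skip s s 1
  | const (s : State) (x c : ℕ) : Exec (.const x c) s (s.setReg x c) 1
  | copy (s : State) (x y : ℕ) : Exec (.copy x y) s (s.setReg x (s.reg y)) 1
  | plus (s : State) (x y z : ℕ) : Exec (.plus x y z) s (s.setReg x (s.reg y + s.reg z)) 1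
  | minus (s : State) (x y z : ℕ) : Exec (.minus x y z) s (s.setReg x (s.reg y - s.reg z)) 1
  | load (s : State) (x a y : ℕ) : Exec (.load x a y) s (s.setReg x (s.arr a (s.reg y))) 1
  | store (s : State) (a y x : ℕ) :
      Exec (.store a y x) s (s.setArr a (s.reg y) (s.reg x)) 1
  | seq {p q : Prog} {s s' s'' : State} {t t' : ℕ} :
      Exec p s s' t → Exec q s' s'' t' → Exec (.seq p q) s s'' (t + t')
  | ite_then {x : ℕ} {p q : Prog} {s s' : State} {t : ℕ} :
      s.reg x ≠ 0 → Exec p s s' t → Exec (.ite x p q) s s' (t + 1)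
  | ite_else {x : ℕ} {p q : Prog} {s s' : State} {t : ℕ} :
      s.reg x = 0 → Exec q s s' t → Exec (.ite x p q) s s' (t + 1)
  | loop_stop {x : ℕ} {p : Prog} {s : State} :
      s.reg x = 0 → Exec (.loop x p) s s 1
  | loop_again {x : ℕ} {p : Prog} {s s' s'' : State} {t t' : ℕ} :
      s.reg x ≠ 0 → Exec p s s' t → Exec (.loop x p) s' s'' t' →
        Exec (.loop x p) s s'' (t + t' + 1)

/-! ### Kernels -/

open Classical in
/-- The state `s` holds the instance `I`: register `0` is `n`, register `1` is `k`, array `0` is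
the adjacency matrix (row by row), and arrays `1` and `2` are the indicator vectors of `S` and
`T`. The other registers and array entries are arbitrary. -/
def Holds (s : State) (I : Instance) : Prop :=
  s.reg 0 = I.n ∧ s.reg 1 = I.k ∧
    (∀ i j : Fin I.n, s.arr 0 (I.n * i + j) = if I.graph.Adj i j then 1 else 0) ∧
    (∀ i : Fin I.n, s.arr 1 i = if i ∈ I.S then 1 else 0) ∧
    (∀ i : Fin I.n, s.arr 2 i = if i ∈ I.T then 1 else 0)

open Classical in
/-- The initial state on the input `I`: the memory holds `I`, and everything else is zero. -/
noncomputable def inputState (I : Instance) : State where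
  reg x := if x = 0 then I.n else if x = 1 then I.k else 0
  arr a c :=
    if a = 0 then (if ∃ i j : Fin I.n, c = I.n * i + j ∧ I.graph.Adj i j then 1 else 0)
    else if a = 1 then (if ∃ i ∈ I.S, c = (i : ℕ) then 1 else 0)
    else if a = 2 then (if ∃ i ∈ I.T, c = (i : ℕ) then 1 else 0)
    else 0

/-- Token Sliding, parameterized by `k` and restricted to the instances in the class `P`, admits a
kernel with at most `g k` vertices: a single program turns every instance `I` in `P`, in time
polynomial in its number of vertices, into an equivalent instance `J` in `P` with at most `g k`
vertices. (The new parameter is bounded by `g k` as well, because `J.k = |J.S| ≤ J.n`.) -/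
def AdmitsKernel (P : Instance → Prop) (g : ℕ → ℕ) : Prop :=
  ∃ (prog : Prog) (time : Polynomial ℕ), ∀ I : Instance, P I →
    ∃ (s : State) (t : ℕ) (J : Instance),
      Exec prog (inputState I) s t ∧ t ≤ time.eval I.n ∧ Holds s J ∧
        P J ∧ (J.IsYes ↔ I.IsYes) ∧ J.n ≤ g I.k

end TokenSliding

/-! Call a set of tokens locked if every neighbour of one of its members has a second neighbour in
the set; such tokens can never move. If no nonempty subset is locked (`Free`), every nonempty subset
contains a token with an exit that no other member of the subset blocks. In a bipartite graph all
tokens of one colour class can therefore leave one by one for the other class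
(`Free.exists_reach_color`). The same greedy moves, interrupted at the first one that comes closer
to a given target and afterwards undone, bring one token two steps nearer to the target and restore
all the others (`Free.push`). This is the basic move of the proof.

In a bipartite `C₄`-free graph two vertices have at most one common neighbour. Suppose that `v` has
`2k` neighbours of degree at least two, and that the tokens are on the side of `v`. Each token
outside `v` touches at most one of these neighbours, so at least `k` of them are untouched and serve
as parking positions. Tokens are pushed towards `v` and parked one at a time. A parked token makes
room by stepping out to a second neighbour, which no other neighbour of `v` sees, and this also
allows two parkings to be exchanged through `v`. Hence any two free sets of `k` tokens in the
component of `v` are connected (`reach_of_large_star`). The second assertion follows: at most one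
neighbour of `v` is pendant, and `k² + k ≥ 2k`.

For the kernel, the largest locked subset of `S` is deleted together with its neighbours
(`reach_trim_iff`), and among the pendant neighbours of a vertex only the first one and those with
tokens of `S` or `T` are relevant. A component with more than `40k³` relevant vertices has at least
`19k³` vertices of degree at least two. Either it contains a star as above, or it is sparse enough
to contain a packing: parking positions of one colour without common neighbours. Holes in the
packing travel along shortest paths between relative neighbours until they meet a token outside, so
that all tokens get parked (`Packing.reach`). In such a component only the number of tokens matters
(`reach_of_large_core`). It remains to keep the relevant vertices of the small components with
tokens, at most `40k⁴` in all. Two isolated vertices are added; a token on one of them turns the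
output into a no-instance if the locked parts or the token counts of `S` and `T` disagree.

The running time is handled by a small language of expressions with bounded sums and statements with
bounded loops. It compiles to the machine with a polynomial cost. All the sets above are definable
by bounded quantification, counting and `n`-fold iteration. -/

namespace TokenSliding

set_option linter.unusedSectionVars false

/-! ### Slides, locked and free sets of tokens, and greedy moves. -/

section Basics

variable {V : Type*} [DecidableEq V] {G : SimpleGraph V}

theorem isIndepSet_iff {A : Finset V} :
    G.IsIndepSet (A : Set V) ↔ ∀ x ∈ A, ∀ y ∈ A, ¬ G.Adj x y := by
  constructor
  · intro h x hx y hy hxy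
    exact h hx hy hxy.ne hxy
  · intro h x hx y hy _
    exact h x hx y hy

theorem Step.symm {A B : Finset V} (h : Step G A B) : Step G B A := by
  obtain ⟨hA, hB, u, v, huv, hu, hv, rfl⟩ := h
  refine ⟨hB, hA, v, u, huv.symm, Finset.mem_insert_self _ _, ?_, ?_⟩
  · simp [huv.ne]
  · have : v ∉ A.erase u := fun h => hv (Finset.mem_of_mem_erase h)
    rw [Finset.erase_insert this, Finset.insert_erase hu]

theorem Reach.refl (A : Finset V) : Reach G A A := Relation.ReflTransGen.refl

theorem Reach.trans {A B C : Finset V} (h : Reach G A B) (h' : Reach G B C) : Reach G A C :=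
  Relation.ReflTransGen.trans h h'

theorem Reach.symm {A B : Finset V} (h : Reach G A B) : Reach G B A := by
  induction h with
  | refl => exact Reach.refl _
  | tail _ h ih => exact Reach.trans (Relation.ReflTransGen.single h.symm) ih

theorem Step.card_eq {A B : Finset V} (h : Step G A B) : B.card = A.card := by
  obtain ⟨-, -, u, v, huv, hu, hv, rfl⟩ := h
  have : v ∉ A.erase u := fun h => hv (Finset.mem_of_mem_erase h)
  rw [Finset.card_insert_of_notMem this, Finset.card_erase_add_one hu]

theorem Reach.card_eq {A B : Finset V} (h : Reach G A B) : B.card = A.card := by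
  induction h with
  | refl => rfl
  | tail _ h ih => rw [h.card_eq, ih]

theorem Reach.isIndepSet {A B : Finset V} (h : Reach G A B) (hA : G.IsIndepSet (A : Set V)) :
    G.IsIndepSet (B : Set V) := by
  induction h with
  | refl => exact hA
  | tail _ h _ => exact h.2.1

/-- A token slides along an edge, away from the other tokens. -/
theorem reach_slide {Y : Finset V} {u v : V} (hY : ∀ x ∈ Y, ∀ y ∈ Y, ¬ G.Adj x y)
    (hu : ∀ y ∈ Y, ¬ G.Adj u y) (hv : ∀ y ∈ Y, ¬ G.Adj v y) (huv : G.Adj u v) :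
    Reach G (insert u Y) (insert v Y) := by
  have huY : u ∉ Y := fun h => hv u h huv.symm
  have hvY : v ∉ Y := fun h => hu v h huv
  have key : ∀ w, (∀ y ∈ Y, ¬ G.Adj w y) → G.IsIndepSet ((insert w Y : Finset V) : Set V) := by
    intro w hw
    rw [isIndepSet_iff]
    intro x hx y hy hxy
    rcases Finset.mem_insert.1 hx with rfl | hx' <;> rcases Finset.mem_insert.1 hy with rfl | hy'
    · exact hxy.ne rfl
    · exact hw y hy' hxy
    · exact hw x hx' hxy.symm
    · exact hY x hx' y hy' hxy
  refine Relation.ReflTransGen.single ⟨key u hu, key v hv, u, v, huv, Finset.mem_insert_self _ _, ?_, ?_⟩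
  · simp [huv.ne.symm, hvY]
  · rw [Finset.erase_insert huY]

/-- Every neighbour of a vertex of `L` has another neighbour in `L`. -/
def Locked (G : SimpleGraph V) (L : Finset V) : Prop :=
  ∀ u ∈ L, ∀ w, G.Adj u w → ∃ u' ∈ L, u' ≠ u ∧ G.Adj u' w

/-- No nonempty set of tokens is locked. -/
def Free (G : SimpleGraph V) (S : Finset V) : Prop :=
  ∀ L ⊆ S, Locked G L → L = ∅

/-- The first token of `L` to leave would arrive next to another token of `L`, which is still in
place. -/
theorem Locked.subset_of_reach {L A B : Finset V} (hL : Locked G L) (h : Reach G A B)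
    (hA : L ⊆ A) : L ⊆ B := by
  induction h with
  | refl => exact hA
  | tail _ h ih =>
    obtain ⟨-, hB, u, v, huv, hu, hv, rfl⟩ := h
    rw [isIndepSet_iff] at hB
    by_cases huL : u ∈ L
    · obtain ⟨u', hu', hne, hadj⟩ := hL u huL v huv
      exact absurd hadj (hB u' (Finset.mem_insert_of_mem (Finset.mem_erase.2 ⟨hne, ih hu'⟩)) v
        (Finset.mem_insert_self _ _))
    · intro x hx
      exact Finset.mem_insert_of_mem (Finset.mem_erase.2 ⟨fun h => huL (h ▸ hx), ih hx⟩)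

theorem Free.mono {S S' : Finset V} (h : Free G S) (hS : S' ⊆ S) : Free G S' :=
  fun L hL => h L (hL.trans hS)

theorem Free.reach {S S' : Finset V} (h : Free G S) (hr : Reach G S S') : Free G S' :=
  fun L hL hlock => h L (hlock.subset_of_reach hr.symm hL) hlock

theorem Unlocked.free {S : Finset V} (h : Unlocked G S) : Free G S := by
  intro L hL hlock
  rw [Finset.eq_empty_iff_forall_notMem]
  intro x hx
  have : x ∈ rigid G S := fun B hB => hlock.subset_of_reach hB hL hx
  rw [h] at this
  exact this

/-! ### Greedy moves from one colour class to the other -/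

/-- `Peel G P L L₀ B₀`: tokens of `L` leave one by one to vertices with the property `P` that have
no other neighbour among the remaining tokens; `L₀` are the tokens that have not moved, and `B₀`
the new positions of the others. -/
inductive Peel (G : SimpleGraph V) (P : V → Prop) (L : Finset V) : Finset V → Finset V → Prop
  | refl : Peel G P L L ∅
  | step {L₀ B₀ : Finset V} {a b : V} : Peel G P L L₀ B₀ → a ∈ L₀ → G.Adj a b →
      (∀ a' ∈ L₀, G.Adj a' b → a' = a) → P b → Peel G P L (L₀.erase a) (insert b B₀)

variable {P : V → Prop} {L L₀ B₀ : Finset V}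

theorem Peel.subset (h : Peel G P L L₀ B₀) : L₀ ⊆ L := by
  induction h with
  | refl => exact Finset.Subset.refl _
  | step _ _ _ _ _ ih => exact (Finset.erase_subset _ _).trans ih

theorem Peel.mem_right (h : Peel G P L L₀ B₀) {b : V} (hb : b ∈ B₀) :
    P b ∧ ∃ a ∈ L, G.Adj a b := by
  induction h with
  | refl => simp at hb
  | step h ha hab _ hP ih =>
    rcases Finset.mem_insert.1 hb with rfl | hb
    · exact ⟨hP, _, h.subset ha, hab⟩
    · exact ih hb

theorem Peel.not_adj (h : Peel G P L L₀ B₀) {a b : V} (ha : a ∈ L₀) (hb : b ∈ B₀) :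
    ¬ G.Adj a b := by
  induction h with
  | refl => simp at hb
  | step h _ _ huniq _ ih =>
    obtain ⟨hne, ha⟩ := Finset.mem_erase.1 ha
    rcases Finset.mem_insert.1 hb with rfl | hb
    · exact fun hab => hne (huniq a ha hab)
    · exact ih ha hb

/-- The moves of the other tokens do not depend on the presence of `a`. This allows the moves to be
undone after `a` has gone elsewhere. -/
theorem Peel.erase {a : V} (h : Peel G P L L₀ B₀) (ha : a ∈ L₀) :
    Peel G P (L.erase a) (L₀.erase a) B₀ := by
  induction h with
  | refl => exact Peel.refl
  | step h ha' hab huniq hP ih =>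
    obtain ⟨hne, ha⟩ := Finset.mem_erase.1 ha
    rw [Finset.erase_right_comm]
    exact (ih ha).step (Finset.mem_erase.2 ⟨hne.symm, ha'⟩) hab
      (fun x hx => huniq x (Finset.mem_of_mem_erase hx)) hP

/-- The tokens of `Y` rest meanwhile. Tokens that have moved share one colour and those that have
not share the other, so only conflicts between the two groups matter, and `Peel.not_adj` excludes
these. -/
theorem Peel.reach {c : V → Bool} (hc : ∀ u v, G.Adj u v → c u ≠ c v) {κ : Bool}
    (hL : ∀ x ∈ L, c x = κ) (h : Peel G P L L₀ B₀) {Y : Finset V}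
    (hY : ∀ x ∈ Y, ∀ y ∈ Y, ¬ G.Adj x y) (hYL : ∀ x ∈ L, ∀ y ∈ Y, ¬ G.Adj x y)
    (hYB : ∀ x ∈ B₀, ∀ y ∈ Y, ¬ G.Adj x y) : Reach G (L ∪ Y) (L₀ ∪ B₀ ∪ Y) := by
  have same : ∀ x y, c x = c y → ¬ G.Adj x y := fun x y h h' => hc x y h' h
  have hB : ∀ {L₀ B₀ : Finset V}, Peel G P L L₀ B₀ → ∀ b ∈ B₀, c b = !κ := by
    intro L₀ B₀ h b hb
    obtain ⟨-, a, ha, hab⟩ := h.mem_right hb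
    have h1 := hc a b hab
    rw [hL a ha] at h1
    revert h1; cases c b <;> cases κ <;> simp
  induction h with
  | refl => simpa using Reach.refl _
  | @step L₀ B₀ a b h ha hab huniq hP ih =>
    have h' := h.step ha hab huniq hP
    have ih := ih fun x hx => hYB x (Finset.mem_insert_of_mem hx)
    refine ih.trans ?_
    have e1 : L₀ ∪ B₀ ∪ Y = insert a (L₀.erase a ∪ B₀ ∪ Y) := by
      rw [← Finset.insert_union, ← Finset.insert_union, Finset.insert_erase ha]
    have e2 : L₀.erase a ∪ insert b B₀ ∪ Y = insert b (L₀.erase a ∪ B₀ ∪ Y) := by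
      rw [Finset.union_insert, Finset.insert_union]
    rw [e1, e2]
    have hLc : ∀ x ∈ L₀, c x = κ := fun x hx => hL x (h.subset hx)
    have hBc := hB h
    have hbc : c b = !κ := hB h' b (Finset.mem_insert_self _ _)
    refine reach_slide ?_ ?_ ?_ hab
    · intro x hx y hy
      simp only [Finset.mem_union, Finset.mem_erase] at hx hy
      rcases hx with (⟨-, hx⟩ | hx) | hx <;> rcases hy with (⟨-, hy⟩ | hy) | hy
      · exact same _ _ ((hLc x hx).trans (hLc y hy).symm)
      · exact h.not_adj hx hy
      · exact hYL x (h.subset hx) y hy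
      · exact fun e => h.not_adj hy hx e.symm
      · exact same _ _ ((hBc x hx).trans (hBc y hy).symm)
      · exact hYB x (Finset.mem_insert_of_mem hx) y hy
      · exact fun e => hYL y (h.subset hy) x hx e.symm
      · exact fun e => hYB y (Finset.mem_insert_of_mem hy) x hx e.symm
      · exact hY x hx y hy
    · intro y hy
      simp only [Finset.mem_union, Finset.mem_erase] at hy
      rcases hy with (⟨-, hy⟩ | hy) | hy
      · exact same _ _ ((hLc a ha).trans (hLc y hy).symm)
      · exact h.not_adj ha hy
      · exact hYL a (h.subset ha) y hy
    · intro y hy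
      simp only [Finset.mem_union, Finset.mem_erase] at hy
      rcases hy with (⟨hne, hy⟩ | hy) | hy
      · exact fun e => hne (huniq y hy e.symm)
      · exact same _ _ (hbc.trans (hBc y hy).symm)
      · exact hYB b (Finset.mem_insert_self _ _) y hy

/-- If no token of `L₀` had such an exit, `L₀` would be locked. -/
theorem Free.exists_move (h : Free G L) {L₀ : Finset V} (hL₀ : L₀ ⊆ L) (hne : L₀.Nonempty) :
    ∃ a ∈ L₀, ∃ b, G.Adj a b ∧ ∀ a' ∈ L₀, G.Adj a' b → a' = a := by
  by_contra! hcon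
  refine hne.ne_empty (h L₀ hL₀ ?_)
  intro u hu w huw
  obtain ⟨a', ha', h1, h2⟩ := hcon u hu w huw
  exact ⟨a', ha', h2, h1⟩

theorem Free.exists_peel_empty (h : Free G L) : ∃ B₀, Peel G (fun _ => True) L ∅ B₀ := by
  suffices key : ∀ n (L₀ B₀ : Finset V), L₀.card = n → Peel G (fun _ => True) L L₀ B₀ →
      ∃ B₁, Peel G (fun _ => True) L ∅ B₁ from key _ L ∅ rfl Peel.refl
  intro n
  induction n with
  | zero =>
    intro L₀ B₀ hn hp
    rw [Finset.card_eq_zero.1 hn] at hp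
    exact ⟨_, hp⟩
  | succ n ih =>
    intro L₀ B₀ hn hp
    obtain ⟨a, ha, b, hab, hu⟩ := h.exists_move hp.subset (Finset.card_pos.1 (by omega))
    exact ih _ _ (by rw [Finset.card_erase_of_mem ha, hn]; rfl) (hp.step ha hab hu trivial)

/-- Some sequence of greedy moves leads to a token that can move to a vertex without `P`. -/
theorem Free.exists_peel (h : Free G L) {a₀ p : V} (ha₀ : a₀ ∈ L) (hp : G.Adj a₀ p)
    (hPp : ¬ P p) : ∃ L₀ B₀ a b, Peel G P L L₀ B₀ ∧ a ∈ L₀ ∧ G.Adj a b ∧ ¬ P b ∧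
      ∀ a' ∈ L₀, G.Adj a' b → a' = a := by
  suffices key : ∀ n (L₀ B₀ : Finset V), L₀.card = n → Peel G P L L₀ B₀ →
      (∃ a ∈ L₀, G.Adj a p) → ∃ L₀ B₀ a b, Peel G P L L₀ B₀ ∧ a ∈ L₀ ∧ G.Adj a b ∧ ¬ P b ∧
      ∀ a' ∈ L₀, G.Adj a' b → a' = a from key _ L ∅ rfl Peel.refl ⟨a₀, ha₀, hp⟩
  intro n
  induction n with
  | zero =>
    rintro L₀ B₀ hn - ⟨a, ha, -⟩
    simp [Finset.card_eq_zero.1 hn] at ha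
  | succ n ih =>
    rintro L₀ B₀ hn hpe ⟨a₁, ha₁, ha₁p⟩
    obtain ⟨a, ha, b, hab, hu⟩ := h.exists_move hpe.subset ⟨a₁, ha₁⟩
    by_cases hb : P b
    · by_cases hrest : ∃ a' ∈ L₀.erase a, G.Adj a' p
      · exact ih _ _ (by rw [Finset.card_erase_of_mem ha, hn]; rfl) (hpe.step ha hab hu hb) hrest
      · push Not at hrest
        have key : ∀ a' ∈ L₀, G.Adj a' p → a' = a := by
          intro a' ha' hadj
          by_contra hne
          exact hrest a' (Finset.mem_erase.2 ⟨hne, ha'⟩) hadj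
        exact ⟨L₀, B₀, a, p, hpe, ha, key a₁ ha₁ ha₁p ▸ ha₁p, hPp, key⟩
    · exact ⟨L₀, B₀, a, b, hpe, ha, hab, hb, hu⟩

/-- A free set can move into either colour class. -/
theorem Free.exists_reach_color {c : V → Bool} (hc : ∀ u v, G.Adj u v → c u ≠ c v)
    {S : Finset V} (hS : G.IsIndepSet (S : Set V)) (h : Free G S) (κ : Bool) :
    ∃ S', Reach G S S' ∧ ∀ x ∈ S', c x = κ := by
  rw [isIndepSet_iff] at hS
  set L := S.filter (fun x => c x = !κ) with hLdef
  set Y := S.filter (fun x => c x = κ) with hYdef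
  have hSe : S = L ∪ Y := by
    ext x
    simp only [hLdef, hYdef, Finset.mem_union, Finset.mem_filter]
    cases c x <;> cases κ <;> simp
  obtain ⟨B, hB⟩ := (h.mono (Finset.filter_subset _ _ : L ⊆ S)).exists_peel_empty
  have hLc : ∀ x ∈ L, c x = !κ := fun x hx => (Finset.mem_filter.1 hx).2
  have hBc : ∀ b ∈ B, c b = κ := by
    intro b hb
    obtain ⟨-, a, ha, hab⟩ := hB.mem_right hb
    have h1 := hc a b hab
    rw [hLc a ha] at h1
    revert h1; cases c b <;> cases κ <;> simp
  have hYS : Y ⊆ S := Finset.filter_subset _ _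
  have hLS : L ⊆ S := Finset.filter_subset _ _
  refine ⟨∅ ∪ B ∪ Y, ?_, ?_⟩
  · have := hB.reach hc hLc (Y := Y) (fun x hx y hy => hS x (hYS hx) y (hYS hy))
      (fun x hx y hy => hS x (hLS hx) y (hYS hy))
      (fun x hx y hy e => hc x y e ((hBc x hx).trans (Finset.mem_filter.1 hy).2.symm))
    rwa [← hSe] at this
  · intro x hx
    simp only [Finset.empty_union, Finset.mem_union] at hx
    rcases hx with hx | hx
    · exact hBc x hx
    · exact (Finset.mem_filter.1 hx).2

/-- The tokens closest to a target, as measured by `δ`, can come closer by two. -/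
theorem Free.push {c : V → Bool} (hc : ∀ u v, G.Adj u v → c u ≠ c v) {κ : Bool}
    (hL : ∀ x ∈ L, c x = κ) (hfree : Free G L) {C : V → Prop} (hCadj : ∀ u v, G.Adj u v → C u → C v)
    (hLC : ∀ x ∈ L, C x) {δ : V → ℕ} (hlip : ∀ u v, C u → G.Adj u v → δ u ≤ δ v + 1)
    (hdesc : ∀ u, C u → 0 < δ u → ∃ v, G.Adj u v ∧ δ v < δ u)
    {m : ℕ} (hm2 : 2 ≤ m) (hm : ∀ x ∈ L, m ≤ δ x) (hex : ∃ a ∈ L, δ a = m) :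
    ∃ a b p, a ∈ L ∧ G.Adj a b ∧ G.Adj b p ∧ δ p + 2 = m ∧
      ∀ Y : Finset V, (∀ x ∈ Y, ∀ y ∈ Y, ¬ G.Adj x y) → (∀ x ∈ L, ∀ y ∈ Y, ¬ G.Adj x y) →
        (∀ y ∈ Y, ¬ G.Adj b y) → (∀ y ∈ Y, ¬ G.Adj p y) →
        (∀ y ∈ Y, c y ≠ κ ∨ δ y + 2 ≤ m) → Reach G (L ∪ Y) (insert p (L.erase a) ∪ Y) := by
  obtain ⟨a₀, ha₀, hma⟩ := hex
  obtain ⟨p₁, hp₁, hlt⟩ := hdesc a₀ (hLC a₀ ha₀) (by omega)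
  -- Moves to vertices with `δ ≥ m` are made until a token `a` can move to some `b` with `δ b < m`.
  -- As `δ` drops by at most one along an edge, `δ a = m` and `δ b = m - 1`.
  obtain ⟨L₀, B₀, a, b, hpe, ha, hab, hPb, huniq⟩ :=
    hfree.exists_peel (P := fun b => m ≤ δ b) ha₀ hp₁ (by omega)
  have haL := hpe.subset ha
  have hCb : C b := hCadj a b hab (hLC a haL)
  have h1 := hlip a b (hLC a haL) hab
  have h2 := hm a haL
  obtain ⟨p, hbp, hp⟩ := hdesc b hCb (by omega)
  have h3 := hlip b p hCb hbp
  refine ⟨a, b, p, haL, hab, hbp, by omega, ?_⟩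
  intro Y hY hYL hYb hYp hYδ
  have same : ∀ x y, c x = c y → ¬ G.Adj x y := fun x y h h' => hc x y h' h
  have hopp : ∀ x y, G.Adj x y → c x = κ → c y = !κ := by
    intro x y hxy hx
    have := hc x y hxy
    rw [hx] at this
    revert this; cases c y <;> cases κ <;> simp
  have hbc : c b = !κ := hopp a b hab (hL a haL)
  have hpc : c p = κ := by
    have := hc b p hbp
    rw [hbc] at this
    revert this; cases c p <;> cases κ <;> simp
  have hBc : ∀ x ∈ B₀, c x = !κ := by
    intro x hx
    obtain ⟨-, a', ha', h'⟩ := hpe.mem_right hx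
    exact hopp a' x h' (hL a' ha')
  have hBδ : ∀ x ∈ B₀, m ≤ δ x := fun x hx => (hpe.mem_right hx).1
  have hBC : ∀ x ∈ B₀, C x := by
    intro x hx
    obtain ⟨-, a', ha', h'⟩ := hpe.mem_right hx
    exact hCadj a' x h' (hLC a' ha')
  -- A resting token of colour `κ` has `δ ≤ m - 2`, too small for a neighbour of a vertex of `B₀`,
  -- where `δ ≥ m`.
  have hYB : ∀ x ∈ B₀, ∀ y ∈ Y, ¬ G.Adj x y := by
    intro x hx y hy hxy
    rcases hYδ y hy with h | h
    · have := hc x y hxy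
      rw [hBc x hx] at this
      revert this h; cases c y <;> cases κ <;> simp
    · have := hlip x y (hBC x hx) hxy
      have := hBδ x hx
      omega
  have hpB : ∀ x ∈ B₀, ¬ G.Adj p x := by
    intro x hx hxy
    have := hlip x p (hBC x hx) hxy.symm
    have := hBδ x hx
    omega
  have r1 := hpe.reach hc hL hY hYL hYB
  have e1 : L₀ ∪ B₀ ∪ Y = insert a (L₀.erase a ∪ B₀ ∪ Y) := by
    rw [← Finset.insert_union, ← Finset.insert_union, Finset.insert_erase ha]
  have hZ : ∀ x ∈ L₀.erase a ∪ B₀ ∪ Y, ∀ y ∈ L₀.erase a ∪ B₀ ∪ Y, ¬ G.Adj x y := by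
    intro x hx y hy
    simp only [Finset.mem_union, Finset.mem_erase] at hx hy
    rcases hx with (⟨-, hx⟩ | hx) | hx <;> rcases hy with (⟨-, hy⟩ | hy) | hy
    · exact same _ _ ((hL x (hpe.subset hx)).trans (hL y (hpe.subset hy)).symm)
    · exact hpe.not_adj hx hy
    · exact hYL x (hpe.subset hx) y hy
    · exact fun e => hpe.not_adj hy hx e.symm
    · exact same _ _ ((hBc x hx).trans (hBc y hy).symm)
    · exact hYB x hx y hy
    · exact fun e => hYL y (hpe.subset hy) x hx e.symm
    · exact fun e => hYB y hy x hx e.symm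
    · exact hY x hx y hy
  have hZb : ∀ y ∈ L₀.erase a ∪ B₀ ∪ Y, ¬ G.Adj b y := by
    intro y hy
    simp only [Finset.mem_union, Finset.mem_erase] at hy
    rcases hy with (⟨hne, hy⟩ | hy) | hy
    · exact fun e => hne (huniq y hy e.symm)
    · exact same _ _ (hbc.trans (hBc y hy).symm)
    · exact hYb y hy
  have hZa : ∀ y ∈ L₀.erase a ∪ B₀ ∪ Y, ¬ G.Adj a y := by
    intro y hy
    simp only [Finset.mem_union, Finset.mem_erase] at hy
    rcases hy with (⟨hne, hy⟩ | hy) | hy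
    · exact same _ _ ((hL a haL).trans (hL y (hpe.subset hy)).symm)
    · exact hpe.not_adj ha hy
    · exact hYL a haL y hy
  have hZp : ∀ y ∈ L₀.erase a ∪ B₀ ∪ Y, ¬ G.Adj p y := by
    intro y hy
    simp only [Finset.mem_union, Finset.mem_erase] at hy
    rcases hy with (⟨hne, hy⟩ | hy) | hy
    · exact same _ _ (hpc.trans (hL y (hpe.subset hy)).symm)
    · exact hpB y hy
    · exact hYp y hy
  have r2 := reach_slide hZ hZa hZb hab
  have r3 := reach_slide hZ hZb hZp hbp
  have hLe : ∀ x ∈ L.erase a, c x = κ := fun x hx => hL x (Finset.mem_of_mem_erase hx)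
  -- With the token `a` resting on `p`, the greedy moves of the others are reversed; `p` does not
  -- see `B₀` because `δ p = m - 2`.
  have r4 := (hpe.erase ha).reach hc hLe (Y := insert p Y)
    (by
      intro x hx y hy hxy
      rcases Finset.mem_insert.1 hx with rfl | hx' <;> rcases Finset.mem_insert.1 hy with rfl | hy'
      · exact hxy.ne rfl
      · exact hYp y hy' hxy
      · exact hYp x hx' hxy.symm
      · exact hY x hx' y hy' hxy)
    (by
      intro x hx y hy hxy
      rcases Finset.mem_insert.1 hy with rfl | hy
      · exact same _ _ ((hLe x hx).trans hpc.symm) hxy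
      · exact hYL x (Finset.mem_of_mem_erase hx) y hy hxy)
    (by
      intro x hx y hy hxy
      rcases Finset.mem_insert.1 hy with rfl | hy
      · exact hpB x hx hxy.symm
      · exact hYB x hx y hy hxy)
  rw [e1] at r1
  rw [Finset.union_insert, Finset.union_insert, ← Finset.insert_union] at r4
  exact ((r1.trans r2).trans r3).trans r4.symm

end Basics


/-! ### Parking tokens around a vertex with many neighbours of degree at least two. -/

section Star

variable {V : Type*} [DecidableEq V] {G : SimpleGraph V}

/-- The distance to a set `R` that can be reached from everywhere in `C`. -/
theorem exists_distTo (R : V → Prop) (C : V → Prop) (hC : ∀ u, C u → ∃ r, R r ∧ G.Reachable u r) :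
    ∃ δ : V → ℕ, (∀ u, R u → δ u = 0) ∧ (∀ u, C u → δ u = 0 → R u) ∧
      (∀ u v, C u → G.Adj u v → δ u ≤ δ v + 1) ∧
      (∀ u, C u → 0 < δ u → ∃ v, G.Adj u v ∧ δ v < δ u) := by
  let D : V → Set ℕ := fun u => {n | ∃ r, R r ∧ ∃ p : G.Walk u r, p.length = n}
  have hne : ∀ u, C u → (D u).Nonempty := by
    intro u hu
    obtain ⟨r, hr, ⟨p⟩⟩ := hC u hu
    exact ⟨_, r, hr, p, rfl⟩
  refine ⟨fun u => sInf (D u), ?_, ?_, ?_, ?_⟩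
  · intro u hu
    exact Nat.le_zero.1 (Nat.sInf_le ⟨u, hu, SimpleGraph.Walk.nil, rfl⟩)
  · intro u hu h0
    obtain ⟨r, hr, p, hp⟩ := Nat.sInf_mem (hne u hu)
    change p.length = sInf (D u) at hp
    rw [show sInf (D u) = 0 from h0] at hp
    rwa [SimpleGraph.Walk.eq_of_length_eq_zero hp]
  · intro u v hu huv
    have hv : (D v).Nonempty := by
      obtain ⟨_, r, hr, p, -⟩ := hne u hu
      exact ⟨_, r, hr, SimpleGraph.Walk.cons huv.symm p, rfl⟩
    obtain ⟨r, hr, p, hp⟩ := Nat.sInf_mem hv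
    refine Nat.sInf_le ⟨r, hr, SimpleGraph.Walk.cons huv p, ?_⟩
    rw [SimpleGraph.Walk.length_cons, hp]
  · intro u hu hpos
    obtain ⟨r, hr, p, hp⟩ := Nat.sInf_mem (hne u hu)
    cases p with
    | nil => exact absurd hp.symm (by simpa using (show sInf (D u) ≠ 0 by exact hpos.ne'))
    | @cons _ v _ h q =>
      refine ⟨v, h, ?_⟩
      have h1 : sInf (D v) ≤ q.length := Nat.sInf_le ⟨r, hr, q, rfl⟩
      rw [SimpleGraph.Walk.length_cons] at hp
      change sInf (D v) < sInf (D u)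
      omega

variable {c : V → Bool} {κ : Bool} {v : V} {F : Finset V} {x : V → V}

/-- The neighbourhood of `v`, in a bipartite graph without four-cycles: `F` consists of
neighbours of `v`, and `x` chooses a further neighbour of each of them. -/
structure Star (G : SimpleGraph V) (c : V → Bool) (κ : Bool) (v : V) (F : Finset V)
    (x : V → V) : Prop where
  color : ∀ u v, G.Adj u v → c u ≠ c v
  common : ∀ a b y z, a ≠ b → G.Adj a y → G.Adj b y → G.Adj a z → G.Adj b z → y = z
  color_center : c v = κ
  adj : ∀ w ∈ F, G.Adj v w
  adj_x : ∀ w ∈ F, G.Adj w (x w)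
  x_ne : ∀ w ∈ F, x w ≠ v

theorem color_adj (hc : ∀ u v, G.Adj u v → c u ≠ c v) {u w : V} (h : G.Adj u w) (hu : c u = κ) :
    c w = !κ := by
  have := hc u w h
  rw [hu] at this
  revert this; cases c w <;> cases κ <;> simp

theorem color_adj' (hc : ∀ u v, G.Adj u v → c u ≠ c v) {u w : V} (h : G.Adj u w)
    (hu : c u = !κ) : c w = κ := by
  simpa using color_adj hc h hu

theorem not_adj_of_color (hc : ∀ u v, G.Adj u v → c u ≠ c v) {u w : V} (h : c u = c w) :
    ¬ G.Adj u w := fun h' => hc u w h' h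

namespace Star

theorem color_F (h : Star G c κ v F x) {w : V} (hw : w ∈ F) : c w = !κ :=
  color_adj h.color (h.adj w hw) h.color_center

theorem color_x (h : Star G c κ v F x) {w : V} (hw : w ∈ F) : c (x w) = κ :=
  color_adj' h.color (h.adj_x w hw) (h.color_F hw)

/-- Otherwise `w` and `w'` would have the two common neighbours `v` and `x w`. -/
theorem not_adj_x (h : Star G c κ v F x) {w w' : V} (hw : w ∈ F) (hw' : G.Adj v w')
    (hne : w' ≠ w) : ¬ G.Adj w' (x w) := fun hadj =>
  h.x_ne w hw (h.common w w' (x w) v hne.symm (h.adj_x w hw) hadj (h.adj w hw).symm hw'.symm)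

theorem peel (h : Star G c κ v F x) {Z : Finset V} (hZ : Z ⊆ F) :
    Peel G (fun _ => True) Z ∅ (Z.image x) := by
  suffices key : ∀ Z₀ ⊆ Z, Peel G (fun _ => True) Z (Z \ Z₀) (Z₀.image x) by
    simpa using key Z (Finset.Subset.refl _)
  intro Z₀
  induction Z₀ using Finset.induction_on with
  | empty => intro _; simpa using Peel.refl
  | insert a Z₀ ha ih =>
    intro hs
    have haZ : a ∈ Z := hs (Finset.mem_insert_self _ _)
    have := (ih ((Finset.subset_insert _ _).trans hs)).step (a := a) (b := x a)
      (Finset.mem_sdiff.2 ⟨haZ, ha⟩) (h.adj_x a (hZ haZ)) (by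
        intro a' ha' hadj
        by_contra hne
        exact h.not_adj_x (hZ haZ) (h.adj a' (hZ (Finset.mem_sdiff.1 ha').1)) hne hadj) trivial
    rwa [← Finset.sdiff_insert, ← Finset.image_insert] at this

/-- Each `x w` sees no parking position except `w`, so the parked tokens can step out in any order.
Reversed, this brings them back. -/
theorem reach_image (h : Star G c κ v F x) {Z Y : Finset V} (hZ : Z ⊆ F)
    (hY : ∀ x ∈ Y, ∀ y ∈ Y, ¬ G.Adj x y) (hYL : ∀ z ∈ Z, ∀ y ∈ Y, ¬ G.Adj z y)
    (hYB : ∀ z ∈ Z, ∀ y ∈ Y, ¬ G.Adj (x z) y) : Reach G (Z ∪ Y) (Z.image x ∪ Y) := by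
  have := (h.peel hZ).reach h.color (fun z hz => h.color_F (hZ hz)) hY hYL (by simpa using hYB)
  simpa using this

/-- The two configurations differ in one token, and both reach the configuration with this token on
`v` and the other parked tokens stepped out. -/
theorem exchange_one (h : Star G c κ v F x) {L W : Finset V} (hLc : ∀ y ∈ L, c y = κ)
    (hLF : ∀ y ∈ L, ∀ w ∈ F, ¬ G.Adj y w) (hW : W ⊆ F) {w w' : V} (hw : w ∈ W) (hw' : w' ∈ F)
    (hw'W : w' ∉ W) : Reach G (L ∪ W) (L ∪ insert w' (W.erase w)) := by
  have hW₀ : W.erase w ⊆ F := (Finset.erase_subset _ _).trans hW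
  have key : ∀ u ∈ F, u ∉ W.erase w →
      Reach G (L ∪ insert u (W.erase w)) (insert v ((W.erase w).image x ∪ L)) := by
    intro u hu huW
    have hY : ∀ a ∈ insert u L, ∀ b ∈ insert u L, ¬ G.Adj a b := by
      intro a ha b hb hab
      rcases Finset.mem_insert.1 ha with rfl | ha' <;> rcases Finset.mem_insert.1 hb with rfl | hb'
      · exact hab.ne rfl
      · exact hLF b hb' a hu hab.symm
      · exact hLF a ha' b hu hab
      · exact not_adj_of_color h.color ((hLc a ha').trans (hLc b hb').symm) hab
    have r1 := h.reach_image hW₀ hY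
      (by
        intro z hz y hy hzy
        rcases Finset.mem_insert.1 hy with rfl | hy'
        · exact not_adj_of_color h.color ((h.color_F (hW₀ hz)).trans (h.color_F hu).symm) hzy
        · exact hLF y hy' z (hW₀ hz) hzy.symm)
      (by
        intro z hz y hy hzy
        rcases Finset.mem_insert.1 hy with rfl | hy'
        · exact h.not_adj_x (hW₀ hz) (h.adj y hu) (fun e => huW (e ▸ hz)) hzy.symm
        · exact not_adj_of_color h.color ((h.color_x (hW₀ hz)).trans (hLc y hy').symm) hzy)
    have r2 : Reach G (insert u ((W.erase w).image x ∪ L)) (insert v ((W.erase w).image x ∪ L)) := by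
      have hk : ∀ y ∈ (W.erase w).image x ∪ L, c y = κ := by
        intro y hy
        rcases Finset.mem_union.1 hy with hy | hy
        · obtain ⟨z, hz, rfl⟩ := Finset.mem_image.1 hy
          exact h.color_x (hW₀ hz)
        · exact hLc y hy
      refine reach_slide ?_ ?_ ?_ (h.adj u hu).symm
      · exact fun a ha b hb => not_adj_of_color h.color ((hk a ha).trans (hk b hb).symm)
      · intro y hy huy
        rcases Finset.mem_union.1 hy with hy | hy
        · obtain ⟨z, hz, rfl⟩ := Finset.mem_image.1 hy
          exact h.not_adj_x (hW₀ hz) (h.adj u hu) (fun e => huW (e ▸ hz)) huy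
        · exact hLF y hy u hu huy.symm
      · exact fun y hy => not_adj_of_color h.color (h.color_center.trans (hk y hy).symm)
    have e1 : L ∪ insert u (W.erase w) = W.erase w ∪ insert u L := by
      ext; simp; tauto
    rw [Finset.union_insert u ((W.erase w).image x)] at r1
    rw [e1]
    exact r1.trans r2
  have r1 := key w (hW hw) (Finset.notMem_erase _ _)
  rw [Finset.insert_erase hw] at r1
  exact r1.trans (key w' hw' (fun hm => hw'W (Finset.mem_of_mem_erase hm))).symm

theorem exchange (h : Star G c κ v F x) {L : Finset V} (hLc : ∀ y ∈ L, c y = κ)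
    (hLF : ∀ y ∈ L, ∀ w ∈ F, ¬ G.Adj y w) {W W' : Finset V} (hW : W ⊆ F) (hW' : W' ⊆ F)
    (hcard : W.card = W'.card) : Reach G (L ∪ W) (L ∪ W') := by
  suffices key : ∀ n, ∀ W ⊆ F, W.card = W'.card → (W \ W').card = n →
      Reach G (L ∪ W) (L ∪ W') from key _ W hW hcard rfl
  intro n
  induction n with
  | zero =>
    intro W _ hcard hn
    rw [Finset.card_eq_zero, Finset.sdiff_eq_empty_iff_subset] at hn
    rw [Finset.eq_of_subset_of_card_le hn hcard.ge]
    exact Reach.refl _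
  | succ n ih =>
    intro W hW hcard hn
    obtain ⟨w, hw⟩ := Finset.card_pos.1 (by omega : 0 < (W \ W').card)
    have h2 : (W' \ W).card = (W \ W').card :=
      (Finset.card_sdiff_comm hcard).symm
    obtain ⟨w', hw'⟩ := Finset.card_pos.1 (by omega : 0 < (W' \ W).card)
    rw [Finset.mem_sdiff] at hw hw'
    refine (h.exchange_one hLc hLF hW hw.1 (hW' hw'.1) hw'.2).trans (ih _ ?_ ?_ ?_)
    · intro y hy
      rcases Finset.mem_insert.1 hy with rfl | hy
      · exact hW' hw'.1
      · exact hW (Finset.mem_of_mem_erase hy)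
    · rw [Finset.card_insert_of_notMem (fun hm => hw'.2 (Finset.mem_of_mem_erase hm)),
        Finset.card_erase_add_one hw.1, hcard]
    · rw [Finset.insert_sdiff_of_mem _ hw'.1, Finset.erase_sdiff_comm,
        Finset.card_erase_of_mem (Finset.mem_sdiff.2 hw), hn]
      rfl

/-- The tokens in `L` are still outside and those in `W` are parked. The nearest outside token is
pushed until it lands on `v` or next to a parking position, and is then parked. -/
theorem exists_reach (h : Star G c κ v F x) {C : V → Prop} (hCadj : ∀ u v, G.Adj u v → C u → C v)
    (hCv : ∀ u, C u → G.Reachable u v) {S : Finset V} (hfree : Free G S) (hSc : ∀ y ∈ S, c y = κ)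
    (hSC : ∀ y ∈ S, C y) (hSF : ∀ y ∈ S, y ≠ v → ∀ w ∈ F, ¬ G.Adj y w) (hcard : S.card ≤ F.card) :
    ∃ W ⊆ F, Reach G S W := by
  -- The neighbours of `F` are targets as well. Tokens that have stepped out to `x w` thus have `δ =
  -- 0`, as `Free.push` requires of resting tokens of colour `κ`.
  obtain ⟨δ, hδ0, hδR, hlip, hdesc⟩ := exists_distTo (G := G)
    (fun u => u = v ∨ ∃ w ∈ F, G.Adj u w) C (fun u hu => ⟨v, Or.inl rfl, hCv u hu⟩)
  have hc := h.color
  -- Lexicographic induction on the number of outside tokens and on a bound for their least distance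
  -- to the targets.
  have main : ∀ n m (L W : Finset V), L.card = n → Reach G S (L ∪ W) → (∀ y ∈ L, c y = κ) →
      (∀ y ∈ L, C y) → v ∉ L → (∀ y ∈ L, ∀ w ∈ F, ¬ G.Adj y w) → W ⊆ F →
      L.card + W.card = S.card → (L.Nonempty → ∃ a ∈ L, δ a ≤ m) → ∃ W ⊆ F, Reach G S W := by
    intro n
    induction n with
    | zero =>
      intro m L W hn hr _ _ _ _ hW _ _
      rw [Finset.card_eq_zero.1 hn, Finset.empty_union] at hr
      exact ⟨W, hW, hr⟩
    | succ n ihn =>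
      intro m
      induction m using Nat.strong_induction_on with
      | _ m ihm =>
      intro L W hn hr hLc hLC hvL hLF hW hLW hm
      have hne : L.Nonempty := Finset.card_pos.1 (by omega)
      obtain ⟨a₀, ha₀, hamin⟩ := L.exists_min_image δ hne
      obtain ⟨a₁, ha₁, hle⟩ := hm hne
      have hle' : δ a₀ ≤ m := (hamin a₁ ha₁).trans hle
      have hpos : ∀ y ∈ L, δ y ≠ 0 := by
        intro y hy h0
        rcases hδR y (hLC y hy) h0 with rfl | ⟨w, hw, hyw⟩
        · exact hvL hy
        · exact hLF y hy w hw hyw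
      -- The value one is excluded by parity: all targets have the colour `κ` of the tokens.
      have hm2 : 2 ≤ δ a₀ := by
        by_contra hlt
        obtain ⟨u, hu, hu'⟩ := hdesc a₀ (hLC a₀ ha₀) (Nat.pos_of_ne_zero (hpos a₀ ha₀))
        have hu0 : δ u = 0 := by omega
        have huc := color_adj hc hu (hLc a₀ ha₀)
        rcases hδR u (hCadj _ _ hu (hLC a₀ ha₀)) hu0 with rfl | ⟨w, hw, huw⟩
        · rw [h.color_center] at huc
          revert huc; cases κ <;> simp
        · exact not_adj_of_color hc (huc.trans (h.color_F hw).symm) huw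
      have hLfree : Free G L := (hfree.reach hr).mono Finset.subset_union_left
      obtain ⟨a, b, p, haL, hab, hbp, hδp, hpush⟩ :=
        hLfree.push hc hLc hCadj hLC hlip hdesc hm2 hamin ⟨a₀, ha₀, rfl⟩
      have hbc : c b = !κ := color_adj hc hab (hLc a haL)
      have hpc : c p = κ := color_adj' hc hbp hbc
      have hpC : C p := hCadj _ _ hbp (hCadj _ _ hab (hLC a haL))
      have hFF : ∀ W ⊆ F, ∀ y ∈ W, ∀ z ∈ W, ¬ G.Adj y z := fun W hW y hy z hz =>
        not_adj_of_color hc ((h.color_F (hW hy)).trans (h.color_F (hW hz)).symm)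
      have hFκ : ∀ W ⊆ F, ∀ y ∈ W, c y ≠ κ := by
        intro W hW y hy
        rw [h.color_F (hW hy)]
        cases κ <;> simp
      have hbF : ∀ W ⊆ F, ∀ y ∈ W, ¬ G.Adj b y := fun W hW y hy =>
        not_adj_of_color hc (hbc.trans (h.color_F (hW hy)).symm)
      have hbnF : b ∉ F := fun hb => hLF a haL b hb hab
      have hLe : ∀ y ∈ L.erase a, c y = κ := fun y hy => hLc y (Finset.mem_of_mem_erase hy)
      have hLeC : ∀ y ∈ L.erase a, C y := fun y hy => hLC y (Finset.mem_of_mem_erase hy)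
      have hvLe : v ∉ L.erase a := fun hy => hvL (Finset.mem_of_mem_erase hy)
      have hLeF : ∀ y ∈ L.erase a, ∀ w ∈ F, ¬ G.Adj y w :=
        fun y hy => hLF y (Finset.mem_of_mem_erase hy)
      have hcardLe : (L.erase a).card = n := by rw [Finset.card_erase_of_mem haL, hn]; rfl
      -- If the token is to arrive on `v`, the parked ones first step out; the newcomer passes from
      -- `v` to an unused `w`, and the others return.
      by_cases hpv : p = v
      · subst hpv
        have hWx : ∀ y ∈ W.image x, c y = κ := by
          intro y hy
          obtain ⟨z, hz, rfl⟩ := Finset.mem_image.1 hy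
          exact h.color_x (hW hz)
        have r1 : Reach G (W ∪ L) (W.image x ∪ L) := h.reach_image hW
          (fun y hy z hz => not_adj_of_color hc ((hLc y hy).trans (hLc z hz).symm))
          (fun z hz y hy e => hLF y hy z (hW hz) e.symm)
          (fun z hz y hy => not_adj_of_color hc ((h.color_x (hW hz)).trans (hLc y hy).symm))
        have r2 := hpush (W.image x)
          (fun y hy z hz => not_adj_of_color hc ((hWx y hy).trans (hWx z hz).symm))
          (fun y hy z hz => not_adj_of_color hc ((hLc y hy).trans (hWx z hz).symm))
          (by
            intro y hy hby
            obtain ⟨z, hz, rfl⟩ := Finset.mem_image.1 hy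
            exact h.not_adj_x (hW hz) hbp.symm (fun e => hbnF (e ▸ hW hz)) hby)
          (fun y hy => not_adj_of_color hc (hpc.trans (hWx y hy).symm))
          (by
            intro y hy
            obtain ⟨z, hz, rfl⟩ := Finset.mem_image.1 hy
            right
            rw [hδ0 (x z) (Or.inr ⟨z, hW hz, (h.adj_x z (hW hz)).symm⟩)]
            omega)
        have : ∃ w ∈ F, w ∉ W := by
          by_contra! hall
          have := Finset.card_le_card (show F ⊆ W from hall)
          omega
        obtain ⟨w, hwF, hwW⟩ := this
        have hk : ∀ y ∈ L.erase a ∪ W.image x, c y = κ := by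
          intro y hy
          rcases Finset.mem_union.1 hy with hy | hy
          · exact hLe y hy
          · exact hWx y hy
        have r3 : Reach G (insert p (L.erase a ∪ W.image x)) (insert w (L.erase a ∪ W.image x)) := by
          refine reach_slide ?_ ?_ ?_ (h.adj w hwF)
          · exact fun y hy z hz => not_adj_of_color hc ((hk y hy).trans (hk z hz).symm)
          · exact fun y hy => not_adj_of_color hc (hpc.trans (hk y hy).symm)
          · intro y hy hwy
            rcases Finset.mem_union.1 hy with hy | hy
            · exact hLeF y hy w hwF hwy.symm
            · obtain ⟨z, hz, rfl⟩ := Finset.mem_image.1 hy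
              exact h.not_adj_x (hW hz) (h.adj w hwF) (fun e => hwW (e ▸ hz)) hwy
        have r4 : Reach G (W ∪ insert w (L.erase a)) (W.image x ∪ insert w (L.erase a)) := by
          refine h.reach_image hW ?_ ?_ ?_
          · intro y hy z hz hyz
            rcases Finset.mem_insert.1 hy with rfl | hy' <;>
              rcases Finset.mem_insert.1 hz with rfl | hz'
            · exact hyz.ne rfl
            · exact hLeF z hz' y hwF hyz.symm
            · exact hLeF y hy' z hwF hyz
            · exact not_adj_of_color hc ((hLe y hy').trans (hLe z hz').symm) hyz
          · intro z hz y hy hzy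
            rcases Finset.mem_insert.1 hy with rfl | hy'
            · exact not_adj_of_color hc ((h.color_F (hW hz)).trans (h.color_F hwF).symm) hzy
            · exact hLeF y hy' z (hW hz) hzy.symm
          · intro z hz y hy hzy
            rcases Finset.mem_insert.1 hy with rfl | hy'
            · exact h.not_adj_x (hW hz) (h.adj y hwF) (fun e => hwW (e ▸ hz)) hzy.symm
            · exact not_adj_of_color hc ((h.color_x (hW hz)).trans (hLe y hy').symm) hzy
        refine ihn (L.sup δ) (L.erase a) (insert w W) hcardLe ?_ hLe hLeC hvLe hLeF ?_ ?_ ?_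
        · rw [Finset.union_comm W, Finset.union_comm _ L] at r1
          rw [Finset.insert_union] at r2
          have e1 : W ∪ insert w (L.erase a) = L.erase a ∪ insert w W := by ext; simp; tauto
          have e2 : W.image x ∪ insert w (L.erase a) = insert w (L.erase a ∪ W.image x) := by
            rw [Finset.union_insert, Finset.union_comm]
          rw [e1, e2] at r4
          exact (((hr.trans r1).trans r2).trans r3).trans r4.symm
        · intro y hy
          rcases Finset.mem_insert.1 hy with rfl | hy
          · exact hwF
          · exact hW hy
        · rw [Finset.card_insert_of_notMem hwW, hcardLe]; omega
        · rintro ⟨y, hy⟩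
          exact ⟨y, hy, Finset.le_sup (f := δ) (Finset.mem_of_mem_erase hy)⟩
      · by_cases hpF : ∃ w ∈ F, G.Adj p w
        · obtain ⟨w, hwF, hpw⟩ := hpF
          -- The position `w` is the only one that `p` sees, since `p` and `v` share at most one
          -- neighbour. The parked tokens are first rearranged so that `w` is empty.
          obtain ⟨W', hW', hW'c⟩ := Finset.exists_subset_card_eq
            (s := F.erase w) (n := W.card) (by rw [Finset.card_erase_of_mem hwF]; omega)
          have hW'F : W' ⊆ F := hW'.trans (Finset.erase_subset _ _)
          have hwW' : w ∉ W' := fun hm => Finset.notMem_erase w F (hW' hm)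
          have r1 := h.exchange hLc hLF hW hW'F hW'c.symm
          have hpW' : ∀ y ∈ W', ¬ G.Adj p y := by
            intro y hy hpy
            exact hwW' ((h.common p v w y hpv hpw (h.adj w hwF) hpy (h.adj y (hW'F hy))) ▸ hy)
          have r2 := hpush W' (hFF W' hW'F) (fun y hy z hz => hLF y hy z (hW'F hz))
            (hbF W' hW'F) hpW' (fun y hy => Or.inl (hFκ W' hW'F y hy))
          have r3 : Reach G (insert p (L.erase a ∪ W')) (insert w (L.erase a ∪ W')) := by
            refine reach_slide ?_ ?_ ?_ hpw
            · intro y hy z hz hyz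
              rcases Finset.mem_union.1 hy with hy' | hy' <;>
                rcases Finset.mem_union.1 hz with hz' | hz'
              · exact not_adj_of_color hc ((hLe y hy').trans (hLe z hz').symm) hyz
              · exact hLeF y hy' z (hW'F hz') hyz
              · exact hLeF z hz' y (hW'F hy') hyz.symm
              · exact hFF W' hW'F y hy' z hz' hyz
            · intro y hy hpy
              rcases Finset.mem_union.1 hy with hy' | hy'
              · exact not_adj_of_color hc (hpc.trans (hLe y hy').symm) hpy
              · exact hpW' y hy' hpy
            · intro y hy hwy
              rcases Finset.mem_union.1 hy with hy' | hy'
              · exact hLeF y hy' w hwF hwy.symm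
              · exact not_adj_of_color hc
                  ((h.color_F hwF).trans (h.color_F (hW'F hy')).symm) hwy
          refine ihn (L.sup δ) (L.erase a) (insert w W') hcardLe ?_ hLe hLeC hvLe hLeF ?_ ?_ ?_
          · rw [Finset.insert_union] at r2
            rw [Finset.union_insert]
            exact ((hr.trans r1).trans r2).trans r3
          · intro y hy
            rcases Finset.mem_insert.1 hy with rfl | hy
            · exact hwF
            · exact hW'F hy
          · rw [Finset.card_insert_of_notMem hwW', hcardLe]; omega
          · rintro ⟨y, hy⟩
            exact ⟨y, hy, Finset.le_sup (f := δ) (Finset.mem_of_mem_erase hy)⟩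
        -- Nothing is parked in this case, but the least distance has decreased by two.
        · push Not at hpF
          have hpL : p ∉ L := fun hp => by have := hamin p hp; omega
          have r2 := hpush W (hFF W hW) (fun y hy z hz => hLF y hy z (hW hz))
            (hbF W hW) (fun y hy => hpF y (hW hy)) (fun y hy => Or.inl (hFκ W hW y hy))
          have hcard' : (insert p (L.erase a)).card = n + 1 := by
            rw [Finset.card_insert_of_notMem (fun hm => hpL (Finset.mem_of_mem_erase hm)), hcardLe]
          refine ihm (δ p) (by omega) (insert p (L.erase a)) W hcard' (hr.trans r2) ?_ ?_ ?_ ?_ hW ?_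
            fun _ => ⟨p, Finset.mem_insert_self _ _, le_rfl⟩
          · intro y hy
            rcases Finset.mem_insert.1 hy with rfl | hy
            exacts [hpc, hLe y hy]
          · intro y hy
            rcases Finset.mem_insert.1 hy with rfl | hy
            exacts [hpC, hLeC y hy]
          · intro hv
            rcases Finset.mem_insert.1 hv with hv | hv
            exacts [hpv hv.symm, hvLe hv]
          · intro y hy
            rcases Finset.mem_insert.1 hy with rfl | hy
            exacts [hpF, hLeF y hy]
          · omega
  by_cases hvS : v ∈ S
  · obtain ⟨w, hw⟩ : F.Nonempty := Finset.card_pos.1 (lt_of_lt_of_le (Finset.card_pos.2 ⟨v, hvS⟩) hcard)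
    have hSe : ∀ y ∈ S.erase v, c y = κ := fun y hy => hSc y (Finset.mem_of_mem_erase hy)
    have hSeF : ∀ y ∈ S.erase v, ∀ w ∈ F, ¬ G.Adj y w := fun y hy =>
      hSF y (Finset.mem_of_mem_erase hy) (Finset.ne_of_mem_erase hy)
    refine main _ (S.sup δ) (S.erase v) {w} rfl ?_ hSe
      (fun y hy => hSC y (Finset.mem_of_mem_erase hy)) (Finset.notMem_erase _ _) hSeF (by simpa using hw)
      (by rw [Finset.card_singleton, Finset.card_erase_add_one hvS]) ?_
    · have := reach_slide (G := G) (Y := S.erase v) (u := v) (v := w)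
        (fun y hy z hz => not_adj_of_color hc ((hSe y hy).trans (hSe z hz).symm))
        (fun y hy => not_adj_of_color hc (h.color_center.trans (hSe y hy).symm))
        (fun y hy e => hSeF y hy w hw e.symm) (h.adj w hw)
      rw [Finset.insert_erase hvS] at this
      rwa [Finset.union_comm, ← Finset.insert_eq]
    · rintro ⟨y, hy⟩
      exact ⟨y, hy, Finset.le_sup (f := δ) (Finset.mem_of_mem_erase hy)⟩
  · refine main _ (S.sup δ) S ∅ rfl (by simpa using Reach.refl S) hSc hSC hvS
      (fun y hy => hSF y hy (fun e => hvS (e ▸ hy))) (by simp) (by simp) ?_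
    rintro ⟨y, hy⟩
    exact ⟨y, hy, Finset.le_sup (f := δ) hy⟩

end Star

end Star


/-! ### Parking tokens on a packing, with holes that travel between relative neighbours. -/

section Packing

/-- The relative neighbourhood graph of a finite-valued "distance" is connected. -/
theorem relativeNeighbour_connected {α : Type*} (δ : α → α → ℕ) (M : α → Prop) (p q : α)
    (hp : M p) (hq : M q) :
    Relation.ReflTransGen (fun p q => M p ∧ M q ∧ ∀ r, M r → ¬ (δ p r < δ p q ∧ δ r q < δ p q)) p q := by
  suffices key : ∀ n p q, M p → M q → δ p q = n →
      Relation.ReflTransGen (fun p q => M p ∧ M q ∧ ∀ r, M r → ¬ (δ p r < δ p q ∧ δ r q < δ p q)) p q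
    from key _ p q hp hq rfl
  intro n
  induction n using Nat.strong_induction_on with
  | _ n ih =>
    intro p q hp hq hn
    by_cases h : ∀ r, M r → ¬ (δ p r < δ p q ∧ δ r q < δ p q)
    · exact Relation.ReflTransGen.single ⟨hp, hq, h⟩
    · push Not at h
      obtain ⟨r, hr, h1, h2⟩ := h
      exact (ih _ (hn ▸ h1) p r hp hr rfl).trans (ih _ (hn ▸ h2) r q hr hq rfl)

variable {V : Type*} [DecidableEq V] {G : SimpleGraph V}

/-- A token moves along a walk that avoids the closed neighbourhoods of the other tokens. -/
theorem reach_walk {Y : Finset V} (hY : ∀ x ∈ Y, ∀ y ∈ Y, ¬ G.Adj x y) {u v : V} (p : G.Walk u v)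
    (hp : ∀ x ∈ p.support, ∀ y ∈ Y, ¬ G.Adj x y) : Reach G (insert u Y) (insert v Y) := by
  induction p with
  | nil => exact Reach.refl _
  | @cons u w v h p ih =>
    have h1 : ∀ y ∈ Y, ¬ G.Adj u y := hp u (by simp)
    have h2 : ∀ y ∈ Y, ¬ G.Adj w y := hp w (by simp)
    exact (reach_slide hY h1 h2 h).trans (ih fun x hx => hp x (by simp [hx]))

theorem dist_le_succ {u v w : V} (h : G.Adj u v) (hr : G.Reachable v w) :
    G.dist u w ≤ G.dist v w + 1 := by
  obtain ⟨p, hp⟩ := hr.exists_walk_length_eq_dist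
  have := G.dist_le (SimpleGraph.Walk.cons h p)
  rw [SimpleGraph.Walk.length_cons, hp] at this
  exact this

theorem exists_adj_dist_lt {u w : V} (hr : G.Reachable u w) (hpos : 0 < G.dist u w) :
    ∃ v, G.Adj u v ∧ G.dist v w < G.dist u w := by
  obtain ⟨p, hp⟩ := hr.exists_walk_length_eq_dist
  cases p with
  | nil => simp at hpos
  | @cons _ v _ h q =>
    have := G.dist_le q
    rw [SimpleGraph.Walk.length_cons] at hp
    exact ⟨v, h, by omega⟩

theorem exists_geodesic {u w : V} (hr : G.Reachable u w) :
    ∃ p : G.Walk u w, ∀ x ∈ p.support, G.dist u x + G.dist x w ≤ G.dist u w := by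
  obtain ⟨p, hp⟩ := hr.exists_walk_length_eq_dist
  refine ⟨p, fun x hx => ?_⟩
  have h1 := G.dist_le (p.takeUntil x hx)
  have h2 := G.dist_le (p.dropUntil x hx)
  have h3 := congrArg SimpleGraph.Walk.length (p.take_spec hx)
  rw [SimpleGraph.Walk.length_append] at h3
  omega

theorem exists_common_of_dist {u w : V} (hr : G.Reachable u w) (hne : u ≠ w) (hadj : ¬ G.Adj u w)
    (h : G.dist u w ≤ 2) : ∃ x, G.Adj u x ∧ G.Adj x w := by
  obtain ⟨x, hx, hlt⟩ := exists_adj_dist_lt hr (hr.pos_dist_of_ne hne)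
  have hrx : G.Reachable x w := hx.symm.reachable.trans hr
  rcases Nat.lt_or_ge 0 (G.dist x w) with h0 | h0
  · have h1 : G.dist x w = 1 := by omega
    exact ⟨x, hx, SimpleGraph.dist_eq_one_iff_adj.1 h1⟩
  · have : x = w := hrx.dist_eq_zero_iff.1 (by omega)
    exact absurd (this ▸ hx) hadj

variable {c : V → Bool} {κ : Bool} {F : Finset V}

/-- Parking positions: vertices of one colour without common neighbours, in one component `C`. -/
structure Packing (G : SimpleGraph V) (c : V → Bool) (κ : Bool) (C : V → Prop)
    (F : Finset V) : Prop where
  color : ∀ u v, G.Adj u v → c u ≠ c v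
  color_F : ∀ w ∈ F, c w = !κ
  common : ∀ f ∈ F, ∀ g ∈ F, ∀ y, G.Adj y f → G.Adj y g → f = g
  closed : ∀ u v, G.Adj u v → C u → C v
  reachable : ∀ u v, C u → C v → G.Reachable u v
  mem : ∀ w ∈ F, C w

namespace Packing

variable {C : V → Prop}

/-- The token travels along a shortest path between `g` and `f`. Near the ends it meets no other
token because distinct parking positions have no common neighbour and `L` does not touch `F`. A
token next to an inner vertex of the path would be closer to both ends than they are to each other,
which the last two hypotheses forbid. -/
theorem shift (h : Packing G c κ C F) {L W : Finset V} (hLc : ∀ y ∈ L, c y = κ)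
    (hLF : ∀ y ∈ L, ∀ w ∈ F, ¬ G.Adj y w) (hW : W ⊆ F) {f g : V} (hg : g ∈ W)
    (hf : f ∈ F) (hfW : f ∉ W)
    (h1 : ∀ y ∈ F, ¬ (G.dist f y < G.dist f g ∧ G.dist y g < G.dist f g))
    (h2 : ∀ y ∈ L, ¬ (G.dist f y < G.dist f g ∧ G.dist y g < G.dist f g)) :
    Reach G (L ∪ W) (L ∪ insert f (W.erase g)) := by
  have hc := h.color
  have hgF := hW hg
  have hWc : ∀ y ∈ W, c y = !κ := fun y hy => h.color_F y (hW hy)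
  obtain ⟨p, hp⟩ := exists_geodesic (h.reachable f g (h.mem f hf) (h.mem g hgF))
  have hpC : ∀ x ∈ p.support, C x := by
    have : ∀ {u v : V} (p : G.Walk u v), C u → ∀ x ∈ p.support, C x := by
      intro u v p
      induction p with
      | nil => intro hu x hx; simp at hx; exact hx ▸ hu
      | cons hadj p ih =>
        intro hu x hx
        rw [SimpleGraph.Walk.support_cons, List.mem_cons] at hx
        rcases hx with rfl | hx
        · exact hu
        · exact ih (h.closed _ _ hadj hu) x hx
    exact this p (h.mem f hf)
  have hYs : ∀ x ∈ L ∪ W.erase g, ∀ y ∈ L ∪ W.erase g, ¬ G.Adj x y := by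
    intro x hx y hy hxy
    rw [Finset.mem_union] at hx hy
    rcases hx with hx | hx <;> rcases hy with hy | hy
    · exact not_adj_of_color hc ((hLc x hx).trans (hLc y hy).symm) hxy
    · exact hLF x hx y (hW (Finset.mem_of_mem_erase hy)) hxy
    · exact hLF y hy x (hW (Finset.mem_of_mem_erase hx)) hxy.symm
    · exact not_adj_of_color hc ((hWc x (Finset.mem_of_mem_erase hx)).trans
        (hWc y (Finset.mem_of_mem_erase hy)).symm) hxy
  -- near an end of the geodesic
  have hend : ∀ e ∈ F, (e = f ∨ e = g) → ∀ x, C x → G.dist x e ≤ 1 → ∀ y ∈ L ∪ W.erase g,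
      ¬ G.Adj x y := by
    intro e he hefg x hx hd y hy hxy
    have heW : e ∉ W.erase g := by
      rcases hefg with rfl | rfl
      · exact fun hm => hfW (Finset.mem_of_mem_erase hm)
      · exact Finset.notMem_erase _ _
    have hxe : G.Reachable x e := h.reachable x e hx (h.mem e he)
    rcases Nat.lt_or_ge 0 (G.dist x e) with h0 | h0
    · have hadj : G.Adj x e := SimpleGraph.dist_eq_one_iff_adj.1 (by omega : G.dist x e = 1)
      rw [Finset.mem_union] at hy
      rcases hy with hy | hy
      · have hxc := color_adj' hc hadj.symm (h.color_F e he)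
        exact not_adj_of_color hc (hxc.trans (hLc y hy).symm) hxy
      · exact heW (h.common y (hW (Finset.mem_of_mem_erase hy)) e he x hxy hadj ▸ hy)
    · have hxe' : x = e := hxe.dist_eq_zero_iff.1 (by omega)
      subst hxe'
      rw [Finset.mem_union] at hy
      rcases hy with hy | hy
      · exact hLF y hy x he hxy.symm
      · exact not_adj_of_color hc ((h.color_F x he).trans
          (hWc y (Finset.mem_of_mem_erase hy)).symm) hxy
  have r := reach_walk hYs p (by
    intro x hx y hy hxy
    have hxC := hpC x hx
    have hyC : C y := h.closed x y hxy hxC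
    have hd := hp x hx
    have hfC := h.mem f hf
    have hgC := h.mem g hgF
    rcases Nat.lt_or_ge (G.dist x g) 2 with hs | hs
    · exact hend g hgF (Or.inr rfl) x hxC (by omega) y hy hxy
    rcases Nat.lt_or_ge (G.dist f x) 2 with ht | ht
    · refine hend f hf (Or.inl rfl) x hxC ?_ y hy hxy
      rw [SimpleGraph.dist_comm]; omega
    -- Both parts of the path at `x` have length at least two, so the one-step detour to `y` keeps
    -- both distances below `dist f g`.
    have d1 := dist_le_succ hxy.symm (h.reachable x g hxC hgC)
    have d2 := dist_le_succ hxy.symm (h.reachable x f hxC hfC)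
    rw [SimpleGraph.dist_comm (u := y), SimpleGraph.dist_comm (u := x)] at d2
    have d3 : G.dist f y < G.dist f g ∧ G.dist y g < G.dist f g := by omega
    rcases Finset.mem_union.1 hy with hy | hy
    · exact h2 y hy d3
    · exact h1 y (hW (Finset.mem_of_mem_erase hy)) d3)
  rw [← Finset.union_insert, ← Finset.union_insert, Finset.insert_erase hg] at r
  exact r.symm

/-- The nearest outside token is pushed towards the empty position `f`; here `m` is the distance
from `L` to `f`. The last hypothesis says that no parking position lies between `L` and `f`, and it
keeps the token away from the others on its way. -/
theorem enter (h : Packing G c κ C F) {S : Finset V} (hfree : Free G S) {f : V} (hf : f ∈ F)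
    {W : Finset V} (hW : W ⊆ F) (hfW : f ∉ W) : ∀ (m : ℕ) (L : Finset V), Reach G S (L ∪ W) →
      (∀ y ∈ L, c y = κ) → (∀ y ∈ L, C y) → (∀ y ∈ L, ∀ w ∈ F, ¬ G.Adj y w) →
      (∃ a ∈ L, G.dist a f = m) → (∀ y ∈ L, m ≤ G.dist y f) →
      (∀ g ∈ F, ∀ y ∈ L, ¬ (G.dist f g < m ∧ G.dist y g < m)) →
      ∃ L', L'.card + 1 = L.card ∧ Reach G S (L' ∪ insert f W) ∧ (∀ y ∈ L', c y = κ) ∧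
        (∀ y ∈ L', C y) ∧ (∀ y ∈ L', ∀ w ∈ F, ¬ G.Adj y w) := by
  intro m
  have hc := h.color
  have hfC := h.mem f hf
  induction m using Nat.strong_induction_on with
  | _ m ih =>
  intro L hr hLc hLC hLF hex hmin hrng
  have hm2 : 2 ≤ m := by
    obtain ⟨a, ha, hd⟩ := hex
    by_contra hlt
    rcases Nat.lt_or_ge 0 m with h0 | h0
    · exact hLF a ha f hf (SimpleGraph.dist_eq_one_iff_adj.1 (by omega : G.dist a f = 1))
    · have : a = f := (h.reachable a f (hLC a ha) hfC).dist_eq_zero_iff.1 (by omega)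
      have h1 := hLc a ha
      rw [this, h.color_F f hf] at h1
      revert h1; cases κ <;> simp
  have hLfree : Free G L := (hfree.reach hr).mono Finset.subset_union_left
  obtain ⟨a, b, p, haL, hab, hbp, hδp, hpush⟩ :=
    hLfree.push hc hLc h.closed hLC (δ := fun x => G.dist x f)
      (fun u v hu huv => dist_le_succ huv (h.reachable v f (h.closed u v huv hu) hfC))
      (fun u hu hpos => exists_adj_dist_lt (h.reachable u f hu hfC) hpos) hm2 hmin hex
  change G.dist p f + 2 = m at hδp
  have hbc : c b = !κ := color_adj hc hab (hLc a haL)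
  have hpc : c p = κ := color_adj' hc hbp hbc
  have hbC : C b := h.closed _ _ hab (hLC a haL)
  have hpC : C p := h.closed _ _ hbp hbC
  have hWc : ∀ y ∈ W, c y = !κ := fun y hy => h.color_F y (hW hy)
  have hLe : ∀ y ∈ L.erase a, c y = κ := fun y hy => hLc y (Finset.mem_of_mem_erase hy)
  have hLeC : ∀ y ∈ L.erase a, C y := fun y hy => hLC y (Finset.mem_of_mem_erase hy)
  have hLeF : ∀ y ∈ L.erase a, ∀ w ∈ F, ¬ G.Adj y w :=
    fun y hy => hLF y (Finset.mem_of_mem_erase hy)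
  have hpf : p ≠ f := fun e => by
    rw [e, h.color_F f hf] at hpc
    revert hpc; cases κ <;> simp
  have hpd : 0 < G.dist p f := (h.reachable p f hpC hfC).pos_dist_of_ne hpf
  have ha3 : ∀ g, C g → G.dist a g ≤ G.dist p g + 2 := by
    intro g hg
    have d1 := dist_le_succ hab (h.reachable b g hbC hg)
    have d2 := dist_le_succ hbp (h.reachable p g hpC hg)
    omega
  have hpF : ∀ g ∈ F, g ≠ f → ¬ G.Adj p g := by
    intro g hg hgf hpg
    have hgC := h.mem g hg
    have d1 := dist_le_succ hpg.symm (h.reachable p f hpC hfC)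
    have d2 := ha3 g hgC
    rw [SimpleGraph.dist_eq_one_iff_adj.2 hpg] at d2
    -- If `p` sees `g`, then `dist g f ≤ m - 1` and `dist a g ≤ 3`. For `m > 3` this contradicts the
    -- hypothesis on `L` and `f`; for smaller `m` the positions `g` and `f` have a common neighbour.
    rcases Nat.lt_or_ge 3 m with h3 | h3
    · refine hrng g hg a haL ⟨?_, by omega⟩
      rw [SimpleGraph.dist_comm]; omega
    · obtain ⟨x, hx1, hx2⟩ := exists_common_of_dist (h.reachable g f hgC hfC) hgf
        (not_adj_of_color hc ((h.color_F g hg).trans (h.color_F f hf).symm)) (by omega)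
      exact hgf (h.common g hg f hf x hx1.symm hx2)
  have hWκ : ∀ y ∈ W, c y ≠ κ := by
    intro y hy
    rw [hWc y hy]
    cases κ <;> simp
  have r1 := hpush W (fun y hy z hz => not_adj_of_color hc ((hWc y hy).trans (hWc z hz).symm))
    (fun y hy z hz => hLF y hy z (hW hz))
    (fun y hy => not_adj_of_color hc (hbc.trans (hWc y hy).symm))
    (fun y hy => hpF y (hW hy) (fun e => hfW (e ▸ hy))) (fun y hy => Or.inl (hWκ y hy))
  by_cases hadj : G.Adj p f
  · refine ⟨L.erase a, Finset.card_erase_add_one haL, ?_, hLe, hLeC, hLeF⟩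
    rw [Finset.insert_union] at r1
    rw [Finset.union_insert]
    refine (hr.trans r1).trans (reach_slide ?_ ?_ ?_ hadj)
    · intro y hy z hz hyz
      rcases Finset.mem_union.1 hy with hy' | hy' <;> rcases Finset.mem_union.1 hz with hz' | hz'
      · exact not_adj_of_color hc ((hLe y hy').trans (hLe z hz').symm) hyz
      · exact hLeF y hy' z (hW hz') hyz
      · exact hLeF z hz' y (hW hy') hyz.symm
      · exact not_adj_of_color hc ((hWc y hy').trans (hWc z hz').symm) hyz
    · intro y hy hpy
      rcases Finset.mem_union.1 hy with hy' | hy'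
      · exact not_adj_of_color hc (hpc.trans (hLe y hy').symm) hpy
      · exact hpF y (hW hy') (fun e => hfW (e ▸ hy')) hpy
    · intro y hy hfy
      rcases Finset.mem_union.1 hy with hy' | hy'
      · exact hLeF y hy' f hf hfy.symm
      · exact not_adj_of_color hc ((h.color_F f hf).trans (hWc y hy').symm) hfy
  · have hpL : p ∉ L := fun hp => by have := hmin p hp; omega
    have hcard : (insert p (L.erase a)).card = L.card := by
      rw [Finset.card_insert_of_notMem (fun hm => hpL (Finset.mem_of_mem_erase hm)),
        Finset.card_erase_add_one haL]
    rw [← hcard]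
    refine ih (m - 2) (by omega) (insert p (L.erase a)) (hr.trans r1) ?_ ?_ ?_
      ⟨p, Finset.mem_insert_self _ _, by omega⟩ ?_ ?_
    · intro y hy
      rcases Finset.mem_insert.1 hy with rfl | hy
      exacts [hpc, hLe y hy]
    · intro y hy
      rcases Finset.mem_insert.1 hy with rfl | hy
      exacts [hpC, hLeC y hy]
    · intro y hy w hw
      rcases Finset.mem_insert.1 hy with rfl | hy
      · by_cases hwf : w = f
        · rwa [hwf]
        · exact hpF w hw hwf
      · exact hLeF y hy w hw
    · intro y hy
      rcases Finset.mem_insert.1 hy with rfl | hy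
      · omega
      · have := hmin y (Finset.mem_of_mem_erase hy); omega
    · rintro g hg y hy ⟨d1, d2⟩
      rcases Finset.mem_insert.1 hy with rfl | hy
      · have := ha3 g (h.mem g hg)
        exact hrng g hg a haL ⟨by omega, by omega⟩
      · exact hrng g hg y (Finset.mem_of_mem_erase hy) ⟨by omega, by omega⟩

/-- A hole is carried along a chain of relative neighbours from `f₀` to `L`. The token of an
occupied next position is shifted into the hole; an empty next position becomes the hole; and when
the chain arrives at `L`, a token enters. -/
theorem exists_progress (h : Packing G c κ C F) {S : Finset V} (hfree : Free G S) {L : Finset V}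
    (hne : L.Nonempty) (hLc : ∀ y ∈ L, c y = κ) (hLC : ∀ y ∈ L, C y)
    (hLF : ∀ y ∈ L, ∀ w ∈ F, ¬ G.Adj y w) {W : Finset V} (hr : Reach G S (L ∪ W)) (hW : W ⊆ F)
    (hWF : W ≠ F) : ∃ L' W', L'.card + 1 = L.card ∧ W'.card = W.card + 1 ∧ W' ⊆ F ∧
      Reach G S (L' ∪ W') ∧ (∀ y ∈ L', c y = κ) ∧ (∀ y ∈ L', C y) ∧
        (∀ y ∈ L', ∀ w ∈ F, ¬ G.Adj y w) := by
  obtain ⟨f₀, hf₀, hf₀W⟩ := Finset.exists_of_ssubset (Finset.ssubset_iff_subset_ne.2 ⟨hW, hWF⟩)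
  let dL : V → ℕ := fun f => L.inf' hne (fun y => G.dist y f)
  have hdL : ∀ f, ∀ y ∈ L, dL f ≤ G.dist y f := fun f y hy =>
    Finset.inf'_le (fun y => G.dist y f) hy
  have hdL' : ∀ f, ∃ y ∈ L, G.dist y f = dL f := by
    intro f
    obtain ⟨y, hy, he⟩ := L.exists_mem_eq_inf' hne (fun y => G.dist y f)
    exact ⟨y, hy, he.symm⟩
  -- The value `none` represents all of `L` as a single point. The triangle inequality may fail, but
  -- connectedness of the relative neighbour graph does not need it.
  let δ : Option V → Option V → ℕ := fun p q =>
    match p, q with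
    | none, none => 0
    | none, some f => dL f
    | some f, none => dL f
    | some f, some g => G.dist f g
  let M : Option V → Prop := fun p => ∀ f, p = some f → f ∈ F
  have hpath := relativeNeighbour_connected δ M (some f₀) none
    (by rintro f ⟨⟩; exact hf₀) (by rintro f ⟨⟩)
  suffices key : ∀ p, Relation.ReflTransGen
      (fun p q => M p ∧ M q ∧ ∀ r, M r → ¬ (δ p r < δ p q ∧ δ r q < δ p q)) p none →
      ∀ f, p = some f → ∀ W, W ⊆ F → f ∉ W → Reach G S (L ∪ W) →
      ∃ L' W', L'.card + 1 = L.card ∧ W'.card = W.card + 1 ∧ W' ⊆ F ∧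
      Reach G S (L' ∪ W') ∧ (∀ y ∈ L', c y = κ) ∧ (∀ y ∈ L', C y) ∧
        (∀ y ∈ L', ∀ w ∈ F, ¬ G.Adj y w) from key _ hpath f₀ rfl W hW hf₀W hr
  intro p hp
  induction hp using Relation.ReflTransGen.head_induction_on with
  | refl => rintro f ⟨⟩
  | @head p q hpq _ ih =>
    rintro f rfl W hW hfW hr
    obtain ⟨hMp, hMq, hrng⟩ := hpq
    have hf : f ∈ F := hMp f rfl
    cases q with
    | none =>
      obtain ⟨L', h1, h2, h3⟩ := h.enter hfree hf hW hfW (dL f) L hr hLc hLC hLF (hdL' f) (hdL f) (by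
        rintro g hg y hy ⟨d1, d2⟩
        exact hrng (some g) (by rintro _ ⟨⟩; exact hg) ⟨d1, (hdL g y hy).trans_lt d2⟩)
      refine ⟨L', insert f W, h1, Finset.card_insert_of_notMem hfW, ?_, h2, h3⟩
      exact Finset.insert_subset hf hW
    | some g =>
      have hg : g ∈ F := hMq g rfl
      by_cases hgW : g ∈ W
      · have r1 := h.shift hLc hLF hW hgW hf hfW
          (fun y hy hd => hrng (some y) (by rintro _ ⟨⟩; exact hy) hd)
          (fun y hy hd => hrng none (by rintro _ ⟨⟩)
            ⟨(hdL f y hy).trans_lt (by rw [SimpleGraph.dist_comm]; exact hd.1),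
              (hdL g y hy).trans_lt hd.2⟩)
        have hfg : g ≠ f := fun e => hfW (e ▸ hgW)
        have hcard : (insert f (W.erase g)).card = W.card := by
          rw [Finset.card_insert_of_notMem (fun hm => hfW (Finset.mem_of_mem_erase hm)),
            Finset.card_erase_add_one hgW]
        obtain ⟨L', W', h1, h2, h3⟩ := ih g rfl (insert f (W.erase g))
          (Finset.insert_subset hf ((Finset.erase_subset _ _).trans hW))
          (by simp [hfg]) (hr.trans r1)
        exact ⟨L', W', h1, h2.trans (by rw [hcard]), h3⟩
      · exact ih g rfl W hW hgW hr

theorem reach (h : Packing G c κ C F) {S : Finset V} (hfree : Free G S) (hSc : ∀ y ∈ S, c y = κ)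
    (hSC : ∀ y ∈ S, C y) (hSF : ∀ y ∈ S, ∀ w ∈ F, ¬ G.Adj y w) (hcard : S.card = F.card) :
    Reach G S F := by
  suffices key : ∀ n (L W : Finset V), L.card = n → L.card + W.card = F.card → W ⊆ F →
      Reach G S (L ∪ W) → (∀ y ∈ L, c y = κ) → (∀ y ∈ L, C y) →
      (∀ y ∈ L, ∀ w ∈ F, ¬ G.Adj y w) → Reach G S F from
    key _ S ∅ rfl (by simpa using hcard) (by simp) (by simpa using Reach.refl S) hSc hSC hSF
  intro n
  induction n with
  | zero =>
    intro L W hn hLW hW hr _ _ _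
    rw [Finset.card_eq_zero.1 hn, Finset.empty_union] at hr
    rwa [← Finset.eq_of_subset_of_card_le hW (by omega)]
  | succ n ih =>
    intro L W hn hLW hW hr hLc hLC hLF
    obtain ⟨L', W', h1, h2, h3, h4, h5, h6, h7⟩ := h.exists_progress hfree
      (Finset.card_pos.1 (by omega)) hLc hLC hLF hr hW (fun e => by rw [e] at hLW; omega)
    exact ih L' W' (by omega) (by omega) h3 h4 h5 h6 h7

end Packing

end Packing


/-! ### Components in which all free sets of the same size are connected. -/

section Component

variable {V : Type*} [DecidableEq V] {G : SimpleGraph V}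

theorem Reach.subset_closed {C : V → Prop} (hC : ∀ u v, G.Adj u v → C u → C v) {S S' : Finset V}
    (h : Reach G S S') (hS : ∀ x ∈ S, C x) : ∀ x ∈ S', C x := by
  induction h with
  | refl => exact hS
  | tail _ h ih =>
    obtain ⟨-, -, u, v, huv, hu, -, rfl⟩ := h
    intro x hx
    rcases Finset.mem_insert.1 hx with rfl | hx
    · exact hC u x huv (ih u hu)
    · exact ih x (Finset.mem_of_mem_erase hx)

/-- The vertex `w` has at least two neighbours. -/
def Core (G : SimpleGraph V) (w : V) : Prop := ∃ x y, x ≠ y ∧ G.Adj w x ∧ G.Adj w y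

theorem Core.exists_ne {w : V} (h : Core G w) (v : V) : ∃ x, G.Adj w x ∧ x ≠ v := by
  obtain ⟨x, y, hxy, hx, hy⟩ := h
  by_cases hxv : x = v
  · exact ⟨y, hy, fun e => hxy (hxv.trans e.symm)⟩
  · exact ⟨x, hx, hxv⟩

variable {c : V → Bool}

open Classical in
/-- Near a vertex with many neighbours of degree at least two, all free sets of `k` tokens can be
reconfigured into each other. -/
theorem reach_of_large_star (hc : ∀ u v, G.Adj u v → c u ≠ c v)
    (hcommon : ∀ a b y z, a ≠ b → G.Adj a y → G.Adj b y → G.Adj a z → G.Adj b z → y = z)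
    {C : V → Prop} (hCadj : ∀ u v, G.Adj u v → C u → C v)
    (hCr : ∀ u v, C u → C v → G.Reachable u v) {S T : Finset V}
    (hSi : G.IsIndepSet (S : Set V)) (hTi : G.IsIndepSet (T : Set V)) (hS : Free G S)
    (hT : Free G T) (hSC : ∀ x ∈ S, C x) (hTC : ∀ x ∈ T, C x) (hST : S.card = T.card) {v : V}
    (hv : C v) {N : Finset V} (hN : ∀ w ∈ N, G.Adj v w ∧ Core G w) (hcard : 2 * S.card ≤ N.card) :
    Reach G S T := by
  have hx : ∀ w, ∃ x, w ∈ N → G.Adj w x ∧ x ≠ v := by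
    intro w
    by_cases hw : w ∈ N
    · obtain ⟨x, h⟩ := (hN w hw).2.exists_ne v
      exact ⟨x, fun _ => h⟩
    · exact ⟨w, fun h => absurd h hw⟩
  choose x hx using hx
  have hstar : ∀ F ⊆ N, Star G c (c v) v F x := fun F hF =>
    ⟨hc, hcommon, rfl, fun w hw => (hN w (hF hw)).1, fun w hw => (hx w (hF hw)).1,
      fun w hw => (hx w (hF hw)).2⟩
  have key : ∀ A : Finset V, G.IsIndepSet (A : Set V) → Free G A → (∀ x ∈ A, C x) →
      A.card = S.card → ∃ W ⊆ N, Reach G A W := by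
    intro A hAi hA hAC hAc
    obtain ⟨A', hr, hA'⟩ := hA.exists_reach_color hc hAi (c v)
    have hA'c := hr.card_eq
    -- Each token outside `v` spoils at most one neighbour of `v`, so half of the `2k` neighbours
    -- survive.
    set F := N.filter (fun w => ∀ y ∈ A', y ≠ v → ¬ G.Adj y w) with hF
    have hFN : F ⊆ N := Finset.filter_subset _ _
    have h1 : (N \ F).card ≤ A'.card * 1 := by
      have hsub : N \ F ⊆ A'.biUnion fun y => N.filter (fun w => y ≠ v ∧ G.Adj y w) := by
        intro w hw
        simp only [hF, Finset.mem_sdiff, Finset.mem_filter, not_and, not_forall, not_not] at hw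
        obtain ⟨hwN, hw⟩ := hw
        obtain ⟨y, hy, hyv, hyw⟩ := hw hwN
        exact Finset.mem_biUnion.2 ⟨y, hy, Finset.mem_filter.2 ⟨hwN, hyv, hyw⟩⟩
      refine (Finset.card_le_card hsub).trans (Finset.card_biUnion_le_card_mul _ _ _ ?_)
      intro y _
      rw [Finset.card_le_one]
      intro w hw w' hw'
      rw [Finset.mem_filter] at hw hw'
      exact hcommon y v w w' hw.2.1 hw.2.2 (hN w hw.1).1 hw'.2.2 (hN w' hw'.1).1
    have h2 := Finset.card_sdiff_add_card_eq_card hFN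
    obtain ⟨W, hW, hW'⟩ := (hstar F hFN).exists_reach hCadj (fun u hu => hCr u v hu hv)
      (hA.reach hr) hA' (hr.subset_closed hCadj hAC)
      (fun y hy hyv w hw => (Finset.mem_filter.1 hw).2 y hy hyv) (by omega)
    exact ⟨W, hW.trans hFN, hr.trans hW'⟩
  obtain ⟨W, hW, hSW⟩ := key S hSi hS hSC rfl
  obtain ⟨W', hW', hTW⟩ := key T hTi hT hTC hST.symm
  have := (hstar N subset_rfl).exchange (L := ∅) (by simp) (by simp) hW hW'
    (by rw [hSW.card_eq, hTW.card_eq, hST])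
  rw [Finset.empty_union, Finset.empty_union] at this
  exact (hSW.trans this).trans hTW.symm

open Classical in
-- Greedy choice: every chosen vertex excludes only itself and at most `D` others.
theorem exists_packing {E : Finset V} {D : ℕ} (hE : ∀ f ∈ E,
    (E.filter fun w => w ≠ f ∧ ∃ x, G.Adj x f ∧ G.Adj x w).card ≤ D) (s : ℕ)
    (hs : s * (D + 1) ≤ E.card) :
    ∃ F ⊆ E, F.card = s ∧ ∀ f ∈ F, ∀ g ∈ F, ∀ y, G.Adj y f → G.Adj y g → f = g := by
  induction s with
  | zero => exact ⟨∅, by simp, rfl, by simp⟩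
  | succ s ih =>
    rw [Nat.succ_mul] at hs
    obtain ⟨F, hF, hFs, hFp⟩ := ih (by omega)
    let X := F.biUnion fun f => insert f (E.filter fun w => w ≠ f ∧ ∃ x, G.Adj x f ∧ G.Adj x w)
    have hX : X.card ≤ F.card * (D + 1) := Finset.card_biUnion_le_card_mul _ _ _ fun f hf =>
      (Finset.card_insert_le _ _).trans (Nat.succ_le_succ (hE f (hF hf)))
    have : ∃ w ∈ E, w ∉ X := by
      by_contra! hall
      have := Finset.card_le_card (show E ⊆ X from hall)
      rw [hFs] at hX
      omega
    obtain ⟨w, hwE, hwX⟩ := this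
    have hw : ∀ f ∈ F, w ≠ f ∧ ∀ y, G.Adj y f → ¬ G.Adj y w := by
      intro f hf
      have hne : w ≠ f := fun e => hwX (Finset.mem_biUnion.2 ⟨f, hf, by simp [e]⟩)
      refine ⟨hne, fun y hy hyw => hwX (Finset.mem_biUnion.2 ⟨f, hf, ?_⟩)⟩
      exact Finset.mem_insert_of_mem (Finset.mem_filter.2 ⟨hwE, hne, y, hy, hyw⟩)
    refine ⟨insert w F, Finset.insert_subset hwE hF, ?_, ?_⟩
    · rw [Finset.card_insert_of_notMem (fun h => (hw w h).1 rfl), hFs]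
    · intro f hf g hg y hyf hyg
      rcases Finset.mem_insert.1 hf with rfl | hf' <;> rcases Finset.mem_insert.1 hg with rfl | hg'
      · rfl
      · exact absurd hyf ((hw g hg').2 y hyg)
      · exact absurd hyg ((hw f hf').2 y hyf)
      · exact hFp f hf' g hg' y hyf hyg

open Classical in
/-- In a large component all free sets with the same number `s ≤ k` of tokens can be reconfigured
into each other. -/
theorem reach_of_large_core (hc : ∀ u v, G.Adj u v → c u ≠ c v)
    (hcommon : ∀ a b y z, a ≠ b → G.Adj a y → G.Adj b y → G.Adj a z → G.Adj b z → y = z)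
    {C : V → Prop} (hCadj : ∀ u v, G.Adj u v → C u → C v)
    (hCr : ∀ u v, C u → C v → G.Reachable u v) {S T : Finset V}
    (hSi : G.IsIndepSet (S : Set V)) (hTi : G.IsIndepSet (T : Set V)) (hS : Free G S)
    (hT : Free G T) (hSC : ∀ x ∈ S, C x) (hTC : ∀ x ∈ T, C x) (hST : S.card = T.card) {k : ℕ}
    (hk : S.card ≤ k) {M : Finset V} (hM : ∀ w, w ∈ M ↔ C w ∧ Core G w)
    (hcard : 19 * k ^ 3 ≤ M.card) : Reach G S T := by
  by_cases hstar : ∃ v, C v ∧ 2 * k ≤ (M.filter (G.Adj v)).card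
  · obtain ⟨v, hv, hvM⟩ := hstar
    exact reach_of_large_star hc hcommon hCadj hCr hSi hTi hS hT hSC hTC hST hv
      (N := M.filter (G.Adj v))
      (fun w hw => ⟨(Finset.mem_filter.1 hw).2, ((hM w).1 (Finset.mem_filter.1 hw).1).2⟩) (by omega)
  -- Without a large star, every vertex of the component has fewer than `2k` neighbours in `M`,
  -- which bounds all the neighbourhoods below.
  push Not at hstar
  -- The larger colour class of `M` provides the parking positions; the tokens are moved to the
  -- opposite class.
  have hκ : ∃ κ : Bool, M.card ≤ 2 * (M.filter (fun w => c w = !κ)).card := by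
    have h1 := Finset.card_filter_add_card_filter_not (s := M) (fun w => c w = true)
    by_cases h2 : M.card ≤ 2 * (M.filter (fun w => c w = true)).card
    · exact ⟨false, h2⟩
    · refine ⟨true, ?_⟩
      simp only [Bool.not_eq_true] at h1
      simp only [Bool.not_true]
      omega
  obtain ⟨κ, hκ⟩ := hκ
  obtain ⟨S', hSS', hS'⟩ := hS.exists_reach_color hc hSi κ
  obtain ⟨T', hTT', hT'⟩ := hT.exists_reach_color hc hTi κ
  have hS'C := hSS'.subset_closed hCadj hSC
  have hT'C := hTT'.subset_closed hCadj hTC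
  set B := M.filter (fun w => c w = !κ) with hB
  set E := B.filter (fun w => ∀ y ∈ S' ∪ T', ¬ G.Adj y w) with hE
  have hEB : E ⊆ B := Finset.filter_subset _ _
  have hBM : B ⊆ M := Finset.filter_subset _ _
  have h1 : (B \ E).card ≤ (2 * k) * (2 * k) := by
    have hsub : B \ E ⊆ (S' ∪ T').biUnion fun y => M.filter (G.Adj y) := by
      intro w hw
      simp only [hE, Finset.mem_sdiff, Finset.mem_filter, not_and, not_forall, not_not] at hw
      obtain ⟨hwB, hw⟩ := hw
      obtain ⟨y, hy, hyw⟩ := hw hwB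
      exact Finset.mem_biUnion.2 ⟨y, hy, Finset.mem_filter.2 ⟨hBM hwB, hyw⟩⟩
    refine (Finset.card_le_card hsub).trans ((Finset.card_biUnion_le_card_mul _ _ (2 * k) ?_).trans ?_)
    · intro y hy
      refine (hstar y ?_).le
      rcases Finset.mem_union.1 hy with hy | hy
      exacts [hS'C y hy, hT'C y hy]
    · refine Nat.mul_le_mul_right _ ((Finset.card_union_le _ _).trans ?_)
      rw [hSS'.card_eq, hTT'.card_eq]
      omega
  have h2 := Finset.card_sdiff_add_card_eq_card hEB
  have hEC : ∀ w ∈ E, C w := fun w hw => ((hM w).1 (hBM (hEB hw))).1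
  have hdeg : ∀ f ∈ E, (E.filter fun w => w ≠ f ∧ ∃ x, G.Adj x f ∧ G.Adj x w).card ≤
      (2 * k) * (2 * k) := by
    intro f hf
    have hsub : (E.filter fun w => w ≠ f ∧ ∃ x, G.Adj x f ∧ G.Adj x w) ⊆
        (M.filter (G.Adj f)).biUnion fun x => M.filter (G.Adj x) := by
      intro w hw
      rw [Finset.mem_filter] at hw
      obtain ⟨hwE, hne, x, hxf, hxw⟩ := hw
      -- A vertex between two different ones has degree at least two, so paths of length two inside
      -- `M` account for all conflicts.
      have hxM : x ∈ M := (hM x).2 ⟨hCadj f x hxf.symm (hEC f hf), w, f, hne, hxw, hxf⟩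
      exact Finset.mem_biUnion.2 ⟨x, Finset.mem_filter.2 ⟨hxM, hxf.symm⟩,
        Finset.mem_filter.2 ⟨hBM (hEB hwE), hxw⟩⟩
    refine (Finset.card_le_card hsub).trans ((Finset.card_biUnion_le_card_mul _ _ (2 * k) ?_).trans ?_)
    · intro y hy
      exact (hstar y ((hM y).1 (Finset.mem_filter.1 hy).1).1).le
    · exact Nat.mul_le_mul_right _ (hstar f (hEC f hf)).le
  -- At least `19k³ / 2` candidates have the right colour and at most `4k²` of them touch a token. A
  -- packing of `k` vertices needs `k (4k² + 1)`, and `4k³ + k + 4k² ≤ 9k³`.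
  have h3 : S.card * ((2 * k) * (2 * k) + 1) ≤ E.card := by
    refine (Nat.mul_le_mul_right _ hk).trans ?_
    have h4 : k ≤ k ^ 3 := Nat.le_self_pow (by norm_num) k
    have h5 : k ^ 2 ≤ k ^ 3 := by
      rcases Nat.eq_zero_or_pos k with rfl | hk
      · simp
      · exact Nat.pow_le_pow_right hk (by norm_num)
    have h6 : k * ((2 * k) * (2 * k) + 1) = 4 * k ^ 3 + k := by ring
    have h7 : (2 * k) * (2 * k) = 4 * k ^ 2 := by ring
    rw [h6]
    rw [h7] at h1
    omega
  obtain ⟨F, hFE, hFs, hFp⟩ := exists_packing hdeg S.card h3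
  have hpack : Packing G c κ C F :=
    ⟨hc, fun w hw => (Finset.mem_filter.1 (hEB (hFE hw))).2, hFp, hCadj, hCr,
      fun w hw => hEC w (hFE hw)⟩
  have hnot : ∀ y ∈ S' ∪ T', ∀ w ∈ F, ¬ G.Adj y w := fun y hy w hw =>
    (Finset.mem_filter.1 (hFE hw)).2 y hy
  have r1 := hpack.reach (hS.reach hSS') hS' hS'C (fun y hy => hnot y (Finset.mem_union_left _ hy))
    (by rw [hSS'.card_eq, hFs])
  have r2 := hpack.reach (hT.reach hTT') hT' hT'C (fun y hy => hnot y (Finset.mem_union_right _ hy))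
    (by rw [hTT'.card_eq, hFs, hST])
  exact ((hSS'.trans r1).trans r2.symm).trans hTT'.symm

/-- A bipartite graph without induced four-cycles has no two vertices with two common
neighbours. -/
theorem C4Free.common (h : C4Free G) (hc : ∀ u v, G.Adj u v → c u ≠ c v) :
    ∀ a b y z, a ≠ b → G.Adj a y → G.Adj b y → G.Adj a z → G.Adj b z → y = z := by
  intro a b y z hab hay hby haz hbz
  by_contra hyz
  refine h ⟨⟨⟨![a, y, b, z], ?_⟩, ?_⟩⟩
  · intro i j hij
    fin_cases i <;> fin_cases j <;>
      simp [hab, hab.symm, hyz, Ne.symm hyz, hay.ne, hay.ne.symm, hby.ne, hby.ne.symm, haz.ne,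
        haz.ne.symm, hbz.ne, hbz.ne.symm] at hij ⊢
  · have e1 : c a = c b := by
      have h1 := hc a y hay
      have h2 := hc b y hby
      revert h1 h2; cases c a <;> cases c b <;> cases c y <;> simp
    have e2 : c y = c z := by
      have h1 := hc a y hay
      have h2 := hc a z haz
      revert h1 h2; cases c a <;> cases c z <;> cases c y <;> simp
    have n1 := not_adj_of_color hc e1
    have n2 := not_adj_of_color hc e2
    have n3 := not_adj_of_color hc e1.symm
    have n4 := not_adj_of_color hc e2.symm
    have hcyc : ∀ i j : Fin 4, (SimpleGraph.cycleGraph 4).Adj i j ↔ i.val % 2 ≠ j.val % 2 := by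
      decide
    have hg : ∀ i j : Fin 4, G.Adj (![a, y, b, z] i) (![a, y, b, z] j) ↔ i.val % 2 ≠ j.val % 2 := by
      intro i j
      fin_cases i <;> fin_cases j <;>
        simp [hay, hay.symm, hby, hby.symm, haz, haz.symm, hbz, hbz.symm, n1, n2, n3, n4]
    intro i j
    exact (hg i j).trans (hcyc i j).symm

theorem c4Free_of_common (h : ∀ a b y z, a ≠ b → G.Adj a y → G.Adj b y → G.Adj a z →
    G.Adj b z → y = z) : C4Free G := by
  rintro ⟨f⟩
  have adj : ∀ i j, (SimpleGraph.cycleGraph 4).Adj i j → G.Adj (f i) (f j) := fun i j hij =>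
    f.map_rel_iff.2 hij
  have := h (f 0) (f 2) (f 1) (f 3) (fun e => absurd (f.injective e) (by decide))
    (adj _ _ (by decide)) (adj _ _ (by decide)) (adj _ _ (by decide)) (adj _ _ (by decide))
  exact absurd (f.injective this) (by decide)

theorem exists_color (h : G.IsBipartite) : ∃ c : V → Bool, ∀ u v, G.Adj u v → c u ≠ c v := by
  obtain ⟨f⟩ := h
  refine ⟨fun v => decide (f v = 0), fun u v huv => ?_⟩
  have := f.valid huv
  change decide (f u = 0) ≠ decide (f v = 0)
  revert this
  generalize f u = i
  generalize f v = j
  revert i j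
  decide

theorem isBipartite_of_color (hc : ∀ u v, G.Adj u v → c u ≠ c v) : G.IsBipartite :=
  ⟨SimpleGraph.Coloring.mk (fun v => if c v then 0 else 1) (by
    intro u v huv
    have := hc u v huv
    revert this; cases c u <;> cases c v <;> simp)⟩

open Classical in
-- All neighbours of `v` but at most one have degree at least two, and `k² + k ≥ 2k` of these
-- suffice for the star argument.
theorem isYes_of_large_degree (I : Instance) (hI : I.BipartiteC4Free) (hconn : I.graph.Connected)
    (hS : Unlocked I.graph I.S) (hT : Unlocked I.graph I.T) (hpend : AtMostOnePendant I.graph)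
    (hdeg : ∃ v, I.k ^ 2 + I.k + 1 ≤ deg I.graph v) : I.IsYes := by
  obtain ⟨c, hc⟩ := exists_color hI.1
  obtain ⟨v, hv⟩ := hdeg
  set A := Finset.univ.filter (I.graph.Adj v) with hA
  have hAcard : A.card = deg I.graph v := by
    unfold deg
    rw [Set.ncard_eq_toFinset_card']
    congr 1
    ext; simp [hA]
  set N := A.filter (Core I.graph) with hN
  have hNA : N ⊆ A := Finset.filter_subset _ _
  have hpen : ∀ w ∈ A \ N, I.graph.Adj v w ∧ deg I.graph w = 1 := by
    intro w hw
    simp only [hN, hA, Finset.mem_sdiff, Finset.mem_filter, Finset.mem_univ, true_and, not_and] at hw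
    refine ⟨hw.1, ?_⟩
    unfold deg
    rw [Set.ncard_eq_one]
    refine ⟨v, ?_⟩
    ext y
    simp only [SimpleGraph.mem_neighborSet, Set.mem_singleton_iff]
    constructor
    · intro hy
      by_contra hne
      exact hw.2 hw.1 ⟨y, v, hne, hy, hw.1.symm⟩
    · rintro rfl
      exact hw.1.symm
  have h1 : (A \ N).card ≤ 1 := by
    rw [Finset.card_le_one]
    intro p hp q hq
    exact hpend v p q (hpen p hp).1 (hpen q hq).1 (hpen p hp).2 (hpen q hq).2
  have h2 := Finset.card_sdiff_add_card_eq_card hNA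
  have h3 : I.k ≤ I.k ^ 2 := Nat.le_self_pow (by norm_num) _
  have hcS := I.card_S
  have hcT := I.card_T
  exact reach_of_large_star hc (hI.2.common hc) (C := fun _ => True) (fun _ _ _ _ => trivial)
    (fun u v _ _ => hconn.preconnected u v) I.indep_S I.indep_T hS.free hT.free
    (fun _ _ => trivial) (fun _ _ => trivial) (hcS.trans hcT.symm) (v := v) trivial (N := N)
    (fun w hw => ⟨by simpa [hA] using hNA hw, (Finset.mem_filter.1 hw).2⟩) (by omega)

end Component


/-! ### Subgraphs, and moves beside resting tokens. -/

section Restriction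

variable {V : Type*} [DecidableEq V] {G : SimpleGraph V}

/-- The graph `G` without the edges that leave `X`. -/
def restr (G : SimpleGraph V) (X : V → Prop) : SimpleGraph V where
  Adj u v := G.Adj u v ∧ X u ∧ X v
  symm := ⟨fun _ _ h => ⟨h.1.symm, h.2.2, h.2.1⟩⟩
  loopless := ⟨fun _ h => h.1.ne rfl⟩

theorem restr_adj {X : V → Prop} {u v : V} : (restr G X).Adj u v ↔ G.Adj u v ∧ X u ∧ X v := Iff.rfl

theorem Reach.exists_insert {A B : Finset V} (h : Step G A B) : ∃ u v Y, A = insert u Y ∧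
    B = insert v Y ∧ G.Adj u v ∧ (∀ x ∈ Y, ∀ y ∈ Y, ¬ G.Adj x y) ∧ (∀ y ∈ Y, ¬ G.Adj u y) ∧
    (∀ y ∈ Y, ¬ G.Adj v y) := by
  obtain ⟨hA, hB, u, v, huv, hu, hv, rfl⟩ := h
  rw [isIndepSet_iff] at hA hB
  refine ⟨u, v, A.erase u, (Finset.insert_erase hu).symm, rfl, huv, ?_, ?_, ?_⟩
  · exact fun x hx y hy => hA x (Finset.mem_of_mem_erase hx) y (Finset.mem_of_mem_erase hy)
  · exact fun y hy => hA u hu y (Finset.mem_of_mem_erase hy)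
  · exact fun y hy => hB v (Finset.mem_insert_self _ _) y (Finset.mem_insert_of_mem hy)

/-- Tokens move within `K` while the tokens in `D` rest. -/
theorem Reach.union {G' : SimpleGraph V} {K : V → Prop} {A B D : Finset V} (h : Reach G' A B)
    (hA : ∀ x ∈ A, K x) (h1 : ∀ u v, G'.Adj u v → G.Adj u v ∧ (K u → K v))
    (h2 : ∀ u v, K u → K v → G.Adj u v → G'.Adj u v) (hD : ∀ x ∈ D, ∀ y ∈ D, ¬ G.Adj x y)
    (hKD : ∀ x, K x → ∀ y ∈ D, ¬ G.Adj x y) : Reach G (A ∪ D) (B ∪ D) := by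
  suffices key : Reach G (A ∪ D) (B ∪ D) ∧ ∀ x ∈ B, K x from key.1
  induction h with
  | refl => exact ⟨Reach.refl _, hA⟩
  | tail _ h ih =>
    obtain ⟨hr, hK⟩ := ih
    obtain ⟨u, v, Y, rfl, rfl, huv, hY, hu, hv⟩ := Reach.exists_insert h
    have hKu : K u := hK u (Finset.mem_insert_self _ _)
    have hKv : K v := (h1 u v huv).2 hKu
    have hKY : ∀ y ∈ Y, K y := fun y hy => hK y (Finset.mem_insert_of_mem hy)
    refine ⟨hr.trans ?_, ?_⟩
    · rw [Finset.insert_union, Finset.insert_union]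
      refine reach_slide ?_ ?_ ?_ (h1 u v huv).1
      · intro x hx y hy hxy
        rcases Finset.mem_union.1 hx with hx' | hx' <;> rcases Finset.mem_union.1 hy with hy' | hy'
        · exact hY x hx' y hy' (h2 x y (hKY x hx') (hKY y hy') hxy)
        · exact hKD x (hKY x hx') y hy' hxy
        · exact hKD y (hKY y hy') x hx' hxy.symm
        · exact hD x hx' y hy' hxy
      · intro y hy huy
        rcases Finset.mem_union.1 hy with hy' | hy'
        · exact hu y hy' (h2 u y hKu (hKY y hy') huy)
        · exact hKD u hKu y hy' huy
      · intro y hy huy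
        rcases Finset.mem_union.1 hy with hy' | hy'
        · exact hv y hy' (h2 v y hKv (hKY y hy') huy)
        · exact hKD v hKv y hy' huy
    · intro x hx
      rcases Finset.mem_insert.1 hx with rfl | hx
      exacts [hKv, hKY x hx]

theorem closed_of_reachable {P : V → Prop} (hP : ∀ u v, G.Adj u v → P u → P v) {u v : V}
    (h : G.Reachable u v) (hu : P u) : P v := by
  obtain ⟨p⟩ := h
  induction p with
  | nil => exact hu
  | cons hadj _ ih => exact ih (hP _ _ hadj hu)

end Restriction

/-! ### Pendant twins, and small and large components. -/

section Twins

variable {n : ℕ} {H : SimpleGraph (Fin n)} {S T : Finset (Fin n)} {k : ℕ}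

/-- The vertex `u` has exactly one neighbour. -/
def Pend (H : SimpleGraph (Fin n)) (u : Fin n) : Prop :=
  ∃ w, H.Adj u w ∧ ¬ ∃ w', w' ≠ w ∧ H.Adj u w'

/-- The vertex `u` carries a token in `S` or `T`, or it is not pendant, or it is the first pendant
neighbour of its neighbour. -/
def Red (H : SimpleGraph (Fin n)) (S T : Finset (Fin n)) (u : Fin n) : Prop :=
  (u ∈ S ∨ u ∈ T) ∨ ¬ (Pend H u ∧ ∃ q, (q < u ∧ Pend H q) ∧ ∃ w, H.Adj u w ∧ H.Adj q w)

open Classical in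
/-- The number of vertices of `A` in the component of `r`. -/
noncomputable def compCard (H : SimpleGraph (Fin n)) (A : Fin n → Prop) (r : Fin n) : ℕ :=
  (Finset.univ.filter fun u => H.Reachable r u ∧ A u).card

/-- The component of `r` contains a token, and only a few relevant vertices. -/
def Small (H : SimpleGraph (Fin n)) (S T : Finset (Fin n)) (k : ℕ) (r : Fin n) : Prop :=
  compCard H (· ∈ S) r ≠ 0 ∧ compCard H (Red H S T) r ≤ 40 * k ^ 3

/-- The relevant vertices of the small components. -/
def Keep (H : SimpleGraph (Fin n)) (S T : Finset (Fin n)) (k : ℕ) (r : Fin n) : Prop :=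
  Small H S T k r ∧ Red H S T r

theorem compCard_congr {A : Fin n → Prop} {r r' : Fin n} (h : H.Reachable r r') :
    compCard H A r = compCard H A r' := by
  unfold compCard
  congr 1
  ext u
  simp only [Finset.mem_filter, Finset.mem_univ, true_and]
  exact and_congr_left fun _ => ⟨fun h' => h.symm.trans h', fun h' => h.trans h'⟩

theorem small_congr {r r' : Fin n} (h : H.Reachable r r') :
    Small H S T k r ↔ Small H S T k r' := by
  unfold Small
  rw [compCard_congr h, compCard_congr h]

theorem Pend.adj_iff {u q w : Fin n} (hu : Pend H u) (huw : H.Adj u w) : H.Adj u q ↔ q = w := by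
  obtain ⟨w', hw', hun⟩ := hu
  push Not at hun
  have hw : w = w' := by
    by_contra hne
    exact hun w hne huw
  subst hw
  constructor
  · intro h
    by_contra hne
    exact hun q hne h
  · rintro rfl
    exact huw

/-- The vertices `u` and `q` are equal or pendant neighbours of the same vertex. -/
def Twin (H : SimpleGraph (Fin n)) (u q : Fin n) : Prop :=
  u = q ∨ (Pend H u ∧ Pend H q ∧ ∃ w, H.Adj u w ∧ H.Adj q w)

theorem Twin.adj_iff {u q w : Fin n} (h : Twin H u q) : H.Adj u w ↔ H.Adj q w := by
  rcases h with rfl | ⟨hu, hq, x, hux, hqx⟩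
  · rfl
  · rw [hu.adj_iff hux, hq.adj_iff hqx]

theorem Twin.reachable {u q : Fin n} (h : Twin H u q) : H.Reachable u q := by
  rcases h with rfl | ⟨_, _, x, hux, hqx⟩
  · rfl
  · exact hux.reachable.trans hqx.symm.reachable

/-- An irrelevant vertex has an earlier pendant twin; descending in the order of the vertices ends
at a relevant one. -/
theorem exists_red_twin (H : SimpleGraph (Fin n)) (S T : Finset (Fin n)) (u : Fin n) :
    ∃ q, Red H S T q ∧ Twin H u q := by
  induction u using WellFoundedLT.induction with
  | _ u ih =>
  by_cases hu : Red H S T u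
  · exact ⟨u, hu, Or.inl rfl⟩
  · have hu' := hu
    unfold Red at hu'
    push Not at hu'
    obtain ⟨-, hp, q, ⟨hlt, hq⟩, w, huw, hqw⟩ := hu'
    obtain ⟨q', hq', htw⟩ := ih q hlt
    refine ⟨q', hq', Or.inr ⟨hp, ?_⟩⟩
    rcases htw with rfl | ⟨-, h2, x, hx, hx'⟩
    · exact ⟨hq, w, huw, hqw⟩
    · rw [hq.adj_iff hqw] at hx
      subst hx
      exact ⟨h2, x, huw, hx'⟩

open Classical in
-- Each vertex is retracted to a relevant twin. Twins have the same neighbours, so the retraction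
-- preserves and reflects adjacency and carries slides to slides. Slides in the other components are
-- forgotten, and tokens of `S` and `T` stay fixed.
theorem reach_keep_of_reach (h : Reach H S T) :
    Reach (restr H (Keep H S T k)) (S.filter (Keep H S T k)) (T.filter (Keep H S T k)) := by
  have hex : ∀ u, ∃ q, Red H S T q ∧ Twin H u q ∧ (Red H S T u → q = u) := by
    intro u
    by_cases hu : Red H S T u
    · exact ⟨u, hu, Or.inl rfl, fun _ => rfl⟩
    · obtain ⟨q, h1, h2⟩ := exists_red_twin H S T u
      exact ⟨q, h1, h2, fun h => absurd h hu⟩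
  choose f hfr hft hfid using hex
  have hadj : ∀ u v, H.Adj (f u) (f v) ↔ H.Adj u v := by
    intro u v
    rw [← (hft u).adj_iff, H.adj_comm, ← (hft v).adj_iff, H.adj_comm]
  let U := Small H S T k
  let π : Finset (Fin n) → Finset (Fin n) := fun A => (A.filter U).image f
  have hπ : ∀ A : Finset (Fin n), (∀ x ∈ A, Red H S T x) → π A = A.filter (Keep H S T k) := by
    intro A hA
    ext x
    simp only [π, U, Finset.mem_image, Finset.mem_filter, Keep]
    constructor
    · rintro ⟨y, ⟨hy, hs⟩, rfl⟩
      rw [hfid y (hA y hy)]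
      exact ⟨hy, hs, hA y hy⟩
    · rintro ⟨hx, hs, hr⟩
      exact ⟨x, ⟨hx, hs⟩, hfid x hr⟩
  rw [← hπ S fun x hx => Or.inl (Or.inl hx), ← hπ T fun x hx => Or.inl (Or.inr hx)]
  have main : ∀ A B, Reach H A B → Reach (restr H (Keep H S T k)) (π A) (π B) := by
    intro A B hAB
    induction hAB with
    | refl => exact Reach.refl _
    | tail _ hst ih =>
      refine ih.trans ?_
      obtain ⟨u, v, Y, rfl, rfl, huv, hY, hu, hv⟩ := Reach.exists_insert hst
      have huv' : U u ↔ U v := small_congr huv.reachable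
      by_cases hU : U u
      · have e : ∀ x, U x → π (insert x Y) = insert (f x) (π Y) := by
          intro x hx
          simp only [π]
          rw [Finset.filter_insert, if_pos hx, Finset.image_insert]
        rw [e u hU, e v (huv'.1 hU)]
        have hK : ∀ x, U x → Keep H S T k (f x) := fun x hx =>
          ⟨(small_congr (hft x).reachable).1 hx, hfr x⟩
        refine reach_slide ?_ ?_ ?_ ⟨(hadj u v).2 huv, hK u hU, hK v (huv'.1 hU)⟩
        · rintro x hx y hy ⟨hxy, -⟩
          obtain ⟨x, hx', rfl⟩ := Finset.mem_image.1 hx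
          obtain ⟨y, hy', rfl⟩ := Finset.mem_image.1 hy
          exact hY x (Finset.mem_filter.1 hx').1 y (Finset.mem_filter.1 hy').1 ((hadj x y).1 hxy)
        · rintro y hy ⟨hxy, -⟩
          obtain ⟨y, hy', rfl⟩ := Finset.mem_image.1 hy
          exact hu y (Finset.mem_filter.1 hy').1 ((hadj u y).1 hxy)
        · rintro y hy ⟨hxy, -⟩
          obtain ⟨y, hy', rfl⟩ := Finset.mem_image.1 hy
          exact hv y (Finset.mem_filter.1 hy').1 ((hadj v y).1 hxy)
      · have e : ∀ x, ¬ U x → π (insert x Y) = π Y := by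
          intro x hx
          simp only [π]
          rw [Finset.filter_insert, if_neg hx]
        rw [e u hU, e v (fun h => hU (huv'.2 h))]
        exact Reach.refl _
  exact main S T h

open Classical in
theorem Reach.compCard_eq (h : Reach H S T) (r : Fin n) :
    compCard H (· ∈ T) r = compCard H (· ∈ S) r := by
  induction h with
  | refl => rfl
  | tail _ hst ih =>
    rw [← ih]
    obtain ⟨hA, hB, u, v, huv, hu, hv, rfl⟩ := hst
    have e : ∀ A : Finset (Fin n), compCard H (· ∈ A) r = (A.filter (H.Reachable r)).card := by
      intro A
      unfold compCard
      congr 1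
      ext x
      simp [and_comm]
    rw [e, e]
    have huv' : H.Reachable r u ↔ H.Reachable r v :=
      ⟨fun h => h.trans huv.reachable, fun h => h.trans huv.symm.reachable⟩
    rw [Finset.filter_insert, Finset.filter_erase]
    split_ifs with hr
    · rw [Finset.card_insert_of_notMem (by simp [hv]), Finset.card_erase_add_one]
      exact Finset.mem_filter.2 ⟨hu, huv'.2 hr⟩
    · rw [Finset.erase_eq_of_notMem]
      simp [huv', hr]

open Classical in
/-- A component with many relevant vertices has many vertices of degree at least two. -/
theorem card_core_of_compCard_red (hS : S.card ≤ k) (hT : T.card ≤ k) (hk : 1 ≤ k) {r : Fin n}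
    (h : 40 * k ^ 3 < compCard H (Red H S T) r) :
    19 * k ^ 3 ≤ (Finset.univ.filter fun w => H.Reachable r w ∧ Core H w).card := by
  set M := Finset.univ.filter fun w => H.Reachable r w ∧ Core H w with hM
  set N := Finset.univ.filter fun w => H.Reachable r w ∧ Red H S T w with hN
  change 40 * k ^ 3 < N.card at h
  have hk3 : k ≤ k ^ 3 := Nat.le_self_pow (by norm_num) k
  -- The component cannot have at most two vertices, since it has more than `40` relevant ones.
  have hpair : ∀ a b, H.Reachable r a → ¬ ∀ x, H.Reachable a x → x = a ∨ x = b := by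
    intro a b ha hall
    have : N ⊆ {a, b} := by
      intro x hx
      have := hall x (ha.symm.trans (Finset.mem_filter.1 hx).2.1)
      simpa using this
    have := (Finset.card_le_card this).trans Finset.card_le_two
    omega
  set Z := N.filter fun w => ¬ Core H w ∧ w ∉ S ∧ w ∉ T with hZ
  have hsub : N ⊆ (M ∪ Z) ∪ (S ∪ T) := by
    intro x hx
    have hx' := (Finset.mem_filter.1 hx).2
    simp only [Finset.mem_union, hM, hZ, Finset.mem_filter, Finset.mem_univ, true_and]
    by_cases h1 : Core H x
    · exact Or.inl (Or.inl ⟨hx'.1, h1⟩)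
    · by_cases h2 : x ∈ S ∨ x ∈ T
      · exact Or.inr h2
      · push Not at h2
        exact Or.inl (Or.inr ⟨hx, h1, h2⟩)
  have hpend : ∀ u, H.Reachable r u → ¬ Core H u → Pend H u := by
    intro u hu hcore
    have hne : ∃ w, H.Adj u w := by
      by_contra! hiso
      refine hpair u u hu fun x hx => Or.inl ?_
      exact closed_of_reachable (P := fun y => y = u)
        (fun a b hab ha => absurd (ha ▸ hab) (hiso b)) hx rfl
    obtain ⟨w, hw⟩ := hne
    refine ⟨w, hw, ?_⟩
    rintro ⟨w', hne, hw'⟩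
    exact hcore ⟨w', w, hne, hw', hw⟩
  -- Each relevant pendant vertex without a token is sent to its neighbour. This is injective
  -- because only the first pendant neighbour is relevant, and the image has degree at least two
  -- because the component is not a single edge.
  have hZM : Z.card ≤ M.card := by
    have hex : ∀ u, ∃ w, u ∈ Z → H.Adj u w := by
      intro u
      by_cases hu : u ∈ Z
      · rw [hZ, Finset.mem_filter, hN, Finset.mem_filter] at hu
        obtain ⟨w, hw, -⟩ := hpend u hu.1.2.1 hu.2.1
        exact ⟨w, fun _ => hw⟩
      · exact ⟨u, fun h => absurd h hu⟩
    choose g hg using hex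
    have hZ' : ∀ u ∈ Z, H.Reachable r u ∧ Pend H u ∧
        ¬ ∃ q, (q < u ∧ Pend H q) ∧ ∃ w, H.Adj u w ∧ H.Adj q w := by
      intro u hu
      rw [hZ, Finset.mem_filter, hN, Finset.mem_filter] at hu
      obtain ⟨⟨-, h1, h2⟩, h3, h4, h5⟩ := hu
      have hp := hpend u h1 h3
      refine ⟨h1, hp, fun hq => ?_⟩
      rcases h2 with h2 | h2
      · rcases h2 with h2 | h2
        exacts [h4 h2, h5 h2]
      · exact h2 ⟨hp, hq⟩
    refine Finset.card_le_card_of_injOn g ?_ ?_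
    · intro u hu
      have hu := Finset.mem_coe.1 hu
      obtain ⟨h1, h2, h3⟩ := hZ' u hu
      have hgr : H.Reachable r (g u) := h1.trans (hg u hu).reachable
      refine Finset.mem_coe.2 (Finset.mem_filter.2 ⟨Finset.mem_univ _, hgr, ?_⟩)
      by_contra hcore
      have hgp := hpend _ hgr hcore
      refine hpair u (g u) h1 fun x hx => ?_
      refine closed_of_reachable (P := fun y => y = u ∨ y = g u) ?_ hx (Or.inl rfl)
      rintro a b hab (rfl | rfl)
      · exact Or.inr ((h2.adj_iff (hg a hu)).1 hab)
      · exact Or.inl ((hgp.adj_iff (hg u hu).symm).1 hab)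
    · intro u hu u' hu' he
      have hu := Finset.mem_coe.1 hu
      have hu' := Finset.mem_coe.1 hu'
      obtain ⟨-, h2, h3⟩ := hZ' u hu
      obtain ⟨-, h2', h3'⟩ := hZ' u' hu'
      have ha := hg u hu
      have ha' := hg u' hu'
      rcases lt_trichotomy u u' with hlt | heq | hlt
      · exact absurd ⟨u, ⟨hlt, h2⟩, g u', ha', he ▸ ha⟩ h3'
      · exact heq
      · exact absurd ⟨u', ⟨hlt, h2'⟩, g u, ha, he ▸ ha'⟩ h3
  -- Altogether `40k³ < 2 |M| + 2k`, and `k ≤ k³`.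
  have h1 := Finset.card_le_card hsub
  have h2 := Finset.card_union_le (M ∪ Z) (S ∪ T)
  have h3 := Finset.card_union_le M Z
  have h4 := Finset.card_union_le S T
  omega

open Classical in
-- A small component contains one of the `k` tokens of `S`, and at most `40k³` relevant vertices.
theorem card_keep_le (hS : S.card ≤ k) :
    (Finset.univ.filter (Keep H S T k)).card ≤ k * (40 * k ^ 3) := by
  have hsub : Finset.univ.filter (Keep H S T k) ⊆ (S.filter (Small H S T k)).biUnion
      fun s => Finset.univ.filter fun u => H.Reachable s u ∧ Red H S T u := by
    intro u hu
    obtain ⟨-, hs, hr⟩ := Finset.mem_filter.1 hu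
    have h0 := hs.1
    unfold compCard at h0
    obtain ⟨s, hs'⟩ := Finset.card_pos.1 (Nat.pos_of_ne_zero h0)
    simp only [Finset.mem_filter, Finset.mem_univ, true_and] at hs'
    obtain ⟨hus, hsS⟩ := hs'
    refine Finset.mem_biUnion.2 ⟨s, Finset.mem_filter.2 ⟨hsS, (small_congr hus).1 hs⟩, ?_⟩
    exact Finset.mem_filter.2 ⟨Finset.mem_univ _, hus.symm, hr⟩
  refine (Finset.card_le_card hsub).trans
    ((Finset.card_biUnion_le_card_mul _ _ (40 * k ^ 3) ?_).trans ?_)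
  · intro s hs
    exact (Finset.mem_filter.1 hs).2.2
  · exact Nat.mul_le_mul_right _ ((Finset.card_filter_le _ _).trans hS)

open Classical in
-- The given reconfiguration settles the small components while the other tokens rest. Each
-- remaining component in which `S` and `T` differ is large, hence settled by `reach_of_large_core`,
-- one after the other. The hypotheses on locked sets leave only isolated vertices locked.
theorem reach_of_reach_keep {c : Fin n → Bool} (hc : ∀ u v, H.Adj u v → c u ≠ c v)
    (hcommon : ∀ a b y z, a ≠ b → H.Adj a y → H.Adj b y → H.Adj a z → H.Adj b z → y = z)
    (hSi : H.IsIndepSet (S : Set (Fin n))) (hTi : H.IsIndepSet (T : Set (Fin n)))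
    (hSl : ∀ L ⊆ S, Locked H L → ∀ u ∈ L, ∀ w, ¬ H.Adj u w)
    (hTl : ∀ L ⊆ T, Locked H L → ∀ u ∈ L, ∀ w, ¬ H.Adj u w)
    (hS : S.card = k) (hT : T.card = k)
    (hcomp : ∀ r, compCard H (· ∈ S) r = compCard H (· ∈ T) r)
    (h : Reach (restr H (Keep H S T k)) (S.filter (Keep H S T k)) (T.filter (Keep H S T k))) :
    Reach H S T := by
  set K := Keep H S T k with hK
  set U := Small H S T k with hU
  have hUS : ∀ x ∈ S, (K x ↔ U x) := fun x hx => ⟨fun h => h.1, fun h => ⟨h, Or.inl (Or.inl hx)⟩⟩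
  have hUT : ∀ x ∈ T, (K x ↔ U x) := fun x hx => ⟨fun h => h.1, fun h => ⟨h, Or.inl (Or.inr hx)⟩⟩
  have hSi' := isIndepSet_iff.1 hSi
  have hTi' := isIndepSet_iff.1 hTi
  have r1 : Reach H (S.filter K ∪ S.filter (fun x => ¬ U x)) (T.filter K ∪ S.filter (fun x => ¬ U x)) := by
    refine h.union (K := K) (fun x hx => (Finset.mem_filter.1 hx).2)
      (fun u v huv => ⟨huv.1, fun _ => huv.2.2⟩) (fun u v hu hv huv => ⟨huv, hu, hv⟩) ?_ ?_
    · exact fun x hx y hy => hSi' x (Finset.mem_filter.1 hx).1 y (Finset.mem_filter.1 hy).1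
    · intro x hx y hy hxy
      exact (Finset.mem_filter.1 hy).2 ((small_congr hxy.reachable).1 hx.1)
  have e1 : S.filter K ∪ S.filter (fun x => ¬ U x) = S := by
    ext x
    simp only [Finset.mem_union, Finset.mem_filter]
    constructor
    · rintro (h | h) <;> exact h.1
    · intro hx
      rw [hUS x hx]
      tauto
  rw [e1] at r1
  -- In every component the current set agrees with `S` or with `T`. Settling one component
  -- decreases the number of tokens outside `T`.
  suffices key : ∀ m (A : Finset (Fin n)), (A \ T).card = m → Reach H S A →
      (∀ x, U x → (x ∈ A ↔ x ∈ T)) →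
      (∀ r, (∀ x, H.Reachable r x → (x ∈ A ↔ x ∈ S)) ∨ (∀ x, H.Reachable r x → (x ∈ A ↔ x ∈ T))) →
      Reach H S T by
    refine key _ _ rfl r1 ?_ ?_
    · intro x hx
      simp only [Finset.mem_union, Finset.mem_filter]
      constructor
      · rintro (h | h)
        · exact h.1
        · exact absurd hx h.2
      · exact fun h => Or.inl ⟨h, (hUT x h).2 hx⟩
    · intro r
      by_cases hr : U r
      · right
        intro x hx
        have hUx : U x := (small_congr hx).1 hr
        simp only [Finset.mem_union, Finset.mem_filter]
        constructor
        · rintro (h | h)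
          · exact h.1
          · exact absurd hUx h.2
        · exact fun h => Or.inl ⟨h, (hUT x h).2 hUx⟩
      · left
        intro x hx
        have hUx : ¬ U x := fun h => hr ((small_congr hx).2 h)
        simp only [Finset.mem_union, Finset.mem_filter]
        constructor
        · rintro (h | h)
          · exact absurd h.2.1 hUx
          · exact h.1
        · exact fun h => Or.inr ⟨h, hUx⟩
  intro m
  induction m using Nat.strong_induction_on with
  | _ m ih =>
  intro A hm hr hAU hmix
  by_cases hsub : A ⊆ T
  · rwa [← Finset.eq_of_subset_of_card_le hsub (by rw [hr.card_eq, hS, hT])]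
  obtain ⟨v, hvA, hvT⟩ := Finset.not_subset.1 hsub
  have hvU : ¬ U v := fun h => hvT ((hAU v h).1 hvA)
  have hAS : ∀ x, H.Reachable v x → (x ∈ A ↔ x ∈ S) := by
    rcases hmix v with h | h
    · exact h
    · exact absurd ((h v (SimpleGraph.Reachable.refl v)).1 hvA) hvT
  have hvS : v ∈ S := (hAS v (SimpleGraph.Reachable.refl v)).1 hvA
  have hk : 1 ≤ k := by
    rw [← hS]
    exact Finset.card_pos.2 ⟨v, hvS⟩
  -- The component contains the token `v`, so only its number of relevant vertices can prevent it
  -- from being small.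
  have hbig : 40 * k ^ 3 < compCard H (Red H S T) v := by
    by_contra hle
    refine hvU ⟨?_, not_lt.1 hle⟩
    refine (Finset.card_pos.2 ⟨v, ?_⟩).ne'
    simpa using hvS
  have hcore := card_core_of_compCard_red hS.le hT.le hk hbig
  -- A component with a vertex of degree at least two has no isolated vertex, so the tokens in it
  -- form a free set.
  have hniso : ∀ u, H.Reachable v u → ¬ ∀ w, ¬ H.Adj u w := by
    intro u hu hiso
    have : (Finset.univ.filter fun w => H.Reachable v w ∧ Core H w).card = 0 := by
      rw [Finset.card_eq_zero, Finset.filter_eq_empty_iff]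
      rintro x - ⟨hx, y, z, hyz, hxy, -⟩
      have : x = u := closed_of_reachable (P := fun y => y = u)
        (fun a b hab ha => absurd (ha ▸ hab) (hiso b)) (hu.symm.trans hx) rfl
      exact hiso y (this ▸ hxy)
    have hk3 : 1 ≤ k ^ 3 := Nat.one_le_pow _ _ hk
    omega
  let C : Fin n → Prop := fun x => H.Reachable v x
  have hCadj : ∀ x y, H.Adj x y → C x → C y := fun x y hxy hx => hx.trans hxy.reachable
  have hfree : ∀ B : Finset (Fin n), (∀ L ⊆ B, Locked H L → ∀ u ∈ L, ∀ w, ¬ H.Adj u w) →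
      Free H (B.filter C) := by
    intro B hB L hL hlock
    rw [Finset.eq_empty_iff_forall_notMem]
    intro x hx
    exact hniso x (Finset.mem_filter.1 (hL hx)).2
      (hB L (hL.trans (Finset.filter_subset _ _)) hlock x hx)
  have hind : ∀ B : Finset (Fin n), H.IsIndepSet (B : Set (Fin n)) →
      H.IsIndepSet ((B.filter C : Finset (Fin n)) : Set (Fin n)) := by
    intro B hB
    rw [isIndepSet_iff] at hB ⊢
    exact fun x hx y hy => hB x (Finset.mem_filter.1 hx).1 y (Finset.mem_filter.1 hy).1
  have ecomp : ∀ B : Finset (Fin n), compCard H (· ∈ B) v = (B.filter C).card := by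
    intro B
    unfold compCard
    congr 1
    ext x
    simp [C, and_comm]
  have r2 : Reach H (S.filter C) (T.filter C) := by
    refine reach_of_large_core hc hcommon hCadj (fun x y hx hy => hx.symm.trans hy) (hind S hSi)
      (hind T hTi) (hfree S hSl) (hfree T hTl) (fun x hx => (Finset.mem_filter.1 hx).2)
      (fun x hx => (Finset.mem_filter.1 hx).2) ?_
      ((Finset.card_filter_le _ _).trans hS.le)
      (M := Finset.univ.filter fun w => H.Reachable v w ∧ Core H w) (fun w => by simp [C]) hcore
    rw [← ecomp, ← ecomp, hcomp]
  have hAi := isIndepSet_iff.1 (hr.isIndepSet hSi)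
  have r3 : Reach H (S.filter C ∪ A.filter (fun x => ¬ C x)) (T.filter C ∪ A.filter (fun x => ¬ C x)) := by
    refine r2.union (K := C) (fun x hx => (Finset.mem_filter.1 hx).2)
      (fun u v huv => ⟨huv, hCadj u v huv⟩) (fun u v _ _ huv => huv) ?_ ?_
    · exact fun x hx y hy => hAi x (Finset.mem_filter.1 hx).1 y (Finset.mem_filter.1 hy).1
    · intro x hx y hy hxy
      exact (Finset.mem_filter.1 hy).2 (hCadj x y hxy hx)
  have e2 : S.filter C ∪ A.filter (fun x => ¬ C x) = A := by
    ext x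
    simp only [Finset.mem_union, Finset.mem_filter]
    by_cases hx : C x
    · simp [hx, hAS x hx]
    · simp [hx]
  rw [e2] at r3
  have hmem : ∀ x, x ∈ T.filter C ∪ A.filter (fun x => ¬ C x) ↔
      (C x ∧ x ∈ T) ∨ (¬ C x ∧ x ∈ A) := by
    intro x
    simp only [Finset.mem_union, Finset.mem_filter]
    tauto
  refine ih _ ?_ _ rfl (hr.trans r3) ?_ ?_
  · rw [← hm]
    refine Finset.card_lt_card (Finset.ssubset_iff_of_subset ?_ |>.2
      ⟨v, Finset.mem_sdiff.2 ⟨hvA, hvT⟩, ?_⟩)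
    · intro x hx
      rw [Finset.mem_sdiff, hmem] at hx
      rw [Finset.mem_sdiff]
      tauto
    · rw [Finset.mem_sdiff, hmem]
      have : C v := SimpleGraph.Reachable.refl v
      tauto
  · intro x hx
    rw [hmem]
    have := hAU x hx
    tauto
  · intro r
    by_cases hCr : C r
    · right
      intro x hx
      have hCx : C x := hCr.trans hx
      rw [hmem]
      tauto
    · have hCx : ∀ x, H.Reachable r x → ¬ C x := fun x hx h => hCr (h.trans hx.symm)
      rcases hmix r with h | h
      · left
        intro x hx
        rw [hmem, ← h x hx]
        have := hCx x hx
        tauto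
      · right
        intro x hx
        rw [hmem, ← h x hx]
        have := hCx x hx
        tauto

end Twins


/-! ### The largest locked subset and its removal. -/

section LockedPart

variable {n : ℕ} {G : SimpleGraph (Fin n)} {S T : Finset (Fin n)} {k : ℕ}

open Classical in
/-- A shrinking operator on the subsets of an `n`-element set is stationary after `n` steps. -/
theorem iterate_fixed {f : (Fin n → Prop) → Fin n → Prop} (hf : ∀ P u, f P u → P u)
    (P : Fin n → Prop) : f (f^[n] P) = f^[n] P := by
  by_contra hne
  have hne' : ∀ j ≤ n, f (f^[j] P) ≠ f^[j] P := by
    intro j hj he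
    apply hne
    have : f^[n] P = f^[j] P := by
      obtain ⟨d, hd⟩ := Nat.exists_eq_add_of_le' hj
      have : f^[d + j] P = f^[j] P := by
        rw [Function.iterate_add_apply]
        exact Function.iterate_fixed he _
      convert this
    rw [this, he]
  -- Every non-stationary step loses an element, and there are at most `n` elements to lose.
  have key : ∀ j ≤ n + 1, (Finset.univ.filter (f^[j] P)).card + j ≤ n := by
    intro j
    induction j with
    | zero =>
      intro _
      simpa using Finset.card_filter_le (Finset.univ : Finset (Fin n)) (f^[0] P)
    | succ j ih =>
      intro hj
      have h1 := ih (by omega)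
      have h2 : (Finset.univ.filter (f^[j + 1] P)).card < (Finset.univ.filter (f^[j] P)).card := by
        rw [Function.iterate_succ_apply']
        refine Finset.card_lt_card (Finset.ssubset_iff_subset_ne.2 ⟨?_, ?_⟩)
        · intro u hu
          simp only [Finset.mem_filter, Finset.mem_univ, true_and] at hu ⊢
          exact hf _ u hu
        · intro he
          refine hne' j (by omega) (funext fun u => propext ?_)
          have := Finset.ext_iff.1 he u
          simpa using this
      omega
  have := key (n + 1) le_rfl
  omega

/-- Remove the tokens that can move although all tokens of `P` are present. -/
def peelStep (G : SimpleGraph (Fin n)) (P : Fin n → Prop) (u : Fin n) : Prop :=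
  P u ∧ ¬ ∃ w, G.Adj u w ∧ ¬ ∃ x, x ≠ u ∧ P x ∧ G.Adj w x

/-- The largest locked set of tokens. -/
def lockedPart (G : SimpleGraph (Fin n)) (S : Finset (Fin n)) : Fin n → Prop :=
  (peelStep G)^[n] (· ∈ S)

theorem lockedPart_subset {u : Fin n} (h : lockedPart G S u) : u ∈ S := by
  have : ∀ j, (peelStep G)^[j] (· ∈ S) u → u ∈ S := by
    intro j
    induction j with
    | zero => exact id
    | succ j ih =>
      rw [Function.iterate_succ_apply']
      exact fun h => ih h.1
  exact this n h

/-- As long as all of `L` is present, no token of `L` has an exit; so `L` survives every round. -/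
theorem Locked.subset_lockedPart {L : Finset (Fin n)} (hL : Locked G L) (hS : L ⊆ S) {u : Fin n}
    (hu : u ∈ L) : lockedPart G S u := by
  have : ∀ j, ∀ u ∈ L, (peelStep G)^[j] (· ∈ S) u := by
    intro j
    induction j with
    | zero => exact fun u hu => hS hu
    | succ j ih =>
      intro u hu
      rw [Function.iterate_succ_apply']
      refine ⟨ih u hu, ?_⟩
      rintro ⟨w, huw, hno⟩
      obtain ⟨x, hx, hne, hxw⟩ := hL u hu w huw
      exact hno ⟨x, hne, ih x hx, hxw.symm⟩
  exact this n u hu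

/-- The iteration has become stationary, and a fixed point of `peelStep` is a locked set. -/
theorem lockedPart_locked {u w : Fin n} (hu : lockedPart G S u) (huw : G.Adj u w) :
    ∃ x, x ≠ u ∧ lockedPart G S x ∧ G.Adj w x := by
  have h := iterate_fixed (f := peelStep G) (fun P u h => h.1) (· ∈ S)
  have hu' : peelStep G (lockedPart G S) u := by
    have := congrFun h u
    exact this ▸ hu
  by_contra hno
  exact hu'.2 ⟨w, huw, hno⟩

/-- The vertices outside the closed neighbourhood of `R`. -/
def Alive (G : SimpleGraph (Fin n)) (R : Fin n → Prop) (u : Fin n) : Prop :=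
  ¬ R u ∧ ¬ ∃ w, G.Adj u w ∧ R w

open Classical in
theorem lockedFinset_locked : Locked G (Finset.univ.filter (lockedPart G S)) := by
  intro u hu w huw
  obtain ⟨x, hne, hx, hwx⟩ := lockedPart_locked (Finset.mem_filter.1 hu).2 huw
  exact ⟨x, by simpa using hx, hne, hwx.symm⟩

open Classical in
-- The surviving part of `L` together with the locked part of `S` is locked in `G`: a neighbour that
-- was removed is itself next to a locked token. By maximality no surviving vertex of `L` exists, so
-- `L` has no edges in the trimmed graph.
theorem locked_trim {L : Finset (Fin n)} (hLS : L ⊆ S)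
    (hL : Locked (restr G (Alive G (lockedPart G S))) L) :
    ∀ u ∈ L, ∀ w, ¬ (restr G (Alive G (lockedPart G S))).Adj u w := by
  set R := lockedPart G S with hR
  rintro u hu w ⟨huw, hau, haw⟩
  refine hau.1 (Locked.subset_lockedPart (L := L.filter (Alive G R) ∪ Finset.univ.filter R) ?_ ?_ ?_)
  · intro x hx y hxy
    rcases Finset.mem_union.1 hx with hx | hx
    · obtain ⟨hxL, hxa⟩ := Finset.mem_filter.1 hx
      by_cases hy : Alive G R y
      · obtain ⟨x', hx', hne, hx'y⟩ := hL x hxL y ⟨hxy, hxa, hy⟩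
        exact ⟨x', Finset.mem_union_left _ (Finset.mem_filter.2 ⟨hx', hx'y.2.1⟩), hne, hx'y.1⟩
      · by_cases hyR : R y
        · exact absurd ⟨y, hxy, hyR⟩ hxa.2
        · have : ∃ z, G.Adj y z ∧ R z := by
            by_contra hno
            exact hy ⟨hyR, hno⟩
          obtain ⟨z, hyz, hz⟩ := this
          refine ⟨z, Finset.mem_union_right _ (by simpa using hz), ?_, hyz.symm⟩
          rintro rfl
          exact hxa.1 hz
    · obtain ⟨x', hx', hne, hx'y⟩ := lockedFinset_locked x hx y hxy
      exact ⟨x', Finset.mem_union_right _ hx', hne, hx'y⟩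
  · intro x hx
    rcases Finset.mem_union.1 hx with hx | hx
    · exact hLS (Finset.mem_filter.1 hx).1
    · exact lockedPart_subset (Finset.mem_filter.1 hx).2
  · exact Finset.mem_union_left _ (Finset.mem_filter.2 ⟨hu, hau⟩)

theorem lockedPart_eq_of_reach (h : Reach G S T) (u : Fin n) :
    lockedPart G S u ↔ lockedPart G T u := by
  classical
  have key : ∀ {S T : Finset (Fin n)}, Reach G S T → lockedPart G S u → lockedPart G T u := by
    intro S T h hu
    have hS : Finset.univ.filter (lockedPart G S) ⊆ S := fun x hx =>
      lockedPart_subset (Finset.mem_filter.1 hx).2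
    refine lockedFinset_locked.subset_lockedPart (lockedFinset_locked.subset_of_reach h hS)
      (u := u) (by simpa using hu)
  exact ⟨key h, key h.symm⟩

/-- The tokens of the locked part never move, so no slide starts or ends in its closed
neighbourhood. Conversely, a removed vertex that carries a token belongs to the locked part, since
the neighbours of the locked part are blocked; so removed edges hide no conflict. -/
theorem reach_trim_iff (hS : G.IsIndepSet (S : Set (Fin n))) :
    Reach (restr G (Alive G (lockedPart G S))) S T ↔ Reach G S T := by
  classical
  set R := lockedPart G S with hR
  have hRS : Finset.univ.filter R ⊆ S := fun x hx => lockedPart_subset (Finset.mem_filter.1 hx).2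
  constructor
  · intro h
    suffices key : Reach G S T ∧ Finset.univ.filter R ⊆ T from key.1
    induction h with
    | refl => exact ⟨Reach.refl _, hRS⟩
    | @tail A B _ h ih =>
      obtain ⟨hr, hRA⟩ := ih
      have hA := hr.isIndepSet hS
      rw [isIndepSet_iff] at hA
      have hR' : ∀ x, R x → x ∈ A := fun x hx => hRA (by simpa using hx)
      obtain ⟨u, v, Y, rfl, rfl, ⟨huv, hau, hav⟩, hY, hu, hv⟩ := Reach.exists_insert h
      have hRY : ∀ x, R x → x ∈ Y := by
        intro x hx
        rcases Finset.mem_insert.1 (hR' x hx) with rfl | h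
        · exact absurd hx hau.1
        · exact h
      refine ⟨hr.trans (reach_slide ?_ ?_ ?_ huv), ?_⟩
      · exact fun x hx y hy => hA x (Finset.mem_insert_of_mem hx) y (Finset.mem_insert_of_mem hy)
      · exact fun y hy => hA u (Finset.mem_insert_self _ _) y (Finset.mem_insert_of_mem hy)
      · intro y hy hvy
        by_cases hay : Alive G R y
        · exact hv y hy ⟨hvy, hav, hay⟩
        · by_cases hyR : R y
          · exact hav.2 ⟨y, hvy, hyR⟩
          · have : ∃ z, G.Adj y z ∧ R z := by
              by_contra hno
              exact hay ⟨hyR, hno⟩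
            obtain ⟨z, hyz, hz⟩ := this
            exact hA y (Finset.mem_insert_of_mem hy) z (hR' z hz) hyz
      · intro x hx
        exact Finset.mem_insert_of_mem (hRY x (Finset.mem_filter.1 hx).2)
  · intro h
    suffices key : Reach (restr G (Alive G R)) S T ∧ Finset.univ.filter R ⊆ T from key.1
    induction h with
    | refl => exact ⟨Reach.refl _, hRS⟩
    | @tail A B hr' h ih =>
      obtain ⟨hr, hRA⟩ := ih
      have hRB := lockedFinset_locked.subset_of_reach (Relation.ReflTransGen.tail hr' h) hRS
      refine ⟨hr.trans ?_, hRB⟩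
      obtain ⟨hA, hB, u, v, huv, hu, hv, rfl⟩ := h
      rw [isIndepSet_iff] at hA hB
      have hR' : ∀ x, R x → x ∈ A := fun x hx => hRA (by simpa using hx)
      have hR'' : ∀ x, R x → x ∈ insert v (A.erase u) := fun x hx => hRB (by simpa using hx)
      have hau : Alive G R u := by
        refine ⟨fun h => ?_, fun ⟨w, huw, hw⟩ => hA u hu w (hR' w hw) huw⟩
        have := hR'' u h
        simp [huv.ne] at this
      have hav : Alive G R v := ⟨fun h => hv (hR' v h), fun ⟨w, hvw, hw⟩ =>
        hB v (Finset.mem_insert_self _ _) w (hR'' w hw) hvw⟩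
      refine Relation.ReflTransGen.single ⟨?_, ?_, u, v, ⟨huv, hau, hav⟩, hu, hv, rfl⟩
      · rw [isIndepSet_iff]
        exact fun x hx y hy hxy => hA x hx y hy hxy.1
      · rw [isIndepSet_iff]
        exact fun x hx y hy hxy => hB x hx y hy hxy.1

/-- The graph without the rigid vertices of `S` and their neighbours. -/
def trim (G : SimpleGraph (Fin n)) (S : Finset (Fin n)) : SimpleGraph (Fin n) :=
  restr G (Alive G (lockedPart G S))

open Classical in
/-- One of the obvious obstructions to a reconfiguration of `S` into `T`. -/
def Bad (G : SimpleGraph (Fin n)) (S T : Finset (Fin n)) (k : ℕ) : Prop :=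
  (∃ u, ¬ (lockedPart G S u ↔ lockedPart G T u)) ∨
  (∃ r, compCard (trim G S) (· ∈ S) r ≠ compCard (trim G S) (· ∈ T) r) ∨
  (S.filter (Keep (trim G S) S T k)).card ≠ (T.filter (Keep (trim G S) S T k)).card

open Classical in
-- A reconfiguration preserves the locked part and the number of tokens in each component, and
-- projects to the relevant vertices. Conversely, equal locked parts make the trimmed graph valid
-- for `T` too, and equal counts settle the large components.
theorem reach_iff_not_bad_and_reach_keep {c : Fin n → Bool} (hc : ∀ u v, G.Adj u v → c u ≠ c v)
    (hcommon : ∀ a b y z, a ≠ b → G.Adj a y → G.Adj b y → G.Adj a z → G.Adj b z → y = z)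
    (hSi : G.IsIndepSet (S : Set (Fin n))) (hTi : G.IsIndepSet (T : Set (Fin n)))
    (hS : S.card = k) (hT : T.card = k) :
    Reach G S T ↔ ¬ Bad G S T k ∧ Reach (restr (trim G S) (Keep (trim G S) S T k))
      (S.filter (Keep (trim G S) S T k)) (T.filter (Keep (trim G S) S T k)) := by
  have hsub : ∀ u v, (trim G S).Adj u v → G.Adj u v := fun u v h => h.1
  constructor
  · intro h
    have h' := (reach_trim_iff hSi).2 h
    have h'' := reach_keep_of_reach (k := k) h'
    refine ⟨?_, h''⟩
    rintro (⟨u, hu⟩ | ⟨r, hr⟩ | hcard)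
    · exact hu (lockedPart_eq_of_reach h u)
    · exact hr (h'.compCard_eq r).symm
    · exact hcard h''.card_eq.symm
  · rintro ⟨hbad, h⟩
    unfold Bad at hbad
    push Not at hbad
    obtain ⟨h1, h2, -⟩ := hbad
    refine (reach_trim_iff hSi).1 (reach_of_reach_keep (k := k) (c := c) ?_ ?_ ?_ ?_ ?_ ?_ hS hT h2 h)
    · exact fun u v huv => hc u v huv.1
    · exact fun a b y z hab h1 h2 h3 h4 => hcommon a b y z hab h1.1 h2.1 h3.1 h4.1
    · exact isIndepSet_iff.2 fun x hx y hy hxy => isIndepSet_iff.1 hSi x hx y hy hxy.1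
    · exact isIndepSet_iff.2 fun x hx y hy hxy => isIndepSet_iff.1 hTi x hx y hy hxy.1
    · exact fun L hL hlock => locked_trim hL hlock
    · have e : lockedPart G S = lockedPart G T := funext fun u => propext (h1 u)
      intro L hL hlock
      rw [e] at hlock ⊢
      exact locked_trim hL hlock

end LockedPart

/-! ### The output graph and its tokens. -/

section Output

variable {n : ℕ}

open Classical in
/-- The position of `u` among the elements of `K`. -/
noncomputable def rank (K : Fin n → Prop) (u : Fin n) : ℕ :=
  (Finset.univ.filter fun v => v < u ∧ K v).card

open Classical in
/-- The number of elements of `K`. -/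
noncomputable def size (K : Fin n → Prop) : ℕ := (Finset.univ.filter K).card

variable {K : Fin n → Prop}

theorem rank_lt_rank {u v : Fin n} (hu : K u) (huv : u < v) : rank K u < rank K v := by
  classical
  refine Finset.card_lt_card (Finset.ssubset_iff_of_subset ?_ |>.2 ⟨u, ?_, ?_⟩)
  · intro x hx
    simp only [Finset.mem_filter, Finset.mem_univ, true_and] at hx ⊢
    exact ⟨hx.1.trans huv, hx.2⟩
  · simpa using ⟨huv, hu⟩
  · simp

theorem rank_lt_size {u : Fin n} (hu : K u) : rank K u < size K := by
  classical
  refine Finset.card_lt_card (Finset.ssubset_iff_of_subset ?_ |>.2 ⟨u, ?_, ?_⟩)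
  · intro x hx
    simp only [Finset.mem_filter, Finset.mem_univ, true_and] at hx ⊢
    exact hx.2
  · simpa using hu
  · simp

theorem rank_injective {u v : Fin n} (hu : K u) (hv : K v) (h : rank K u = rank K v) : u = v := by
  rcases lt_trichotomy u v with hlt | heq | hlt
  · have := rank_lt_rank hu hlt; omega
  · exact heq
  · have := rank_lt_rank hv hlt; omega

/-- The subgraph induced by `K` on `{0, …, |K| - 1}`, together with two isolated vertices. -/
def outGraph (H : SimpleGraph (Fin n)) (K : Fin n → Prop) : SimpleGraph (Fin (size K + 2)) where
  Adj a b := ∃ x y, K x ∧ K y ∧ H.Adj x y ∧ rank K x = a ∧ rank K y = b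
  symm := ⟨fun _ _ ⟨x, y, hx, hy, h, ha, hb⟩ => ⟨y, x, hy, hx, h.symm, hb, ha⟩⟩
  loopless := ⟨fun _ ⟨_, _, hx, hy, h, ha, hb⟩ => h.ne (rank_injective hx hy (ha.trans hb.symm))⟩

open Classical in
/-- The tokens of `A` in `K`, and a token on the isolated vertex `|K| + i`. -/
noncomputable def outTokens (K : Fin n → Prop) (A : Finset (Fin n)) (i : ℕ) :
    Finset (Fin (size K + 2)) :=
  Finset.univ.filter fun a => (∃ x, K x ∧ x ∈ A ∧ rank K x = a) ∨ (a : ℕ) = size K + i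

variable {H : SimpleGraph (Fin n)}

/-- The position of a vertex of `K` in the output. -/
noncomputable def outVertex (K : Fin n → Prop) (x : Fin n) : Fin (size K + 2) :=
  if h : rank K x < size K + 2 then ⟨rank K x, h⟩ else ⟨0, by omega⟩

theorem outVertex_val {x : Fin n} (hx : K x) : (outVertex K x : ℕ) = rank K x := by
  have := rank_lt_size hx
  unfold outVertex
  rw [dif_pos (by omega)]

theorem outGraph_adj {x y : Fin n} (hx : K x) (hy : K y) :
    (outGraph H K).Adj (outVertex K x) (outVertex K y) ↔ H.Adj x y := by
  constructor
  · rintro ⟨x', y', hx', hy', h, hax, hay⟩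
    rw [outVertex_val hx] at hax
    rw [outVertex_val hy] at hay
    rwa [rank_injective hx' hx hax, rank_injective hy' hy hay] at h
  · exact fun h => ⟨x, y, hx, hy, h, (outVertex_val hx).symm, (outVertex_val hy).symm⟩

theorem outGraph_adj_iff {a b : Fin (size K + 2)} : (outGraph H K).Adj a b ↔
    ∃ x y, K x ∧ K y ∧ H.Adj x y ∧ a = outVertex K x ∧ b = outVertex K y := by
  constructor
  · rintro ⟨x, y, hx, hy, h, ha, hb⟩
    exact ⟨x, y, hx, hy, h, Fin.ext (by rw [outVertex_val hx, ha]),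
      Fin.ext (by rw [outVertex_val hy, hb])⟩
  · rintro ⟨x, y, hx, hy, h, rfl, rfl⟩
    exact (outGraph_adj hx hy).2 h

theorem outVertex_injective {x y : Fin n} (hx : K x) (hy : K y)
    (h : outVertex K x = outVertex K y) : x = y :=
  rank_injective hx hy (by rw [← outVertex_val hx, ← outVertex_val hy, h])

theorem outGraph_color {c : Fin n → Bool} (hc : ∀ u v, H.Adj u v → c u ≠ c v) :
    ∃ c' : Fin (size K + 2) → Bool, ∀ u v, (outGraph H K).Adj u v → c' u ≠ c' v := by
  classical
  have hex : ∀ a : Fin (size K + 2), ∃ i : Bool, ∀ x, K x → outVertex K x = a → c x = i := by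
    intro a
    by_cases h : ∃ x, K x ∧ outVertex K x = a
    · obtain ⟨x, hx, hxa⟩ := h
      exact ⟨c x, fun y hy hya => by rw [outVertex_injective hy hx (hya.trans hxa.symm)]⟩
    · exact ⟨true, fun x hx hxa => absurd ⟨x, hx, hxa⟩ h⟩
  choose c' hc' using hex
  refine ⟨c', fun a b hab => ?_⟩
  obtain ⟨x, y, hx, hy, h, rfl, rfl⟩ := outGraph_adj_iff.1 hab
  rw [← hc' _ x hx rfl, ← hc' _ y hy rfl]
  exact hc x y h

theorem outGraph_common
    (hcommon : ∀ a b y z, a ≠ b → H.Adj a y → H.Adj b y → H.Adj a z → H.Adj b z → y = z) :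
    ∀ a b y z, a ≠ b → (outGraph H K).Adj a y → (outGraph H K).Adj b y →
      (outGraph H K).Adj a z → (outGraph H K).Adj b z → y = z := by
  intro a b y z hab hay hby haz hbz
  obtain ⟨a, y, ha, hy, h1, rfl, rfl⟩ := outGraph_adj_iff.1 hay
  obtain ⟨b, z, hb, hz, h4, rfl, rfl⟩ := outGraph_adj_iff.1 hbz
  rw [outGraph_adj hb hy] at hby
  rw [outGraph_adj ha hz] at haz
  rw [hcommon a b y z (fun e => hab (by rw [e])) h1 hby haz h4]

theorem mem_outTokens {A : Finset (Fin n)} {i : ℕ} {a : Fin (size K + 2)} :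
    a ∈ outTokens K A i ↔ (∃ x, K x ∧ x ∈ A ∧ outVertex K x = a) ∨ (a : ℕ) = size K + i := by
  simp only [outTokens, Finset.mem_filter, Finset.mem_univ, true_and]
  refine or_congr_left (exists_congr fun x => and_congr_right fun hx => and_congr_right fun _ => ?_)
  rw [Fin.ext_iff, outVertex_val hx]

open Classical in
theorem outTokens_eq {A : Finset (Fin n)} {i : ℕ} (hi : size K + i < size K + 2) :
    outTokens K A i = insert ⟨size K + i, hi⟩ ((A.filter K).image (outVertex K)) := by
  ext a
  rw [mem_outTokens, Finset.mem_insert, Finset.mem_image, or_comm, Fin.ext_iff]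
  refine or_congr_right (exists_congr fun x => ?_)
  rw [Finset.mem_filter]
  tauto

open Classical in
theorem card_outTokens {A : Finset (Fin n)} {i : ℕ} (hi : i < 2) :
    (outTokens K A i).card = (A.filter K).card + 1 := by
  rw [outTokens_eq (by omega), Finset.card_insert_of_notMem, Finset.card_image_of_injOn]
  · intro _ hx _ hy h
    exact outVertex_injective (Finset.mem_filter.1 hx).2 (Finset.mem_filter.1 hy).2 h
  · intro h
    obtain ⟨x, hx, he⟩ := Finset.mem_image.1 h
    have hK := (Finset.mem_filter.1 hx).2
    have h1 := congrArg Fin.val he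
    rw [outVertex_val hK] at h1
    have := rank_lt_size hK
    change rank K x = size K + i at h1
    omega

theorem outGraph_not_adj {a b : Fin (size K + 2)} (ha : size K ≤ (a : ℕ)) :
    ¬ (outGraph H K).Adj a b := by
  rintro ⟨x, y, hx, -, -, hxa, -⟩
  have := rank_lt_size hx
  omega

theorem indep_outTokens {A : Finset (Fin n)} {i : ℕ} (hA : H.IsIndepSet (A : Set (Fin n))) :
    (outGraph H K).IsIndepSet (outTokens K A i : Set (Fin (size K + 2))) := by
  rw [isIndepSet_iff] at hA ⊢
  intro a ha b hb hab
  rcases mem_outTokens.1 ha with ⟨x, hx, hxA, rfl⟩ | ha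
  · rcases mem_outTokens.1 hb with ⟨y, hy, hyA, rfl⟩ | hb
    · exact hA x hxA y hyA ((outGraph_adj hx hy).1 hab)
    · exact outGraph_not_adj (by omega) hab.symm
  · exact outGraph_not_adj (by omega) hab

open Classical in
-- The token on an isolated vertex is locked, which forces `i = j`. All other slides translate back
-- and forth along `outVertex`.
theorem reach_outTokens_iff {A B : Finset (Fin n)} {i j : ℕ} (hi : i < 2) (hj : j < 2) :
    Reach (outGraph H K) (outTokens K A i) (outTokens K B j) ↔
      i = j ∧ Reach (restr H K) (A.filter K) (B.filter K) := by
  constructor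
  · intro h
    constructor
    · have hl : Locked (outGraph H K) {⟨size K + i, by omega⟩} := by
        intro u hu w huw
        rw [Finset.mem_singleton] at hu
        subst hu
        exact absurd huw (outGraph_not_adj (by simp))
      have h1 := hl.subset_of_reach h (by
        rw [Finset.singleton_subset_iff, mem_outTokens]
        exact Or.inr rfl)
      rw [Finset.singleton_subset_iff, mem_outTokens] at h1
      rcases h1 with ⟨x, hx, -, he⟩ | h1
      · have h2 := congrArg Fin.val he
        rw [outVertex_val hx] at h2
        change rank K x = size K + i at h2
        have := rank_lt_size hx
        omega
      · change size K + i = size K + j at h1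
        omega
    · let pull : Finset (Fin (size K + 2)) → Finset (Fin n) := fun A' =>
        Finset.univ.filter fun x => K x ∧ outVertex K x ∈ A'
      have hpull : ∀ (A : Finset (Fin n)) i, pull (outTokens K A i) = A.filter K := by
        intro A i
        ext x
        simp only [pull, Finset.mem_filter, Finset.mem_univ, true_and, mem_outTokens]
        constructor
        · rintro ⟨hx, ⟨y, hy, hyA, he⟩ | he⟩
          · rw [← outVertex_injective hy hx he]
            exact ⟨hyA, hy⟩
          · rw [outVertex_val hx] at he
            have := rank_lt_size hx
            omega
        · exact fun ⟨hxA, hx⟩ => ⟨hx, Or.inl ⟨x, hx, hxA, rfl⟩⟩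
      rw [← hpull A i, ← hpull B j]
      generalize outTokens K A i = A' at h
      generalize outTokens K B j = B' at h
      induction h with
      | refl => exact Reach.refl _
      | tail _ hst ih =>
        refine ih.trans ?_
        obtain ⟨a, b, Y, rfl, rfl, hab, hY, ha, hb⟩ := Reach.exists_insert hst
        obtain ⟨x, y, hx, hy, hxy, rfl, rfl⟩ := outGraph_adj_iff.1 hab
        have e : ∀ x, K x → pull (insert (outVertex K x) Y) = insert x (pull Y) := by
          intro x hx
          ext z
          simp only [pull, Finset.mem_filter, Finset.mem_univ, true_and, Finset.mem_insert]
          constructor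
          · rintro ⟨hz, he | hz'⟩
            · exact Or.inl (outVertex_injective hz hx he)
            · exact Or.inr ⟨hz, hz'⟩
          · rintro (rfl | ⟨hz, hz'⟩)
            · exact ⟨hx, Or.inl rfl⟩
            · exact ⟨hz, Or.inr hz'⟩
        have hm : ∀ z ∈ pull Y, K z ∧ outVertex K z ∈ Y := fun z hz => by simpa [pull] using hz
        rw [e x hx, e y hy]
        refine reach_slide ?_ ?_ ?_ ⟨hxy, hx, hy⟩
        · exact fun u hu v hv huv => hY _ (hm u hu).2 _ (hm v hv).2
            ((outGraph_adj (hm u hu).1 (hm v hv).1).2 huv.1)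
        · exact fun v hv huv => ha _ (hm v hv).2 ((outGraph_adj hx (hm v hv).1).2 huv.1)
        · exact fun v hv huv => hb _ (hm v hv).2 ((outGraph_adj hy (hm v hv).1).2 huv.1)
  · rintro ⟨rfl, h⟩
    have hi' : size K + i < size K + 2 := by omega
    rw [outTokens_eq hi', outTokens_eq hi']
    have hA : ∀ x ∈ A.filter K, K x := fun x hx => (Finset.mem_filter.1 hx).2
    generalize A.filter K = A' at h hA
    generalize B.filter K = B' at h
    suffices key : Reach (outGraph H K) (insert ⟨size K + i, hi'⟩ (A'.image (outVertex K)))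
      (insert ⟨size K + i, hi'⟩ (B'.image (outVertex K))) ∧ ∀ x ∈ B', K x from key.1
    induction h with
    | refl => exact ⟨Reach.refl _, hA⟩
    | tail _ hst ih =>
      obtain ⟨hr, hK⟩ := ih
      obtain ⟨u, v, Y, rfl, rfl, ⟨huv, hu, hv⟩, hY, huY, hvY⟩ := Reach.exists_insert hst
      have hKY : ∀ y ∈ Y, K y := fun y hy => hK y (Finset.mem_insert_of_mem hy)
      have hlast : ∀ b, ¬ (outGraph H K).Adj ⟨size K + i, hi'⟩ b := fun b =>
        outGraph_not_adj (by simp)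
      refine ⟨hr.trans ?_, ?_⟩
      · rw [Finset.image_insert, Finset.image_insert, Finset.insert_comm,
          Finset.insert_comm _ (outVertex K v)]
        refine reach_slide ?_ ?_ ?_ ((outGraph_adj hu hv).2 huv)
        · intro a ha b hb hab
          rcases Finset.mem_insert.1 ha with rfl | ha'
          · exact hlast _ hab
          rcases Finset.mem_insert.1 hb with rfl | hb'
          · exact hlast _ hab.symm
          obtain ⟨x, hx, rfl⟩ := Finset.mem_image.1 ha'
          obtain ⟨y, hy, rfl⟩ := Finset.mem_image.1 hb'
          exact hY x hx y hy ⟨(outGraph_adj (hKY x hx) (hKY y hy)).1 hab, hKY x hx, hKY y hy⟩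
        · intro b hb hab
          rcases Finset.mem_insert.1 hb with rfl | hb'
          · exact hlast _ hab.symm
          obtain ⟨y, hy, rfl⟩ := Finset.mem_image.1 hb'
          exact huY y hy ⟨(outGraph_adj hu (hKY y hy)).1 hab, hu, hKY y hy⟩
        · intro b hb hab
          rcases Finset.mem_insert.1 hb with rfl | hb'
          · exact hlast _ hab.symm
          obtain ⟨y, hy, rfl⟩ := Finset.mem_image.1 hb'
          exact hvY y hy ⟨(outGraph_adj hv (hKY y hy)).1 hab, hv, hKY y hy⟩
      · intro x hx
        rcases Finset.mem_insert.1 hx with rfl | hx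
        exacts [hv, hKY x hx]

end Output

/-! ### The kernel as an instance of Token Sliding. -/

section KernelInstance

variable (I : Instance)

/-- The graph of the instance without its rigid part. -/
def Instance.core : SimpleGraph (Fin I.n) := trim I.graph I.S

/-- An instance with an obvious obstruction. -/
def Instance.IsBad : Prop := Bad I.graph I.S I.T I.k

/-- The vertices that remain in the kernel. -/
def Instance.Kept (u : Fin I.n) : Prop := Keep I.core I.S I.T I.k u ∧ ¬ I.IsBad

/-- With an obstruction nothing is kept; without one, the last clause of `Bad` fails. That clause
serves to make the two token sets of the kernel equally large. -/
theorem filter_kept_card_eq [DecidablePred I.Kept] :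
    (I.S.filter I.Kept).card = (I.T.filter I.Kept).card := by
  classical
  by_cases h : I.IsBad
  · have : ∀ u, ¬ I.Kept u := fun u hu => hu.2 h
    rw [Finset.filter_false_of_mem fun u _ => this u, Finset.filter_false_of_mem fun u _ => this u]
  · have h' : ¬ Bad I.graph I.S I.T I.k := h
    unfold Bad at h'
    push Not at h'
    have e : ∀ A : Finset (Fin I.n), A.filter I.Kept = A.filter (Keep (trim I.graph I.S) I.S I.T I.k) := by
      intro A
      ext u
      simp [Instance.Kept, Instance.core, h]
    rw [e, e]
    exact h'.2.2

theorem core_indep {A : Finset (Fin I.n)} (h : I.graph.IsIndepSet (A : Set (Fin I.n))) :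
    I.core.IsIndepSet (A : Set (Fin I.n)) := by
  rw [isIndepSet_iff] at h ⊢
  exact fun x hx y hy hxy => h x hx y hy hxy.1

open Classical in
/-- The kernel. -/
noncomputable def Instance.kernel : Instance where
  n := size I.Kept + 2
  graph := outGraph I.core I.Kept
  S := outTokens I.Kept I.S 0
  -- An obstruction puts the extra tokens of the two sets on different isolated vertices, which
  -- makes a no-instance. The extra token also ensures that the new parameter is positive.
  T := outTokens I.Kept I.T (if I.IsBad then 1 else 0)
  k := (I.S.filter I.Kept).card + 1
  one_le_k := by omega
  indep_S := indep_outTokens (core_indep I I.indep_S)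
  indep_T := indep_outTokens (core_indep I I.indep_T)
  card_S := card_outTokens (by omega)
  card_T := by rw [card_outTokens (by split_ifs <;> omega), filter_kept_card_eq I]

theorem kernel_bipartiteC4Free (h : I.BipartiteC4Free) : I.kernel.BipartiteC4Free := by
  obtain ⟨c, hc⟩ := exists_color h.1
  have hcommon := h.2.common hc
  obtain ⟨c', hc'⟩ := outGraph_color (H := I.core) (K := I.Kept) (c := c)
    fun u v huv => hc u v huv.1
  exact ⟨isBipartite_of_color hc', c4Free_of_common (outGraph_common
    fun a b y z hab h1 h2 h3 h4 => hcommon a b y z hab h1.1 h2.1 h3.1 h4.1)⟩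

theorem kernel_isYes_iff (h : I.BipartiteC4Free) : I.kernel.IsYes ↔ I.IsYes := by
  classical
  obtain ⟨c, hc⟩ := exists_color h.1
  have e1 := reach_iff_not_bad_and_reach_keep (k := I.k) hc (h.2.common hc) I.indep_S I.indep_T
    I.card_S I.card_T
  have e2 := reach_outTokens_iff (H := I.core) (K := I.Kept) (A := I.S) (B := I.T) (i := 0)
    (j := if I.IsBad then 1 else 0) (by omega) (by split_ifs <;> omega)
  refine (Iff.trans ?_ e2).trans (Iff.trans ?_ e1.symm)
  · unfold Instance.IsYes Instance.kernel
    exact Iff.rfl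
  · by_cases hb : I.IsBad
    · have hb' : Bad I.graph I.S I.T I.k := hb
      simp [hb, hb']
    · have hb' : ¬ Bad I.graph I.S I.T I.k := hb
      have hK : I.Kept = Keep (trim I.graph I.S) I.S I.T I.k := by
        funext u
        simp [Instance.Kept, Instance.core, hb]
      simp only [hb, hb', hK, Instance.core, if_false, true_and, not_false_eq_true]

theorem kernel_n_le : I.kernel.n ≤ 42 * I.k ^ 12 := by
  classical
  have h1 : size I.Kept ≤ I.k * (40 * I.k ^ 3) := by
    refine le_trans (Finset.card_le_card ?_)
      (card_keep_le (H := I.core) (S := I.S) (T := I.T) I.card_S.le)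
    intro u hu
    simp only [Finset.mem_filter, Finset.mem_univ, true_and] at hu ⊢
    exact hu.1
  have h2 : I.k * (40 * I.k ^ 3) = 40 * I.k ^ 4 := by ring
  have h3 : I.k ^ 4 ≤ I.k ^ 12 := Nat.pow_le_pow_right I.one_le_k (by norm_num)
  have h4 : 1 ≤ I.k ^ 12 := Nat.one_le_pow _ _ I.one_le_k
  change size I.Kept + 2 ≤ _
  omega

end KernelInstance


/-! ### A small language that compiles to random access machines -/

section Machine

@[simp] theorem State.setReg_reg (s : State) (x c y : ℕ) :
    (s.setReg x c).reg y = if y = x then c else s.reg y := by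
  simp [State.setReg, Function.update_apply]

@[simp] theorem State.setReg_arr (s : State) (x c : ℕ) : (s.setReg x c).arr = s.arr := rfl

theorem State.setArr_arr (s : State) (a i c b j : ℕ) :
    (s.setArr a i c).arr b j = if b = a ∧ j = i then c else s.arr b j := by
  simp only [State.setArr, Function.update_apply]
  split_ifs <;> simp_all

/-- Expressions. The bound variable of a sum ranges over all numbers less than register `0`. -/
inductive Expr where
  | const (c : ℕ) : Expr
  | reg (x : ℕ) : Expr
  | add (e f : Expr) : Expr
  | sub (e f : Expr) : Expr
  | arr (a : ℕ) (e : Expr) : Expr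
  | ite (c e f : Expr) : Expr
  | sum (v : ℕ) (e : Expr) : Expr

namespace Expr

/-- The value of an expression. -/
def eval : Expr → State → ℕ
  | const c, _ => c
  | reg x, s => s.reg x
  | add e f, s => e.eval s + f.eval s
  | sub e f, s => e.eval s - f.eval s
  | arr a e, s => s.arr a (e.eval s)
  | ite c e f, s => if c.eval s ≠ 0 then e.eval s else f.eval s
  | sum v e, s => ∑ i ∈ Finset.range (s.reg 0), e.eval (s.setReg v i)

/-- The registers of an expression are among the first `32` ones, and register `0` is not bound. -/
def wf : Expr → Bool
  | const _ => true
  | reg x => x < 32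
  | add e f => e.wf && f.wf
  | sub e f => e.wf && f.wf
  | arr _ e => e.wf
  | ite c e f => c.wf && e.wf && f.wf
  | sum v e => v < 32 && v != 0 && e.wf

/-- The expression does not read the array `a`. -/
def noArr (a : ℕ) : Expr → Bool
  | const _ => true
  | reg _ => true
  | add e f => e.noArr a && f.noArr a
  | sub e f => e.noArr a && f.noArr a
  | arr b e => b != a && e.noArr a
  | ite c e f => c.noArr a && e.noArr a && f.noArr a
  | sum _ e => e.noArr a

/-- A program that computes the value of the expression in register `d`, and uses only registers
from `d` on. -/
def compile : Expr → ℕ → Prog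
  | const c, d => .const d c
  | reg x, d => .copy d x
  | add e f, d => .seq (e.compile d) (.seq (f.compile (d + 1)) (.plus d d (d + 1)))
  | sub e f, d => .seq (e.compile d) (.seq (f.compile (d + 1)) (.minus d d (d + 1)))
  | arr a e, d => .seq (e.compile d) (.load d a d)
  | ite c e f, d => .seq (c.compile d) (.ite d (e.compile d) (f.compile d))
  | sum v e, d => .seq (.const d 0) (.seq (.copy (d + 1) v) (.seq (.copy (d + 2) 0)
      (.seq (.const (d + 3) 1) (.seq
        (.loop (d + 2) (.seq (.minus v 0 (d + 2)) (.seq (e.compile (d + 4))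
          (.seq (.plus d d (d + 4)) (.minus (d + 2) (d + 2) (d + 3))))))
        (.copy v (d + 1))))))

open Polynomial in
/-- A bound for the running time, in terms of register `0`. -/
noncomputable def cost : Expr → Polynomial ℕ
  | const _ => 1
  | reg _ => 1
  | add e f => e.cost + f.cost + 1
  | sub e f => e.cost + f.cost + 1
  | arr _ e => e.cost + 1
  | ite c e f => c.cost + e.cost + f.cost + 1
  | sum _ e => X * (e.cost + 4) + 6

end Expr

/-- The states agree on the arrays and on the first `d` registers. -/
def Agree (d : ℕ) (s s' : State) : Prop := s.arr = s'.arr ∧ ∀ x < d, s.reg x = s'.reg x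

theorem Agree.trans {d : ℕ} {s s' s'' : State} (h : Agree d s s') (h' : Agree d s' s'') :
    Agree d s s'' := ⟨h.1.trans h'.1, fun x hx => (h.2 x hx).trans (h'.2 x hx)⟩

theorem Agree.mono {d d' : ℕ} {s s' : State} (h : Agree d s s') (hd : d' ≤ d) : Agree d' s s' :=
  ⟨h.1, fun x hx => h.2 x (hx.trans_le hd)⟩

theorem Agree.setReg {d : ℕ} {s s' : State} (h : Agree d s s') (v i : ℕ) :
    Agree d (s.setReg v i) (s'.setReg v i) := by
  refine ⟨h.1, fun x hx => ?_⟩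
  simp only [State.setReg_reg]
  split_ifs
  exacts [rfl, h.2 x hx]

theorem Agree.setReg_left {d y : ℕ} (s : State) (hy : d ≤ y) (c : ℕ) : Agree d (s.setReg y c) s := by
  refine ⟨rfl, fun x hx => ?_⟩
  rw [State.setReg_reg, if_neg (by omega)]

-- Bookkeeping registers start at `32`, so they do not influence the values of well-formed
-- expressions.
theorem Expr.eval_congr {e : Expr} (he : e.wf = true) {s s' : State} (h : Agree 32 s s') :
    e.eval s = e.eval s' := by
  induction e generalizing s s' with
  | const c => rfl
  | reg x => exact h.2 x (by simpa [wf] using he)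
  | add e f ihe ihf =>
    simp only [wf, Bool.and_eq_true] at he
    simp only [eval, ihe he.1 h, ihf he.2 h]
  | sub e f ihe ihf =>
    simp only [wf, Bool.and_eq_true] at he
    simp only [eval, ihe he.1 h, ihf he.2 h]
  | arr a e ihe =>
    simp only [eval, ihe he h, h.1]
  | ite c e f ihc ihe ihf =>
    simp only [wf, Bool.and_eq_true] at he
    simp only [eval, ihc he.1.1 h, ihe he.1.2 h, ihf he.2 h]
  | sum v e ihe =>
    simp only [wf, Bool.and_eq_true] at he
    simp only [eval, h.2 0 (by omega)]
    exact Finset.sum_congr rfl fun i _ => ihe he.2 (h.setReg v i)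

theorem Expr.eval_noArr {e : Expr} {a : ℕ} (he : e.noArr a = true) {s s' : State}
    (hreg : s.reg = s'.reg) (harr : ∀ b ≠ a, s.arr b = s'.arr b) : e.eval s = e.eval s' := by
  induction e generalizing s s' with
  | const c => rfl
  | reg x => simp only [eval, hreg]
  | add e f ihe ihf =>
    simp only [noArr, Bool.and_eq_true] at he
    simp only [eval, ihe he.1 hreg harr, ihf he.2 hreg harr]
  | sub e f ihe ihf =>
    simp only [noArr, Bool.and_eq_true] at he
    simp only [eval, ihe he.1 hreg harr, ihf he.2 hreg harr]
  | arr b e ihe =>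
    simp only [noArr, Bool.and_eq_true, bne_iff_ne] at he
    simp only [eval, ihe he.2 hreg harr, harr b he.1]
  | ite c e f ihc ihe ihf =>
    simp only [noArr, Bool.and_eq_true] at he
    simp only [eval, ihc he.1.1 hreg harr, ihe he.1.2 hreg harr, ihf he.2 hreg harr]
  | sum v e ihe =>
    simp only [eval, hreg]
    refine Finset.sum_congr rfl fun i _ => ihe he ?_ harr
    funext y
    simp only [State.setReg_reg, hreg]

/-- Later parts of an expression are computed in higher registers, so earlier results survive. In a
sum a counter runs down from `n` to `0` while the bound variable is recomputed as the difference,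
and the old value of that variable is saved and put back at the end. -/
theorem Expr.exec_compile {e : Expr} (he : e.wf = true) (d : ℕ) (hd : 32 ≤ d) (s : State) :
    ∃ s' t, Exec (e.compile d) s s' t ∧ Agree d s' s ∧ s'.reg d = e.eval s ∧
      t ≤ e.cost.eval (s.reg 0) := by
  induction e generalizing d s with
  | const c =>
    refine ⟨_, _, Exec.const s d c, ⟨rfl, fun x hx => ?_⟩, by simp [eval], by simp [cost]⟩
    simp [hx.ne]
  | reg x =>
    refine ⟨_, _, Exec.copy s d x, ⟨rfl, fun x hx => ?_⟩, by simp [eval], by simp [cost]⟩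
    simp [hx.ne]
  | add e f ihe ihf =>
    simp only [wf, Bool.and_eq_true] at he
    obtain ⟨s1, t1, h1, a1, v1, c1⟩ := ihe he.1 d hd s
    obtain ⟨s2, t2, h2, a2, v2, c2⟩ := ihf he.2 (d + 1) (by omega) s1
    refine ⟨_, _, Exec.seq h1 (Exec.seq h2 (Exec.plus s2 d d (d + 1))), ?_, ?_, ?_⟩
    · exact (Agree.setReg_left _ le_rfl _).trans ((a2.mono (Nat.le_succ d)).trans a1)
    · simp only [State.setReg_reg, if_true, eval]
      rw [a2.2 d (by omega), v1, v2, eval_congr he.2 (a1.mono hd)]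
    · rw [a1.2 0 (by omega)] at c2
      simp only [cost, Polynomial.eval_add, Polynomial.eval_one]
      omega
  | sub e f ihe ihf =>
    simp only [wf, Bool.and_eq_true] at he
    obtain ⟨s1, t1, h1, a1, v1, c1⟩ := ihe he.1 d hd s
    obtain ⟨s2, t2, h2, a2, v2, c2⟩ := ihf he.2 (d + 1) (by omega) s1
    refine ⟨_, _, Exec.seq h1 (Exec.seq h2 (Exec.minus s2 d d (d + 1))), ?_, ?_, ?_⟩
    · exact (Agree.setReg_left _ le_rfl _).trans ((a2.mono (Nat.le_succ d)).trans a1)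
    · simp only [State.setReg_reg, if_true, eval]
      rw [a2.2 d (by omega), v1, v2, eval_congr he.2 (a1.mono hd)]
    · rw [a1.2 0 (by omega)] at c2
      simp only [cost, Polynomial.eval_add, Polynomial.eval_one]
      omega
  | arr a e ihe =>
    obtain ⟨s1, t1, h1, a1, v1, c1⟩ := ihe he d hd s
    refine ⟨_, _, Exec.seq h1 (Exec.load s1 d a d), ?_, ?_, ?_⟩
    · exact (Agree.setReg_left _ le_rfl _).trans a1
    · simp only [State.setReg_reg, if_true, eval, v1, a1.1]
    · simp only [cost, Polynomial.eval_add, Polynomial.eval_one]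
      omega
  | ite c e f ihc ihe ihf =>
    simp only [wf, Bool.and_eq_true] at he
    obtain ⟨s1, t1, h1, a1, v1, c1⟩ := ihc he.1.1 d hd s
    by_cases hc : c.eval s ≠ 0
    · obtain ⟨s2, t2, h2, a2, v2, c2⟩ := ihe he.1.2 d hd s1
      refine ⟨_, _, Exec.seq h1 (Exec.ite_then (by rwa [v1]) h2), a2.trans a1, ?_, ?_⟩
      · simp only [eval, if_pos hc]
        rw [v2, eval_congr he.1.2 (a1.mono hd)]
      · rw [a1.2 0 (by omega)] at c2
        simp only [cost, Polynomial.eval_add, Polynomial.eval_one]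
        omega
    · obtain ⟨s2, t2, h2, a2, v2, c2⟩ := ihf he.2 d hd s1
      refine ⟨_, _, Exec.seq h1 (Exec.ite_else (by rw [v1]; exact not_not.1 hc) h2), a2.trans a1, ?_, ?_⟩
      · simp only [eval, if_neg hc]
        rw [v2, eval_congr he.2 (a1.mono hd)]
      · rw [a1.2 0 (by omega)] at c2
        simp only [cost, Polynomial.eval_add, Polynomial.eval_one]
        omega
  | sum v e ihe =>
    simp only [wf, Bool.and_eq_true, decide_eq_true_eq, bne_iff_ne] at he
    obtain ⟨⟨hv, hv0⟩, he⟩ := he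
    set n := s.reg 0 with hn
    set body : Prog := .seq (.minus v 0 (d + 2)) (.seq (e.compile (d + 4))
          (.seq (.plus d d (d + 4)) (.minus (d + 2) (d + 2) (d + 3)))) with hbody
    -- Invariant with `m` rounds to go: the first `n - m` terms have been added up. A round costs
    -- four steps besides the evaluation of the term.
    have hloop : ∀ m ≤ n, ∀ s1 : State, s1.arr = s.arr → (∀ x < d, x ≠ v → s1.reg x = s.reg x) →
        s1.reg d = ∑ i ∈ Finset.range (n - m), e.eval (s.setReg v i) → s1.reg (d + 1) = s.reg v →
        s1.reg (d + 2) = m → s1.reg (d + 3) = 1 → ∃ s2 t, Exec (.loop (d + 2) body) s1 s2 t ∧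
          s2.arr = s.arr ∧ (∀ x < d, x ≠ v → s2.reg x = s.reg x) ∧
          s2.reg d = ∑ i ∈ Finset.range n, e.eval (s.setReg v i) ∧ s2.reg (d + 1) = s.reg v ∧
          t ≤ m * (e.cost.eval n + 4) + 1 := by
      intro m
      induction m with
      | zero =>
        intro _ s1 h1 h2 h3 h4 h5 _
        exact ⟨s1, 1, Exec.loop_stop h5, h1, h2, h3, h4, by omega⟩
      | succ m ihm =>
        intro hm s1 h1 h2 h3 h4 h5 h6
        have h0 : s1.reg 0 = n := h2 0 (by omega) hv0.symm
        set i := n - (m + 1) with hi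
        set sa := s1.setReg v (s1.reg 0 - s1.reg (d + 2)) with hsa
        have hsai : sa = s1.setReg v i := by rw [hsa, h0, h5]
        have hag : Agree d sa (s.setReg v i) := by
          rw [hsai]
          refine ⟨h1, fun x hx => ?_⟩
          simp only [State.setReg_reg]
          split_ifs with hxv
          exacts [rfl, h2 x hx hxv]
        obtain ⟨sb, t, hb, ab, vb, cb⟩ := ihe he (d + 4) (by omega) sa
        have hsa_big : ∀ x, d ≤ x → sa.reg x = s1.reg x := by
          intro x hx
          rw [hsai, State.setReg_reg, if_neg (by omega)]
        set sc := sb.setReg d (sb.reg d + sb.reg (d + 4)) with hsc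
        set sd := sc.setReg (d + 2) (sc.reg (d + 2) - sc.reg (d + 3)) with hsd
        have hsc_reg : ∀ x, x < d + 4 → x ≠ d → sc.reg x = sa.reg x := by
          intro x hx hxd
          rw [hsc, State.setReg_reg, if_neg hxd, ab.2 x hx]
        have hsd_reg : ∀ x, x < d + 4 → x ≠ d → x ≠ d + 2 → sd.reg x = sa.reg x := by
          intro x hx hxd hxd2
          rw [hsd, State.setReg_reg, if_neg hxd2, hsc_reg x hx hxd]
        have hsum : sd.reg d = ∑ i ∈ Finset.range (n - m), e.eval (s.setReg v i) := by
          have : n - m = i + 1 := by omega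
          rw [hsd, State.setReg_reg, if_neg (by omega), hsc, State.setReg_reg, if_pos rfl, vb,
            ab.2 d (by omega), hsa_big d le_rfl, h3, this, Finset.sum_range_succ,
            eval_congr he (hag.mono hd)]
        obtain ⟨s2, t', hl, r1, r2, r3, r4, r5⟩ := ihm (by omega) sd (by
            change sb.arr = s.arr
            rw [ab.1]; exact h1)
          (fun x hx hxv => by
            rw [hsd_reg x (by omega) (by omega) (by omega), hsai, State.setReg_reg, if_neg hxv,
              h2 x hx hxv]) hsum
          (by rw [hsd_reg _ (by omega) (by omega) (by omega), hsa_big _ (by omega), h4])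
          (by
            rw [hsd, State.setReg_reg, if_pos rfl, hsc_reg _ (by omega) (by omega),
              hsc_reg _ (by omega) (by omega), hsa_big _ (by omega), hsa_big _ (by omega), h5, h6]
            rfl)
          (by rw [hsd_reg _ (by omega) (by omega) (by omega), hsa_big _ (by omega), h6])
        have hsa0 : sa.reg 0 = n := by rw [hsai, State.setReg_reg, if_neg hv0.symm, h0]
        rw [hsa0] at cb
        refine ⟨s2, _, Exec.loop_again (by omega) (Exec.seq (Exec.minus s1 v 0 (d + 2))
          (Exec.seq hb (Exec.seq (Exec.plus sb d d (d + 4)) (Exec.minus sc (d + 2) (d + 2) (d + 3)))))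
          hl, r1, r2, r3, r4, ?_⟩
        rw [Nat.succ_mul]
        omega
    set s1 := (((s.setReg d 0).setReg (d + 1) ((s.setReg d 0).reg v)).setReg (d + 2)
      (((s.setReg d 0).setReg (d + 1) ((s.setReg d 0).reg v)).reg 0)).setReg (d + 3) 1 with hs1
    obtain ⟨s2, t, hl, r1, r2, r3, r4, r5⟩ := hloop n le_rfl s1 rfl (by
        intro x hx hxv
        simp only [hs1, State.setReg_reg]
        rw [if_neg (by omega), if_neg (by omega), if_neg (by omega), if_neg (by omega)])
      (by simp [hs1]) (by
        simp only [hs1, State.setReg_reg]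
        rw [if_neg (by omega), if_neg (by omega), if_pos trivial, if_neg (by omega)])
      (by
        simp only [hs1, State.setReg_reg]
        rw [if_neg (by omega), if_pos trivial, if_neg (by omega), if_neg (by omega)])
      (by simp [hs1])
    refine ⟨_, _, Exec.seq (Exec.const s d 0) (Exec.seq (Exec.copy _ (d + 1) v)
      (Exec.seq (Exec.copy _ (d + 2) 0) (Exec.seq (Exec.const _ (d + 3) 1)
        (Exec.seq hl (Exec.copy s2 v (d + 1)))))), ⟨r1, fun x hx => ?_⟩, ?_, ?_⟩
    · simp only [State.setReg_reg]
      split_ifs with hxv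
      · rw [r4, hxv]
      · exact r2 x hx hxv
    · rw [State.setReg_reg, if_neg (by omega), r3]
      rfl
    · simp only [cost, Polynomial.eval_add, Polynomial.eval_mul, Polynomial.eval_X,
        Polynomial.eval_ofNat]
      omega

/-- Statements. In a loop the variable runs over all numbers less than register `0`. -/
inductive Stmt where
  | assign (x : ℕ) (e : Expr) : Stmt
  | store (a : ℕ) (e f : Expr) : Stmt
  | seq (p q : Stmt) : Stmt
  | ite (e : Expr) (p : Stmt) : Stmt
  | iter (v : ℕ) (p : Stmt) : Stmt

/-- `m` rounds of a loop. -/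
def rounds (b : State → State) (v : ℕ) : ℕ → State → State
  | 0, s => s
  | m + 1, s => b ((rounds b v m s).setReg v m)

namespace Stmt

/-- The effect of a statement. -/
def run : Stmt → State → State
  | assign x e, s => s.setReg x (e.eval s)
  | store a e f, s => s.setArr a (e.eval s) (f.eval s)
  | seq p q, s => q.run (p.run s)
  | ite e p, s => if e.eval s ≠ 0 then p.run s else s
  | iter v p, s => (rounds p.run v (s.reg 0) s).setReg v (s.reg v)

/-- The registers of a statement are among the first `32` ones, and register `0` is constant. -/
def wf : Stmt → Bool
  | assign x e => x < 32 && x != 0 && e.wf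
  | store _ e f => e.wf && f.wf
  | seq p q => p.wf && q.wf
  | ite e p => e.wf && p.wf
  | iter v p => v < 32 && v != 0 && p.wf

/-- A program with the effect of the statement, that uses the registers from `d` on for its
bookkeeping. -/
def compile : Stmt → ℕ → Prog
  | assign x e, d => .seq (e.compile d) (.copy x d)
  | store a e f, d => .seq (e.compile d) (.seq (f.compile (d + 1)) (.store a d (d + 1)))
  | seq p q, d => .seq (p.compile d) (q.compile d)
  | ite e p, d => .seq (e.compile d) (.ite d (p.compile d) .skip)
  | iter v p, d => .seq (.copy d v) (.seq (.copy (d + 1) 0)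
      (.seq (.const (d + 2) 1) (.seq
        (.loop (d + 1) (.seq (.minus v 0 (d + 1)) (.seq (p.compile (d + 3))
          (.minus (d + 1) (d + 1) (d + 2)))))
        (.copy v d))))

open Polynomial in
/-- A bound for the running time, in terms of register `0`. -/
noncomputable def cost : Stmt → Polynomial ℕ
  | assign _ e => e.cost + 1
  | store _ e f => e.cost + f.cost + 1
  | seq p q => p.cost + q.cost
  | ite e p => e.cost + p.cost + 2
  | iter _ p => X * (p.cost + 3) + 6

theorem run_reg_zero {p : Stmt} (hp : p.wf = true) (s : State) : (p.run s).reg 0 = s.reg 0 := by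
  induction p generalizing s with
  | assign x e =>
    simp only [wf, Bool.and_eq_true, bne_iff_ne] at hp
    simp [run, hp.1.2.symm]
  | store a e f => rfl
  | seq p q ihp ihq =>
    simp only [wf, Bool.and_eq_true] at hp
    simp only [run]
    rw [ihq hp.2, ihp hp.1]
  | ite e p ih =>
    simp only [wf, Bool.and_eq_true] at hp
    simp only [run]
    split_ifs
    exacts [ih hp.2 s, rfl]
  | iter v p ih =>
    simp only [wf, Bool.and_eq_true, bne_iff_ne] at hp
    have hr : ∀ m s, (rounds p.run v m s).reg 0 = s.reg 0 := by
      intro m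
      induction m with
      | zero => exact fun _ => rfl
      | succ m ihm =>
        intro s
        simp only [rounds]
        rw [ih hp.2, State.setReg_reg, if_neg hp.1.2.symm, ihm]
    simp only [run, State.setReg_reg]
    rw [if_neg hp.1.2.symm, hr]

theorem run_reg_of_le {p : Stmt} (hp : p.wf = true) (s : State) {x : ℕ} (hx : 32 ≤ x) :
    (p.run s).reg x = s.reg x := by
  induction p generalizing s with
  | assign y e =>
    simp only [wf, Bool.and_eq_true, decide_eq_true_eq] at hp
    simp only [run, State.setReg_reg]
    rw [if_neg (by omega)]
  | store a e f => rfl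
  | seq p q ihp ihq =>
    simp only [wf, Bool.and_eq_true] at hp
    simp only [run]
    rw [ihq hp.2, ihp hp.1]
  | ite e p ih =>
    simp only [wf, Bool.and_eq_true] at hp
    simp only [run]
    split_ifs
    exacts [ih hp.2 s, rfl]
  | iter v p ih =>
    simp only [wf, Bool.and_eq_true, decide_eq_true_eq] at hp
    have hr : ∀ m s, (rounds p.run v m s).reg x = s.reg x := by
      intro m
      induction m with
      | zero => exact fun _ => rfl
      | succ m ihm =>
        intro s
        simp only [rounds]
        rw [ih hp.2, State.setReg_reg, if_neg (by omega), ihm]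
    simp only [run, State.setReg_reg]
    rw [if_neg (by omega), hr]

theorem run_congr {p : Stmt} (hp : p.wf = true) {d : ℕ} (hd : 32 ≤ d) {s s' : State}
    (h : Agree d s s') : Agree d (p.run s) (p.run s') := by
  induction p generalizing s s' with
  | assign x e =>
    simp only [wf, Bool.and_eq_true] at hp
    simp only [run]
    rw [Expr.eval_congr hp.2 (h.mono hd)]
    exact h.setReg _ _
  | store a e f =>
    simp only [wf, Bool.and_eq_true] at hp
    simp only [run]
    rw [Expr.eval_congr hp.1 (h.mono hd), Expr.eval_congr hp.2 (h.mono hd)]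
    refine ⟨?_, h.2⟩
    simp only [State.setArr, h.1]
  | seq p q ihp ihq =>
    simp only [wf, Bool.and_eq_true] at hp
    exact ihq hp.2 (ihp hp.1 h)
  | ite e p ih =>
    simp only [wf, Bool.and_eq_true] at hp
    simp only [run]
    rw [Expr.eval_congr hp.1 (h.mono hd)]
    split_ifs
    exacts [ih hp.2 h, h]
  | iter v p ih =>
    simp only [wf, Bool.and_eq_true, decide_eq_true_eq] at hp
    have hr : ∀ m, Agree d (rounds p.run v m s) (rounds p.run v m s') := by
      intro m
      induction m with
      | zero => exact h
      | succ m ihm => exact ih hp.2 (ihm.setReg _ _)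
    simp only [run]
    rw [h.2 0 (by omega), h.2 v (by omega)]
    exact (hr _).setReg _ _

/-- A loop is compiled like a sum. Only agreement below `d` is claimed, as the registers from `d` on
are scratch; `run_congr` shows that scratch contents do not matter to later statements. -/
theorem exec_compile {p : Stmt} (hp : p.wf = true) (d : ℕ) (hd : 32 ≤ d) (s : State) :
    ∃ s' t, Exec (p.compile d) s s' t ∧ Agree d s' (p.run s) ∧ t ≤ p.cost.eval (s.reg 0) := by
  induction p generalizing d s with
  | assign x e =>
    simp only [wf, Bool.and_eq_true, decide_eq_true_eq] at hp
    obtain ⟨s1, t1, h1, a1, v1, c1⟩ := Expr.exec_compile hp.2 d hd s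
    refine ⟨_, _, Exec.seq h1 (Exec.copy s1 x d), ?_, ?_⟩
    · rw [v1]
      exact a1.setReg _ _
    · simp only [cost, Polynomial.eval_add, Polynomial.eval_one]
      omega
  | store a e f =>
    simp only [wf, Bool.and_eq_true] at hp
    obtain ⟨s1, t1, h1, a1, v1, c1⟩ := Expr.exec_compile hp.1 d hd s
    obtain ⟨s2, t2, h2, a2, v2, c2⟩ := Expr.exec_compile hp.2 (d + 1) (by omega) s1
    have a3 := (a2.mono (Nat.le_succ d)).trans a1
    refine ⟨_, _, Exec.seq h1 (Exec.seq h2 (Exec.store s2 a d (d + 1))), ?_, ?_⟩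
    · rw [v2, a2.2 d (by omega), v1, Expr.eval_congr hp.2 (a1.mono hd)]
      refine ⟨?_, a3.2⟩
      simp only [State.setArr, run, a3.1]
    · rw [a1.2 0 (by omega)] at c2
      simp only [cost, Polynomial.eval_add, Polynomial.eval_one]
      omega
  | seq p q ihp ihq =>
    simp only [wf, Bool.and_eq_true] at hp
    obtain ⟨s1, t1, h1, a1, c1⟩ := ihp hp.1 d hd s
    obtain ⟨s2, t2, h2, a2, c2⟩ := ihq hp.2 d hd s1
    refine ⟨_, _, Exec.seq h1 h2, a2.trans (run_congr hp.2 hd a1), ?_⟩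
    rw [a1.2 0 (by omega), run_reg_zero hp.1] at c2
    simp only [cost, Polynomial.eval_add]
    omega
  | ite e p ih =>
    simp only [wf, Bool.and_eq_true] at hp
    obtain ⟨s1, t1, h1, a1, v1, c1⟩ := Expr.exec_compile hp.1 d hd s
    by_cases hc : e.eval s ≠ 0
    · obtain ⟨s2, t2, h2, a2, c2⟩ := ih hp.2 d hd s1
      refine ⟨_, _, Exec.seq h1 (Exec.ite_then (by rwa [v1]) h2), ?_, ?_⟩
      · simp only [run, if_pos hc]
        exact a2.trans (run_congr hp.2 hd a1)
      · rw [a1.2 0 (by omega)] at c2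
        simp only [cost, Polynomial.eval_add, Polynomial.eval_ofNat]
        omega
    · refine ⟨_, _, Exec.seq h1 (Exec.ite_else (by rw [v1]; exact not_not.1 hc) (Exec.skip s1)), ?_, ?_⟩
      · simp only [run, if_neg hc]
        exact a1
      · simp only [cost, Polynomial.eval_add, Polynomial.eval_ofNat]
        omega
  | iter v p ih =>
    have hp' := hp
    simp only [wf, Bool.and_eq_true, decide_eq_true_eq, bne_iff_ne] at hp
    obtain ⟨⟨hv, hv0⟩, hp⟩ := hp
    set n := s.reg 0 with hn
    set body : Prog := .seq (.minus v 0 (d + 1)) (.seq (p.compile (d + 3))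
          (.minus (d + 1) (d + 1) (d + 2))) with hbody
    have hr0 : ∀ m, (rounds p.run v m s).reg 0 = n := by
      intro m
      induction m with
      | zero => rfl
      | succ m ihm =>
        simp only [rounds]
        rw [run_reg_zero hp, State.setReg_reg, if_neg hv0.symm, ihm]
    have hloop : ∀ m ≤ n, ∀ s1 : State, Agree d s1 (rounds p.run v (n - m) s) →
        s1.reg d = s.reg v → s1.reg (d + 1) = m → s1.reg (d + 2) = 1 →
        ∃ s2 t, Exec (.loop (d + 1) body) s1 s2 t ∧ Agree d s2 (rounds p.run v n s) ∧
          s2.reg d = s.reg v ∧ t ≤ m * (p.cost.eval n + 3) + 1 := by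
      intro m
      induction m with
      | zero =>
        intro _ s1 h1 h2 h3 _
        exact ⟨s1, 1, Exec.loop_stop h3, h1, h2, by omega⟩
      | succ m ihm =>
        intro hm s1 h1 h2 h3 h4
        have h0 : s1.reg 0 = n := by rw [h1.2 0 (by omega), hr0]
        set sa := s1.setReg v (s1.reg 0 - s1.reg (d + 1)) with hsa
        have hsai : sa = s1.setReg v (n - (m + 1)) := by rw [hsa, h0, h3]
        have hsa_big : ∀ x, d ≤ x → sa.reg x = s1.reg x := by
          intro x hx
          rw [hsa, State.setReg_reg, if_neg (by omega)]
        obtain ⟨sb, t, hb, ab, cb⟩ := ih hp (d + 3) (by omega) sa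
        have hsb : ∀ x, d ≤ x → x < d + 3 → sb.reg x = s1.reg x := by
          intro x hx hx'
          rw [ab.2 x hx', run_reg_of_le hp _ (by omega), hsa_big x hx]
        set sc := sb.setReg (d + 1) (sb.reg (d + 1) - sb.reg (d + 2)) with hsc
        have hagree : Agree d sc (rounds p.run v (n - m) s) := by
          have e : n - m = (n - (m + 1)) + 1 := by omega
          rw [e]
          refine (Agree.setReg_left sb (by omega) _).trans
            ((ab.mono (by omega)).trans (run_congr hp hd ?_))
          rw [hsai]
          exact h1.setReg _ _
        obtain ⟨s2, t', hl, r1, r2, r3⟩ := ihm (by omega) sc hagree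
          (by rw [hsc, State.setReg_reg, if_neg (by omega), hsb d le_rfl (by omega), h2])
          (by
            rw [hsc, State.setReg_reg, if_pos rfl, hsb _ (by omega) (by omega),
              hsb _ (by omega) (by omega), h3, h4]
            rfl)
          (by rw [hsc, State.setReg_reg, if_neg (by omega), hsb _ (by omega) (by omega), h4])
        have hsa0 : sa.reg 0 = n := by rw [hsa, State.setReg_reg, if_neg hv0.symm, h0]
        rw [hsa0] at cb
        refine ⟨s2, _, Exec.loop_again (by omega) (Exec.seq (Exec.minus s1 v 0 (d + 1))
          (Exec.seq hb (Exec.minus sb (d + 1) (d + 1) (d + 2)))) hl, r1, r2, ?_⟩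
        rw [Nat.succ_mul]
        omega
    set s0 := s.setReg d (s.reg v) with hs0
    set s1 := (s0.setReg (d + 1) (s0.reg 0)).setReg (d + 2) 1 with hs1
    have hs00 : s0.reg 0 = n := by
      rw [hs0, State.setReg_reg, if_neg (by omega)]
    obtain ⟨s2, t, hl, r1, r2, r3⟩ := hloop n le_rfl s1
      (by
        rw [Nat.sub_self]
        exact (Agree.setReg_left _ (by omega) _).trans ((Agree.setReg_left _ (by omega) _).trans
          (Agree.setReg_left _ (by omega) _)))
      (by simp [hs1, hs0])
      (by simp [hs1, hs00]) (by simp [hs1])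
    refine ⟨_, _, Exec.seq (Exec.copy s d v) (Exec.seq (Exec.copy _ (d + 1) 0)
      (Exec.seq (Exec.const _ (d + 2) 1) (Exec.seq hl (Exec.copy s2 v d)))), ?_, ?_⟩
    · rw [r2]
      exact r1.setReg _ _
    · simp only [cost, Polynomial.eval_add, Polynomial.eval_mul, Polynomial.eval_X,
        Polynomial.eval_ofNat]
      omega

end Stmt

end Machine


/-! ### Logical connectives, counting, and filling arrays. -/

section Language

namespace Expr

/-- The expression is true, that is, not zero. -/
def tr (e : Expr) (s : State) : Prop := e.eval s ≠ 0

/-- Negation. -/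
def neg (e : Expr) : Expr := ite e (const 0) (const 1)

/-- Conjunction. -/
def conj (e f : Expr) : Expr := ite e f (const 0)

/-- Disjunction. -/
def disj (e f : Expr) : Expr := ite e (const 1) f

/-- Existential quantification over the numbers less than register `0`. -/
def ex (v : ℕ) (e : Expr) : Expr := sum v e

/-- The values are different. -/
def ne (e f : Expr) : Expr := add (sub e f) (sub f e)

/-- The first value is less than the second one. -/
def lt (e f : Expr) : Expr := sub f e

/-- The truth value of `e`. -/
def ind (e : Expr) : Expr := ite e (const 1) (const 0)

/-- The number of values of the variable for which `e` is true. -/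
def cnt (v : ℕ) (e : Expr) : Expr := sum v (ind e)

/-- Product, if the first factor is at most the content of register `0`. -/
def mul (e f : Expr) : Expr := sum 31 (ite (sub e (reg 31)) f (const 0))

/-- An entry of an array. -/
def rd (a x : ℕ) : Expr := arr a (reg x)

/-- An entry of a square matrix that is stored row by row. -/
def rd2 (a x y : ℕ) : Expr := arr a (add (mul (reg x) (reg 0)) (reg y))

theorem tr_neg (e : Expr) (s : State) : (neg e).tr s ↔ ¬ e.tr s := by
  by_cases h : e.eval s = 0 <;> simp [tr, neg, eval, h]

theorem tr_conj (e f : Expr) (s : State) : (conj e f).tr s ↔ e.tr s ∧ f.tr s := by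
  by_cases h : e.eval s = 0 <;> simp [tr, conj, eval, h]

theorem tr_disj (e f : Expr) (s : State) : (disj e f).tr s ↔ e.tr s ∨ f.tr s := by
  by_cases h : e.eval s = 0 <;> simp [tr, disj, eval, h]

theorem tr_ne (e f : Expr) (s : State) : (ne e f).tr s ↔ e.eval s ≠ f.eval s := by
  simp only [tr, ne, eval]
  omega

theorem tr_lt (e f : Expr) (s : State) : (lt e f).tr s ↔ e.eval s < f.eval s := by
  simp only [tr, lt, eval]
  omega

open Classical in
theorem eval_ind (e : Expr) (s : State) : (ind e).eval s = if e.tr s then 1 else 0 := by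
  by_cases h : e.eval s = 0 <;> simp [ind, eval, tr, h]

theorem tr_ex (n : ℕ) (v : ℕ) (e : Expr) (s : State) (hn : s.reg 0 = n) :
    (ex v e).tr s ↔ ∃ i : Fin n, e.tr (s.setReg v i) := by
  simp only [tr, ex, eval, hn, Finset.sum_range, ne_eq, Finset.sum_eq_zero_iff, Finset.mem_univ,
    forall_const, not_forall]

open Classical in
theorem eval_cnt (n : ℕ) (v : ℕ) (e : Expr) (s : State) (hn : s.reg 0 = n) :
    (cnt v e).eval s = (Finset.univ.filter fun i : Fin n => e.tr (s.setReg v i)).card := by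
  simp only [cnt, eval, hn, Finset.sum_range, eval_ind]
  rw [Finset.card_filter]

/-- The sum contains `f` once for every index below the value of `e`, provided that all these
indices are within the range of summation. Register `31` is reserved for the index. -/
theorem eval_mul {e f : Expr} {s : State} (he : ∀ i, e.eval (s.setReg 31 i) = e.eval s)
    (hf : ∀ i, f.eval (s.setReg 31 i) = f.eval s) (hle : e.eval s ≤ s.reg 0) :
    (mul e f).eval s = e.eval s * f.eval s := by
  simp only [mul, eval, he, hf, State.setReg_reg, if_true]
  have : ∀ i, (if e.eval s - i ≠ 0 then f.eval s else 0) = if i < e.eval s then f.eval s else 0 := by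
    intro i
    by_cases h : i < e.eval s
    · rw [if_pos h, if_pos (by omega)]
    · rw [if_neg h, if_neg (by omega)]
  simp only [this]
  rw [← Finset.sum_filter, Finset.sum_const, smul_eq_mul]
  have hfilter : (Finset.range (s.reg 0)).filter (· < e.eval s) = Finset.range (e.eval s) := by
    ext i
    simp only [Finset.mem_filter, Finset.mem_range]
    omega
  rw [hfilter, Finset.card_range]

theorem tr_rd (a x : ℕ) (s : State) : (rd a x).tr s ↔ s.arr a (s.reg x) ≠ 0 := Iff.rfl

theorem eval_rd2 (n a x y : ℕ) (s : State) (hn : s.reg 0 = n) (hx : x ≠ 31) (hy : s.reg x ≤ n) :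
    (rd2 a x y).eval s = s.arr a (n * s.reg x + s.reg y) := by
  have := eval_mul (e := reg x) (f := reg 0) (s := s) (by simp [eval, hx]) (by simp [eval])
    (by simpa [eval, hn] using hy)
  simp only [rd2, eval] at this ⊢
  rw [this, hn, mul_comm]

theorem tr_rd2 (n a x y : ℕ) (s : State) (hn : s.reg 0 = n) (hx : x ≠ 31) (hy : s.reg x ≤ n) :
    (rd2 a x y).tr s ↔ s.arr a (n * s.reg x + s.reg y) ≠ 0 := by
  rw [tr, eval_rd2 n a x y s hn hx hy]

end Expr

open TokenSliding.Expr

open Classical in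
/-- Started in a state that differs from `s` in the array `a` only, the statement assigns the values
`val` to the entries of `a` in `Q`, and does nothing else. -/
def Stmt.Sets (p : Stmt) (a : ℕ) (s : State) (Q : ℕ → Prop) (val : ℕ → ℕ) : Prop :=
  ∀ s' : State, s'.reg = s.reg → (∀ b ≠ a, s'.arr b = s.arr b) →
    (p.run s').reg = s.reg ∧ (∀ b ≠ a, (p.run s').arr b = s.arr b) ∧
      ∀ c, (p.run s').arr a c = if Q c then val c else s'.arr a c

theorem sets_store {a : ℕ} {e f : Expr} (he : e.noArr a = true) (hf : f.noArr a = true)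
    (s : State) : (Stmt.store a e f).Sets a s (· = e.eval s) (fun _ => f.eval s) := by
  intro s' hr ha
  refine ⟨hr, fun b hb => ?_, fun c => ?_⟩
  · funext c
    simp only [Stmt.run]
    rw [State.setArr_arr, if_neg (fun h => hb h.1), ha b hb]
  · simp only [Stmt.run]
    rw [State.setArr_arr, eval_noArr he hr ha, eval_noArr hf hr ha]
    simp

theorem Stmt.Sets.ite {a : ℕ} {e : Expr} {p : Stmt} {s : State} {Q : ℕ → Prop} {val : ℕ → ℕ}
    (h : p.Sets a s Q val) (he : e.noArr a = true) :
    (Stmt.ite e p).Sets a s (fun c => e.tr s ∧ Q c) val := by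
  intro s' hr ha
  simp only [Stmt.run]
  rw [eval_noArr he hr ha]
  by_cases hc : e.eval s ≠ 0
  · rw [if_pos hc]
    obtain ⟨h1, h2, h3⟩ := h s' hr ha
    refine ⟨h1, h2, fun c => ?_⟩
    rw [h3]
    by_cases hQ : Q c
    · rw [if_pos hQ, if_pos ⟨hc, hQ⟩]
    · rw [if_neg hQ, if_neg (fun h => hQ h.2)]
  · rw [if_neg hc]
    exact ⟨hr, ha, fun c => by simp [tr, hc]⟩

/-- Rounds that write to the same entry must write the same value, so their order is irrelevant.
Since the expressions do not read the array `a`, every round behaves as if started from the original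
state. -/
theorem Stmt.Sets.iter {a v : ℕ} {p : Stmt} {s : State} {Q : ℕ → ℕ → Prop} {val : ℕ → ℕ}
    {val' : ℕ → ℕ → ℕ} (h : ∀ i < s.reg 0, p.Sets a (s.setReg v i) (Q i) (val' i))
    (hval : ∀ i < s.reg 0, ∀ c, Q i c → val' i c = val c) :
    (Stmt.iter v p).Sets a s (fun c => ∃ i < s.reg 0, Q i c) val := by
  classical
  intro s' hr ha
  have key : ∀ m ≤ s.reg 0, (∀ x ≠ v, (rounds p.run v m s').reg x = s.reg x) ∧
      (∀ b ≠ a, (rounds p.run v m s').arr b = s.arr b) ∧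
      ∀ c, (rounds p.run v m s').arr a c = if ∃ i < m, Q i c then val c else s'.arr a c := by
    intro m
    induction m with
    | zero => exact fun _ => ⟨fun x _ => by simp [rounds, hr], ha, fun c => by simp [rounds]⟩
    | succ m ih =>
      intro hm
      obtain ⟨h1, h2, h3⟩ := ih (by omega)
      obtain ⟨k1, k2, k3⟩ := h m (by omega) ((rounds p.run v m s').setReg v m) (by
        funext x
        simp only [State.setReg_reg]
        split_ifs with hx
        exacts [rfl, h1 x hx]) h2
      simp only [rounds]
      refine ⟨fun x hx => ?_, k2, fun c => ?_⟩
      · rw [k1, State.setReg_reg, if_neg hx]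
      · rw [k3, State.setReg_arr, h3]
        by_cases hQ : Q m c
        · rw [if_pos hQ, if_pos ⟨m, by omega, hQ⟩, hval m (by omega) c hQ]
        · rw [if_neg hQ]
          refine if_congr ⟨fun ⟨i, hi, hQi⟩ => ⟨i, by omega, hQi⟩, fun ⟨i, hi, hQi⟩ => ⟨i, ?_, hQi⟩⟩
            rfl rfl
          rcases Nat.lt_succ_iff_lt_or_eq.1 hi with hlt | rfl
          exacts [hlt, absurd hQi hQ]
  simp only [Stmt.run, hr]
  obtain ⟨h1, h2, h3⟩ := key (s.reg 0) le_rfl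
  refine ⟨?_, h2, ?_⟩
  · funext x
    simp only [State.setReg_reg]
    split_ifs with hx
    · rw [hx]
    · exact h1 x hx
  · intro c
    rw [State.setReg_arr, h3]
    congr

theorem Stmt.Sets.run {a : ℕ} {p : Stmt} {s : State} {Q : ℕ → Prop} {val : ℕ → ℕ}
    [DecidablePred Q] (h : p.Sets a s Q val) : (p.run s).reg = s.reg ∧
      (∀ b ≠ a, (p.run s).arr b = s.arr b) ∧
      ∀ c, (p.run s).arr a c = if Q c then val c else s.arr a c := by
  obtain ⟨h1, h2, h3⟩ := h s rfl fun _ _ => rfl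
  refine ⟨h1, h2, fun c => ?_⟩
  rw [h3]
  congr

/-- Fill an array with the values of an expression. -/
def fill (a v : ℕ) (e : Expr) : Stmt := .iter v (.store a (.reg v) e)

/-- Fill a matrix with the values of an expression. -/
def fill2 (a v w : ℕ) (e : Expr) : Stmt :=
  .iter v (.iter w (.store a (.add (.mul (.reg v) (.reg 0)) (.reg w)) e))

theorem fill_spec {a v : ℕ} {e : Expr} (he : e.noArr a = true) (s : State) :
    ((fill a v e).run s).reg = s.reg ∧ (∀ b ≠ a, ((fill a v e).run s).arr b = s.arr b) ∧
      ∀ c, ((fill a v e).run s).arr a c =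
        if c < s.reg 0 then e.eval (s.setReg v c) else s.arr a c := by
  have h := Stmt.Sets.iter (a := a) (v := v) (p := .store a (.reg v) e) (s := s)
    (Q := fun i c => c = i) (val := fun c => e.eval (s.setReg v c))
    (fun i _ => by simpa [Expr.eval] using sets_store (e := .reg v) rfl he (s.setReg v i))
    (by rintro i _ c rfl; rfl)
  obtain ⟨h1, h2, h3⟩ := h.run (Q := fun c => ∃ i < s.reg 0, c = i)
  refine ⟨h1, h2, fun c => (h3 c).trans (if_congr ?_ rfl rfl)⟩
  simp

/-- Entry `c` belongs to row `c / n` and column `c % n`. -/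
theorem fill2_spec {a v w : ℕ} {e : Expr} (he : e.noArr a = true) (hv : v ≠ 0) (hw : w ≠ 0)
    (hv' : v ≠ 31) (hvw : v ≠ w) (s : State) :
    ((fill2 a v w e).run s).reg = s.reg ∧ (∀ b ≠ a, ((fill2 a v w e).run s).arr b = s.arr b) ∧
      ∀ c, ((fill2 a v w e).run s).arr a c = if c < s.reg 0 * s.reg 0 then
        e.eval ((s.setReg v (c / s.reg 0)).setReg w (c % s.reg 0)) else s.arr a c := by
  set n := s.reg 0 with hn
  have hmod : ∀ i j, j < n → (n * i + j) / n = i ∧ (n * i + j) % n = j := by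
    intro i j hj
    constructor
    · rw [Nat.mul_add_div (by omega), Nat.div_eq_of_lt hj, add_zero]
    · rw [Nat.mul_add_mod, Nat.mod_eq_of_lt hj]
  have hin : ∀ i < n, (Stmt.iter w (.store a (.add (.mul (.reg v) (.reg 0)) (.reg w)) e)).Sets a
      (s.setReg v i) (fun c => ∃ j < (s.setReg v i).reg 0, c = n * i + j)
      (fun c => e.eval ((s.setReg v (c / n)).setReg w (c % n))) := by
    intro i hi
    refine Stmt.Sets.iter (Q := fun j c => c = n * i + j)
      (val' := fun j _ => e.eval ((s.setReg v i).setReg w j)) ?_ ?_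
    · intro j hj
      have h1 : (Expr.add (.mul (.reg v) (.reg 0)) (.reg w)).eval ((s.setReg v i).setReg w j) =
          n * i + j := by
        have := eval_mul (e := reg v) (f := reg 0) (s := (s.setReg v i).setReg w j)
          (by simp [eval, hv']) (by simp [eval])
          (by simp [eval, hvw, hv.symm, hw.symm, ← hn, hi.le])
        simp only [eval] at this ⊢
        rw [this]
        simp [hvw, hv.symm, hw.symm, ← hn, mul_comm]
      have := sets_store (e := .add (.mul (.reg v) (.reg 0)) (.reg w)) rfl he
        ((s.setReg v i).setReg w j)
      rwa [h1] at this
    · rintro j hj c rfl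
      rw [State.setReg_reg, if_neg hv.symm] at hj
      obtain ⟨e1, e2⟩ := hmod i j hj
      simp only [e1, e2]
  have h := Stmt.Sets.iter (a := a) (v := v) (s := s) hin (fun i _ c _ => rfl)
  classical
  obtain ⟨h1, h2, h3⟩ := h.run
  refine ⟨h1, h2, fun c => (h3 c).trans (if_congr ?_ rfl rfl)⟩
  simp only [State.setReg_reg, if_neg hv.symm, ← hn]
  constructor
  · rintro ⟨i, hi, j, hj, rfl⟩
    calc n * i + j < n * i + n := by omega
      _ = n * (i + 1) := by ring
      _ ≤ n * n := Nat.mul_le_mul_left _ hi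
  · intro hc
    have hpos : 0 < n := by
      rcases Nat.eq_zero_or_pos n with h0 | h0
      · simp [h0] at hc
      · exact h0
    exact ⟨c / n, Nat.div_lt_of_lt_mul hc, c % n, Nat.mod_lt _ hpos, (Nat.div_add_mod c n).symm⟩

variable {n : ℕ}

open Classical in
/-- The array `a` holds the indicator vector of `P`. -/
def HoldsVec (s : State) (a : ℕ) (P : Fin n → Prop) : Prop :=
  ∀ i : Fin n, s.arr a i = if P i then 1 else 0

open Classical in
/-- The array `a` holds the indicator matrix of `P`. -/
def HoldsMat (s : State) (a : ℕ) (P : Fin n → Fin n → Prop) : Prop :=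
  ∀ i j : Fin n, s.arr a (n * i + j) = if P i j then 1 else 0

theorem HoldsVec.congr {s s' : State} {a b : ℕ} {P : Fin n → Prop} (h : HoldsVec s a P)
    (hs : s'.arr b = s.arr a) : HoldsVec s' b P := by
  intro i
  rw [hs, h i]

theorem HoldsMat.congr {s s' : State} {a b : ℕ} {P : Fin n → Fin n → Prop} (h : HoldsMat s a P)
    (hs : s'.arr b = s.arr a) : HoldsMat s' b P := by
  intro i j
  rw [hs, h i j]

theorem fill_holdsVec {a v : ℕ} {e : Expr} (he : e.noArr a = true) {s : State}
    (hn : s.reg 0 = n) {P : Fin n → Prop} (hP : ∀ i : Fin n, e.tr (s.setReg v i) ↔ P i) :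
    HoldsVec ((fill a v (ind e)).run s) a P := by
  intro i
  have he' : (ind e).noArr a = true := by simp [ind, noArr, he]
  rw [(fill_spec he' s).2.2, if_pos (by rw [hn]; exact i.2), eval_ind]
  by_cases h : P i
  · rw [if_pos h, if_pos ((hP i).2 h)]
  · rw [if_neg h, if_neg (fun h' => h ((hP i).1 h'))]

theorem fill2_holdsMat {a v w : ℕ} {e : Expr} (he : e.noArr a = true) (hv : v ≠ 0) (hw : w ≠ 0)
    (hv' : v ≠ 31) (hvw : v ≠ w) {s : State} (hn : s.reg 0 = n) {P : Fin n → Fin n → Prop}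
    (hP : ∀ i j : Fin n, e.tr ((s.setReg v i).setReg w j) ↔ P i j) :
    HoldsMat ((fill2 a v w (ind e)).run s) a P := by
  intro i j
  have he' : (ind e).noArr a = true := by simp [ind, noArr, he]
  have h1 : n * i + j < n * n :=
    calc n * i + j < n * i + n := by have := j.2; omega
      _ = n * (i + 1) := by ring
      _ ≤ n * n := Nat.mul_le_mul_left _ i.2
  rw [(fill2_spec he' hv hw hv' hvw s).2.2, hn, if_pos h1, Nat.mul_add_div i.pos,
    Nat.div_eq_of_lt j.2, add_zero, Nat.mul_add_mod, Nat.mod_eq_of_lt j.2, eval_ind]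
  by_cases h : P i j
  · rw [if_pos h, if_pos ((hP i j).2 h)]
  · rw [if_neg h, if_neg (fun h' => h ((hP i j).1 h'))]

/-- The registers and the arrays not in `l` are the same. -/
def Frame (l : List ℕ) (s s' : State) : Prop := s'.reg = s.reg ∧ ∀ b, b ∉ l → s'.arr b = s.arr b

theorem Frame.trans {l : List ℕ} {s s' s'' : State} (h : Frame l s s') (h' : Frame l s' s'') :
    Frame l s s'' := ⟨h'.1.trans h.1, fun b hb => (h'.2 b hb).trans (h.2 b hb)⟩

theorem fill_frame {a v : ℕ} {e : Expr} (he : e.noArr a = true) (s : State) {l : List ℕ}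
    (ha : a ∈ l) : Frame l s ((fill a v e).run s) :=
  ⟨(fill_spec he s).1, fun b hb => (fill_spec he s).2.1 b (fun h => hb (h ▸ ha))⟩

theorem fill2_frame {a v w : ℕ} {e : Expr} (he : e.noArr a = true) (hv : v ≠ 0) (hw : w ≠ 0)
    (hv' : v ≠ 31) (hvw : v ≠ w) (s : State) {l : List ℕ} (ha : a ∈ l) :
    Frame l s ((fill2 a v w e).run s) :=
  ⟨(fill2_spec he hv hw hv' hvw s).1,
    fun b hb => (fill2_spec he hv hw hv' hvw s).2.1 b (fun h => hb (h ▸ ha))⟩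

/-- An invariant of a loop that does not use its variable. -/
theorem run_iter {v : ℕ} {p : Stmt} {s : State} {l : List ℕ} {Inv : ℕ → State → Prop}
    (h0 : Inv 0 s) (hcongr : ∀ m s s', s'.arr = s.arr → Inv m s → Inv m s')
    (hstep : ∀ m s', (∀ x ≠ v, s'.reg x = s.reg x) → (∀ b, b ∉ l → s'.arr b = s.arr b) → Inv m s' →
      Frame l s' (p.run s') ∧ Inv (m + 1) (p.run s')) :
    Frame l s ((Stmt.iter v p).run s) ∧ Inv (s.reg 0) ((Stmt.iter v p).run s) := by
  have key : ∀ m, (∀ x ≠ v, (rounds p.run v m s).reg x = s.reg x) ∧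
      (∀ b, b ∉ l → (rounds p.run v m s).arr b = s.arr b) ∧ Inv m (rounds p.run v m s) := by
    intro m
    induction m with
    | zero => exact ⟨fun _ _ => rfl, fun _ _ => rfl, h0⟩
    | succ m ih =>
      obtain ⟨h1, h2, h3⟩ := ih
      obtain ⟨k1, k2⟩ := hstep m ((rounds p.run v m s).setReg v m)
        (fun x hx => by rw [State.setReg_reg, if_neg hx, h1 x hx]) h2 (hcongr m (rounds p.run v m s) _ rfl h3)
      refine ⟨fun x hx => ?_, fun b hb => ?_, k2⟩
      · simp only [rounds]
        rw [k1.1, State.setReg_reg, if_neg hx, h1 x hx]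
      · simp only [rounds]
        rw [k1.2 b hb, State.setReg_arr, h2 b hb]
  obtain ⟨h1, h2, h3⟩ := key (s.reg 0)
  simp only [Stmt.run]
  refine ⟨⟨?_, h2⟩, hcongr _ (rounds p.run v (s.reg 0) s) _ rfl h3⟩
  funext x
  simp only [State.setReg_reg]
  split_ifs with hx
  · rw [hx]
  · exact h1 x hx

end Language


/-! ### The program -/

section Program

open TokenSliding.Expr

variable {n : ℕ}

theorem HoldsVec.eq_zero_iff {s : State} {a : ℕ} {P : Fin n → Prop} (h : HoldsVec s a P)
    (i : Fin n) : s.arr a i = 0 ↔ ¬ P i := by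
  rw [h i]
  split_ifs with hP <;> simp [hP]

theorem HoldsMat.eq_zero_iff {s : State} {a : ℕ} {P : Fin n → Fin n → Prop} (h : HoldsMat s a P)
    (i j : Fin n) : s.arr a (n * i + j) = 0 ↔ ¬ P i j := by
  rw [h i j]
  split_ifs with hP <;> simp [hP]

theorem entry_injective {i j i' j' : ℕ} (hj : j < n) (hj' : j' < n)
    (h : n * i + j = n * i' + j') : i = i' ∧ j = j' := by
  have h1 : ∀ i j, j < n → (n * i + j) / n = i ∧ (n * i + j) % n = j := by
    intro i j hj
    constructor
    · rw [Nat.mul_add_div (by omega), Nat.div_eq_of_lt hj, add_zero]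
    · rw [Nat.mul_add_mod, Nat.mod_eq_of_lt hj]
  obtain ⟨e1, e2⟩ := h1 i j hj
  obtain ⟨e3, e4⟩ := h1 i' j' hj'
  rw [h] at e1 e2
  exact ⟨e1.symm.trans e3, e2.symm.trans e4⟩

/-- The intended content of an array. -/
inductive Content (n : ℕ) where
  | vec (P : Fin n → Prop) : Content n
  | mat (P : Fin n → Fin n → Prop) : Content n

/-- The array `a` has the intended content. -/
def Content.Holds (s : State) (a : ℕ) : Content n → Prop
  | vec P => HoldsVec s a P
  | mat P => HoldsMat s a P

theorem Content.Holds.congr {s s' : State} {a : ℕ} {c : Content n} (h : c.Holds s a)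
    (hs : s'.arr a = s.arr a) : c.Holds s' a := by
  cases c with
  | vec P => exact HoldsVec.congr (s := s) h hs
  | mat P => exact HoldsMat.congr (s := s) h hs

/-- The arrays of the program. Array `4` is for intermediate results. -/
def contents (I : Instance) : ℕ → Content I.n
  | 0 => .mat I.graph.Adj
  | 1 => .vec (· ∈ I.S)
  | 2 => .vec (· ∈ I.T)
  | 3 => .vec (lockedPart I.graph I.S)
  | 5 => .vec (lockedPart I.graph I.T)
  | 6 => .vec (Alive I.graph (lockedPart I.graph I.S))
  | 7 => .vec (Pend I.core)
  | 8 => .vec (Red I.core I.S I.T)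
  | 9 => .mat I.core.Reachable
  | 10 => .vec (Keep I.core I.S I.T I.k)
  | 11 => .vec I.Kept
  | 12 => .vec fun _ => I.IsBad
  | 13 => .mat I.core.Adj
  | 14 => .vec (· ∈ I.S)
  | 15 => .vec (· ∈ I.T)
  | _ => .vec fun _ => False

/-- The registers and the arrays `0`, `1`, `2` are as on input, and the arrays in `l` have their
intended contents. -/
structure Ready (I : Instance) (l : List ℕ) (s : State) : Prop where
  reg_eq : s.reg = (inputState I).reg
  arr_eq : ∀ a ≤ 2, s.arr a = (inputState I).arr a
  holds : ∀ a ∈ l, (contents I a).Holds s a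

variable {I : Instance} {l : List ℕ} {s : State}

theorem Ready.reg_zero (h : Ready I l s) : s.reg 0 = I.n := by simp [h.reg_eq, inputState]

theorem Ready.reg_one (h : Ready I l s) : s.reg 1 = I.k := by simp [h.reg_eq, inputState]

theorem Ready.vec (h : Ready I l s) (a : ℕ) {P : Fin I.n → Prop} (ha : a ∈ l)
    (hc : contents I a = .vec P) : HoldsVec s a P := by
  have := h.holds a ha
  rwa [hc] at this

theorem Ready.mat (h : Ready I l s) (a : ℕ) {P : Fin I.n → Fin I.n → Prop} (ha : a ∈ l)
    (hc : contents I a = .mat P) : HoldsMat s a P := by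
  have := h.holds a ha
  rwa [hc] at this

theorem Ready.frame (h : Ready I l s) {l' : List ℕ} {s' : State} (hf : Frame l' s s')
    (hl : ∀ a ∈ l', 2 < a ∧ a ∉ l) : Ready I l s' where
  reg_eq := hf.1.trans h.reg_eq
  arr_eq a ha := (hf.2 a fun h' => by have := (hl a h').1; omega).trans (h.arr_eq a ha)
  holds a ha := (h.holds a ha).congr (hf.2 a fun h' => (hl a h').2 ha)

theorem Ready.cons (h : Ready I l s) {a : ℕ} (ha : (contents I a).Holds s a) :
    Ready I (a :: l) s where
  reg_eq := h.reg_eq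
  arr_eq := h.arr_eq
  holds b hb := by
    rcases List.mem_cons.1 hb with rfl | hb
    exacts [ha, h.holds b hb]

theorem Ready.fill (h : Ready I l s) {a v : ℕ} {e : Expr} {P : Fin I.n → Prop} (ha : 2 < a)
    (hal : a ∉ l) (he : e.noArr a = true) (hc : contents I a = .vec P)
    (hP : ∀ i : Fin I.n, e.tr (s.setReg v i) ↔ P i) :
    Ready I (a :: l) ((fill a v (ind e)).run s) := by
  have he' : (ind e).noArr a = true := by simp [ind, noArr, he]
  refine (h.frame (fill_frame he' s (List.mem_singleton.2 rfl)) ?_).cons ?_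
  · intro b hb
    rw [List.mem_singleton.1 hb]
    exact ⟨ha, hal⟩
  · rw [hc]
    exact fill_holdsVec he h.reg_zero hP

theorem Ready.fill2 (h : Ready I l s) {a v w : ℕ} {e : Expr} {P : Fin I.n → Fin I.n → Prop}
    (ha : 2 < a) (hal : a ∉ l) (he : e.noArr a = true) (hc : contents I a = .mat P) (hv : v ≠ 0)
    (hw : w ≠ 0) (hv' : v ≠ 31) (hvw : v ≠ w)
    (hP : ∀ i j : Fin I.n, e.tr ((s.setReg v i).setReg w j) ↔ P i j) :
    Ready I (a :: l) ((fill2 a v w (ind e)).run s) := by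
  have he' : (ind e).noArr a = true := by simp [ind, noArr, he]
  refine (h.frame (fill2_frame he' hv hw hv' hvw s (List.mem_singleton.2 rfl)) ?_).cons ?_
  · intro b hb
    rw [List.mem_singleton.1 hb]
    exact ⟨ha, hal⟩
  · rw [hc]
    exact fill2_holdsMat he hv hw hv' hvw h.reg_zero hP

theorem ready_inputState (I : Instance) : Ready I [0, 1, 2] (inputState I) where
  reg_eq := rfl
  arr_eq _ _ := rfl
  holds a ha := by
    classical
    simp only [List.mem_cons, List.not_mem_nil, or_false] at ha
    rcases ha with rfl | rfl | rfl
    · intro i j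
      simp only [inputState, if_true]
      refine if_congr ⟨?_, fun h => ⟨i, j, rfl, h⟩⟩ rfl rfl
      rintro ⟨i', j', he, h⟩
      obtain ⟨e1, e2⟩ := entry_injective j.2 j'.2 he
      rwa [Fin.ext e1, Fin.ext e2]
    · intro i
      by_cases hi : i ∈ I.S <;> simp [inputState, Fin.val_inj, hi]
    · intro i
      by_cases hi : i ∈ I.T <;> simp [inputState, Fin.val_inj, hi]

/-- Truth of `peelStep` for the set in array `a`. -/
def peelExpr (a : ℕ) : Expr :=
  conj (rd a 2) (neg (ex 3 (conj (rd2 0 2 3)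
    (neg (ex 4 (conj (ne (reg 4) (reg 2)) (conj (rd a 4) (rd2 0 3 4))))))))

theorem tr_peelExpr {a : ℕ} {G : SimpleGraph (Fin n)} {P : Fin n → Prop} (hn : s.reg 0 = n)
    (hG : HoldsMat s 0 G.Adj) (hP : HoldsVec s a P) (i : Fin n) :
    (peelExpr a).tr (s.setReg 2 i) ↔ peelStep G P i := by
  have e0 : ∀ j : Fin n, (j : ℕ) ≤ n := fun j => j.2.le
  simp [peelExpr, tr_conj, tr_neg, tr_ex n, tr_ne, tr_rd, tr_rd2 n, hn, e0, hP.eq_zero_iff,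
    hG.eq_zero_iff, eval, peelStep, Fin.val_inj]

/-- Fill array `a` with the largest locked set of the tokens in array `b`. -/
def lockedStmt (a b : ℕ) : Stmt :=
  .seq (fill a 2 (ind (rd b 2)))
    (.iter 7 (.seq (fill 4 2 (ind (peelExpr a))) (fill a 2 (ind (rd 4 2)))))

/-- Loop invariant: after `m` rounds the array `a` holds the `m`-th iterate. Each round is computed
into array `4` first, because an update in place would read entries that have already changed. -/
theorem lockedStmt_spec {a b : ℕ} {A : Finset (Fin n)} {G : SimpleGraph (Fin n)} (ha0 : a ≠ 0)
    (ha4 : a ≠ 4) (hab : b ≠ a) (hn : s.reg 0 = n) (hG : HoldsMat s 0 G.Adj)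
    (hA : HoldsVec s b (· ∈ A)) :
    Frame [4, a] s ((lockedStmt a b).run s) ∧
      HoldsVec ((lockedStmt a b).run s) a (lockedPart G A) := by
  have n1 : (ind (rd b 2)).noArr a = true := by simp [ind, rd, noArr, hab]
  have n2 : (peelExpr a).noArr 4 = true := by
    simp [peelExpr, conj, neg, ex, ne, rd, rd2, mul, noArr, ha4]
  have n2' : (ind (peelExpr a)).noArr 4 = true := by simp [ind, noArr, n2]
  have n3 : (rd 4 2).noArr a = true := by simp [rd, noArr, ha4.symm]
  have n3' : (ind (rd 4 2)).noArr a = true := by simp [ind, noArr, n3]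
  have f1 : Frame [4, a] s ((fill a 2 (ind (rd b 2))).run s) := fill_frame n1 s (by simp)
  set s1 := (fill a 2 (ind (rd b 2))).run s with hs1
  have h1 : HoldsVec s1 a (· ∈ A) := fill_holdsVec (by simp [rd, noArr, hab]) hn fun i => by
    simp [tr_rd, hA.eq_zero_iff]
  obtain ⟨f2, h2⟩ := run_iter (v := 7) (p := .seq (fill 4 2 (ind (peelExpr a))) (fill a 2 (ind (rd 4 2))))
    (s := s1) (l := [4, a]) (Inv := fun m s' => HoldsVec s' a ((peelStep G)^[m] (· ∈ A))) h1
    (fun m s' s'' hs h => h.congr (by rw [hs])) (fun m s' hreg harr h => by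
      have hn' : s'.reg 0 = n := by rw [hreg 0 (by decide), f1.1, hn]
      have hG' : HoldsMat s' 0 G.Adj :=
        hG.congr (by rw [harr 0 (by simp [ha0.symm]), f1.2 0 (by simp [ha0.symm])])
      have h4 := fill_holdsVec n2 hn' (tr_peelExpr hn' hG' h)
      have g1 : Frame [4, a] s' ((fill 4 2 (ind (peelExpr a))).run s') := fill_frame n2' s' (by simp)
      refine ⟨g1.trans (fill_frame n3' _ (by simp)), ?_⟩
      rw [Function.iterate_succ_apply']
      exact fill_holdsVec n3 (by rw [g1.1, hn']) fun i => by simp [tr_rd, h4.eq_zero_iff])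
  refine ⟨f1.trans f2, ?_⟩
  rw [f1.1, hn] at h2
  exact h2

theorem Ready.locked (h : Ready I l s) {a b : ℕ} {A : Finset (Fin I.n)} (ha : 2 < a) (ha4 : a ≠ 4)
    (hab : b ≠ a) (h4 : 4 ∉ l) (hal : a ∉ l) (hbl : b ∈ l) (h0 : 0 ∈ l)
    (hb : contents I b = .vec (· ∈ A)) (hc : contents I a = .vec (lockedPart I.graph A)) :
    Ready I (a :: l) ((lockedStmt a b).run s) := by
  obtain ⟨f, hf⟩ := lockedStmt_spec (by omega) ha4 hab h.reg_zero (h.mat 0 h0 rfl) (h.vec b hbl hb)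
  refine (h.frame f ?_).cons (by rw [hc]; exact hf)
  intro c hc
  simp only [List.mem_cons, List.not_mem_nil, or_false] at hc
  rcases hc with rfl | rfl
  exacts [⟨by omega, h4⟩, ⟨ha, hal⟩]

/-- There is a walk of length at most `m`. -/
def WalkLE (H : SimpleGraph (Fin n)) : ℕ → Fin n → Fin n → Prop
  | 0, u, v => u = v
  | m + 1, u, v => WalkLE H m u v ∨ ∃ w, H.Adj u w ∧ WalkLE H m w v

theorem walkLE_iff {H : SimpleGraph (Fin n)} {u v : Fin n} :
    WalkLE H n u v ↔ H.Reachable u v := by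
  constructor
  · have key : ∀ m u, WalkLE H m u v → H.Reachable u v := by
      intro m
      induction m with
      | zero =>
        rintro u rfl
        rfl
      | succ m ih =>
        rintro u (h | ⟨w, hw, h⟩)
        exacts [ih u h, hw.reachable.trans (ih w h)]
    exact key n u
  · have key : ∀ {u v : Fin n} (p : H.Walk u v) m, p.length ≤ m → WalkLE H m u v := by
      intro u v p
      induction p with
      | nil =>
        intro m _
        induction m with
        | zero => rfl
        | succ m ih => exact Or.inl (ih (Nat.zero_le _))
      | cons hadj p ih =>
        intro m hm
        rw [SimpleGraph.Walk.length_cons] at hm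
        obtain ⟨m, rfl⟩ : ∃ m', m = m' + 1 := ⟨m - 1, by omega⟩
        exact Or.inr ⟨_, hadj, ih m (by omega)⟩
    -- A walk may be replaced by a path, which has length less than `n`; so `n` rounds suffice.
    rintro ⟨p⟩
    classical
    have := (p.toPath.2.length_lt).le
    rw [Fintype.card_fin] at this
    exact key _ n this

/-- One more step of a walk. -/
def walkExpr : Expr := disj (rd2 9 2 3) (ex 5 (conj (rd2 13 2 5) (rd2 9 5 3)))

/-- Fill array `9` with the reachability relation of the graph in array `13`. -/
def reachStmt : Stmt :=
  .seq (fill2 9 2 3 (ind (neg (ne (reg 2) (reg 3)))))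
    (.iter 7 (.seq (fill2 4 2 3 (ind walkExpr)) (fill2 9 2 3 (ind (rd2 4 2 3)))))

theorem reachStmt_spec {H : SimpleGraph (Fin n)} (hn : s.reg 0 = n) (hH : HoldsMat s 13 H.Adj) :
    Frame [4, 9] s (reachStmt.run s) ∧ HoldsMat (reachStmt.run s) 9 H.Reachable := by
  have e0 : ∀ j : Fin n, (j : ℕ) ≤ n := fun j => j.2.le
  have f1 : Frame [4, 9] s ((fill2 9 2 3 (ind (neg (ne (reg 2) (reg 3))))).run s) :=
    fill2_frame rfl (by decide) (by decide) (by decide) (by decide) s (by simp)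
  set s1 := (fill2 9 2 3 (ind (neg (ne (reg 2) (reg 3))))).run s with hs1
  have h1 : HoldsMat s1 9 (WalkLE H 0) :=
    fill2_holdsMat rfl (by decide) (by decide) (by decide) (by decide) hn fun i j => by
      simp [tr_neg, tr_ne, eval, WalkLE, Fin.val_inj]
  obtain ⟨f2, h2⟩ := run_iter (v := 7)
    (p := .seq (fill2 4 2 3 (ind walkExpr)) (fill2 9 2 3 (ind (rd2 4 2 3))))
    (s := s1) (l := [4, 9]) (Inv := fun m s' => HoldsMat s' 9 (WalkLE H m)) h1
    (fun m s' s'' hs h => h.congr (by rw [hs])) (fun m s' hreg harr h => by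
      have hn' : s'.reg 0 = n := by rw [hreg 0 (by decide), f1.1, hn]
      have hH' : HoldsMat s' 13 H.Adj :=
        hH.congr (by rw [harr 13 (by simp), f1.2 13 (by simp)])
      have h4 : HoldsMat ((fill2 4 2 3 (ind walkExpr)).run s') 4 (WalkLE H (m + 1)) :=
        fill2_holdsMat rfl (by decide) (by decide) (by decide) (by decide) hn' fun i j => by
          simp [walkExpr, tr_disj, tr_ex n, tr_conj, tr_rd2 n, hn', e0, h.eq_zero_iff,
            hH'.eq_zero_iff, WalkLE]
      have g1 : Frame [4, 9] s' ((fill2 4 2 3 (ind walkExpr)).run s') :=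
        fill2_frame rfl (by decide) (by decide) (by decide) (by decide) s' (by simp)
      have hn4 : ((fill2 4 2 3 (ind walkExpr)).run s').reg 0 = n := by rw [g1.1, hn']
      refine ⟨g1.trans
        (fill2_frame rfl (by decide) (by decide) (by decide) (by decide) _ (by simp)), ?_⟩
      exact fill2_holdsMat rfl (by decide) (by decide) (by decide) (by decide) hn4 fun i j => by
        simp [tr_rd2 n, hn4, e0, h4.eq_zero_iff])
  refine ⟨f1.trans f2, ?_⟩
  rw [f1.1, hn] at h2
  have e : WalkLE H n = H.Reachable := by
    funext u v
    exact propext walkLE_iff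
  rwa [e] at h2

/-- The number of vertices of the set in array `a` in the component of register `v`. -/
def compExpr (a v : ℕ) : Expr := cnt 5 (conj (rd2 9 v 5) (rd a 5))

theorem eval_compExpr {a v : ℕ} {H : SimpleGraph (Fin n)} {P : Fin n → Prop} (hn : s.reg 0 = n)
    (hv : v ≠ 5) (hv' : v ≠ 31) (hH : HoldsMat s 9 H.Reachable) (hP : HoldsVec s a P) (i : Fin n)
    (hi : s.reg v = i) : (compExpr a v).eval s = compCard H P i := by
  have e0 : ∀ j : Fin n, (j : ℕ) ≤ n := fun j => j.2.le
  rw [compExpr, eval_cnt n _ _ _ hn, compCard]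
  congr 1
  ext j
  simp [tr_conj, tr_rd, tr_rd2 n, hn, hv, hv', hi, e0, hP.eq_zero_iff, hH.eq_zero_iff]

/-- `40 k ^ 3`. -/
def boundExpr : Expr := mul (reg 1) (mul (reg 1) (mul (reg 1) (const 40)))

/-- The product is nested so that every first factor is `k`, which is at most `n` as `eval_mul`
demands. -/
theorem eval_boundExpr (hk : s.reg 1 ≤ s.reg 0) : boundExpr.eval s = 40 * s.reg 1 ^ 3 := by
  have key : ∀ {f : Expr} {c : ℕ}, (∀ s' : State, s'.reg 0 = s.reg 0 → s'.reg 1 = s.reg 1 →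
      f.eval s' = c) → ∀ s' : State, s'.reg 0 = s.reg 0 → s'.reg 1 = s.reg 1 →
      (mul (reg 1) f).eval s' = s.reg 1 * c := by
    intro f c hf s' h0 h1
    rw [eval_mul (by simp [eval]) (fun i => by rw [hf _ h0 h1, hf _ (by simpa) (by simpa)])
      (by simpa [eval, h0, h1] using hk), hf _ h0 h1, eval, h1]
  rw [boundExpr, key (key (key fun _ _ _ => rfl)) s rfl rfl]
  ring

/-- One of the obstructions holds. -/
def badExpr : Expr :=
  disj (ex 3 (ne (ind (rd 3 3)) (ind (rd 5 3))))
    (disj (ex 3 (ne (compExpr 14 3) (compExpr 15 3)))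
      (ne (cnt 3 (conj (rd 14 3) (rd 10 3))) (cnt 3 (conj (rd 15 3) (rd 10 3)))))

/-- The vertex in register `2` is pendant. -/
def pendExpr : Expr := ex 3 (conj (rd2 13 2 3) (neg (ex 4 (conj (ne (reg 4) (reg 3)) (rd2 13 2 4)))))

/-- The vertex in register `2` is relevant. -/
def redExpr : Expr :=
  disj (disj (rd 14 2) (rd 15 2)) (neg (conj (rd 7 2)
    (ex 3 (conj (conj (lt (reg 3) (reg 2)) (rd 7 3)) (ex 4 (conj (rd2 13 2 4) (rd2 13 3 4)))))))

/-- The vertex in register `2` is relevant, and its component is small. -/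
def keepExpr : Expr :=
  conj (conj (compExpr 14 2) (neg (lt boundExpr (compExpr 8 2)))) (rd 8 2)

theorem k_le_n (I : Instance) : I.k ≤ I.n := by
  rw [← I.card_S]
  exact (Finset.card_le_univ _).trans (Fintype.card_fin _).le

theorem tr_keepExpr (h : Ready I l s) (h9 : 9 ∈ l) (h8 : 8 ∈ l) (h14 : 14 ∈ l) (i : Fin I.n) :
    keepExpr.tr (s.setReg 2 i) ↔ Keep I.core I.S I.T I.k i := by
  have hn : (s.setReg 2 i).reg 0 = I.n := h.reg_zero
  have hR : HoldsMat (s.setReg 2 i) 9 I.core.Reachable := h.mat 9 h9 rfl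
  have c14 := eval_compExpr (a := 14) (v := 2) hn (by decide) (by decide) hR
    (h.vec 14 h14 rfl) i (by simp)
  have c8 := eval_compExpr (a := 8) (v := 2) hn (by decide) (by decide) hR
    (h.vec 8 h8 rfl) i (by simp)
  have hk1 : (s.setReg 2 i).reg 1 = I.k := h.reg_one
  have hk := eval_boundExpr (s := s.setReg 2 i) (by rw [hn, hk1]; exact k_le_n I)
  rw [hk1] at hk
  rw [keepExpr, tr_conj, tr_conj, tr_neg, tr_lt, c8, hk, tr, c14]
  simp [tr_rd, (h.vec 8 h8 rfl).eq_zero_iff, Keep, Small]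

theorem tr_badExpr (h : Ready I l s) (hl : [3, 5, 9, 10, 14, 15] ⊆ l) (i : ℕ) :
    badExpr.tr (s.setReg 2 i) ↔ I.IsBad := by
  classical
  have hn : (s.setReg 2 i).reg 0 = I.n := h.reg_zero
  have hn' : s.reg 0 = I.n := h.reg_zero
  have c14 := fun r : Fin I.n => eval_compExpr (s := (s.setReg 2 i).setReg 3 r) (a := 14) (v := 3) hn
    (by decide) (by decide) (h.mat 9 (hl (by decide)) rfl) (h.vec 14 (hl (by decide)) rfl) r (by simp)
  have c15 := fun r : Fin I.n => eval_compExpr (s := (s.setReg 2 i).setReg 3 r) (a := 15) (v := 3) hn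
    (by decide) (by decide) (h.mat 9 (hl (by decide)) rfl) (h.vec 15 (hl (by decide)) rfl) r (by simp)
  have h3 := (h.vec 3 (hl (by decide)) rfl).eq_zero_iff
  have h5 := (h.vec 5 (hl (by decide)) rfl).eq_zero_iff
  have h10 := (h.vec 10 (hl (by decide)) rfl).eq_zero_iff
  have h14 := (h.vec 14 (hl (by decide)) rfl).eq_zero_iff
  have h15 := (h.vec 15 (hl (by decide)) rfl).eq_zero_iff
  have hlock : (ex 3 (ne (ind (rd 3 3)) (ind (rd 5 3)))).tr (s.setReg 2 i) ↔
      ∃ u, ¬ (lockedPart I.graph I.S u ↔ lockedPart I.graph I.T u) := by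
    rw [tr_ex I.n _ _ _ hn]
    refine exists_congr fun u => ?_
    rw [tr_ne, eval_ind, eval_ind]
    by_cases h1 : lockedPart I.graph I.S u <;> by_cases h2 : lockedPart I.graph I.T u <;>
      simp [tr_rd, h3, h5, h1, h2]
  have hcard : ∀ (a : ℕ) (A : Finset (Fin I.n)), (∀ j : Fin I.n, s.arr a j = 0 ↔ ¬ j ∈ A) →
      (cnt 3 (conj (rd a 3) (rd 10 3))).eval (s.setReg 2 i) =
        (A.filter (Keep (trim I.graph I.S) I.S I.T I.k)).card := by
    intro a A hA
    rw [eval_cnt I.n _ _ _ hn]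
    congr 1
    ext j
    simp [tr_conj, tr_rd, h10, hA, Instance.core]
  rw [badExpr, tr_disj, tr_disj, tr_ne, hlock, hcard 14 I.S h14, hcard 15 I.T h15,
    tr_ex I.n _ _ _ hn]
  simp only [tr_ne, c14, c15]
  rw [Instance.IsBad, Bad, Instance.core]

/-- The computation of the vertices of the kernel. -/
def keptStmt : Stmt :=
  -- The tokens are copied because the output will overwrite arrays `1` and `2` before its last use
  -- of them.
  .seq (fill 14 2 (ind (rd 1 2))) <| .seq (fill 15 2 (ind (rd 2 2))) <|
  .seq (lockedStmt 3 14) <| .seq (lockedStmt 5 15) <|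
  .seq (fill 6 2 (ind (conj (neg (rd 3 2)) (neg (ex 3 (conj (rd2 0 2 3) (rd 3 3))))))) <|
  .seq (fill2 13 2 3 (ind (conj (rd2 0 2 3) (conj (rd 6 2) (rd 6 3))))) <|
  .seq (fill 7 2 (ind pendExpr)) <| .seq (fill 8 2 (ind redExpr)) <|
  .seq reachStmt <| .seq (fill 10 2 (ind keepExpr)) <| .seq (fill 12 2 (ind badExpr)) <|
  fill 11 2 (ind (conj (rd 10 2) (neg (rd 12 2))))

theorem ready_keptStmt (I : Instance) :
    Ready I [11, 12, 10, 9, 8, 7, 13, 6, 5, 3, 15, 14, 0, 1, 2] (keptStmt.run (inputState I)) := by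
  have e0 : ∀ j : Fin I.n, (j : ℕ) ≤ I.n := fun j => j.2.le
  have h := ready_inputState I
  have h14 := h.fill (a := 14) (v := 2) (e := rd 1 2) (P := (· ∈ I.S)) (by decide) (by decide) rfl
    rfl fun i => by simp [tr_rd, (h.vec 1 (by decide) rfl).eq_zero_iff]
  have h15 := h14.fill (a := 15) (v := 2) (e := rd 2 2) (P := (· ∈ I.T)) (by decide) (by decide) rfl
    rfl fun i => by simp [tr_rd, (h14.vec 2 (by decide) rfl).eq_zero_iff]
  have h3 := h15.locked (a := 3) (b := 14) (by decide) (by decide) (by decide) (by decide)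
    (by decide) (by decide) (by decide) rfl rfl
  have h5 := h3.locked (a := 5) (b := 15) (by decide) (by decide) (by decide) (by decide)
    (by decide) (by decide) (by decide) rfl rfl
  have h6 := h5.fill (a := 6) (v := 2)
    (e := conj (neg (rd 3 2)) (neg (ex 3 (conj (rd2 0 2 3) (rd 3 3))))) (by decide) (by decide) rfl
    rfl fun i => by
      simp [tr_conj, tr_neg, tr_ex I.n, tr_rd, tr_rd2 I.n, h5.reg_zero, e0,
        (h5.vec 3 (by decide) rfl).eq_zero_iff, (h5.mat 0 (by decide) rfl).eq_zero_iff, Alive]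
  have h13 := h6.fill2 (a := 13) (v := 2) (w := 3)
    (e := conj (rd2 0 2 3) (conj (rd 6 2) (rd 6 3))) (by decide) (by decide) rfl
    rfl (by decide) (by decide) (by decide) (by decide) fun i j => by
      simp [tr_conj, tr_rd, tr_rd2 I.n, h6.reg_zero, e0, (h6.vec 6 (by decide) rfl).eq_zero_iff,
        (h6.mat 0 (by decide) rfl).eq_zero_iff, Instance.core, trim, restr_adj]
  have h7 := h13.fill (a := 7) (v := 2) (e := pendExpr) (by decide) (by decide) rfl rfl fun i => by
    simp [pendExpr, tr_conj, tr_neg, tr_ne, eval, tr_ex I.n, tr_rd2 I.n, h13.reg_zero, e0,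
      (h13.mat 13 (by decide) rfl).eq_zero_iff, Pend, Fin.val_inj]
  have h8 := h7.fill (a := 8) (v := 2) (e := redExpr) (by decide) (by decide) rfl rfl fun i => by
    simp [redExpr, tr_conj, tr_disj, tr_neg, tr_lt, eval, tr_ex I.n, tr_rd, tr_rd2 I.n,
      h7.reg_zero, e0, (h7.mat 13 (by decide) rfl).eq_zero_iff,
      (h7.vec 7 (by decide) rfl).eq_zero_iff, (h7.vec 14 (by decide) rfl).eq_zero_iff,
      (h7.vec 15 (by decide) rfl).eq_zero_iff, Red]
  obtain ⟨f9, h9'⟩ := reachStmt_spec h8.reg_zero (h8.mat 13 (by decide) rfl)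
  have h9 := (h8.frame f9 (by decide)).cons (a := 9) h9'
  have h10 := h9.fill (a := 10) (v := 2) (e := keepExpr) (by decide) (by decide) rfl rfl
    (tr_keepExpr h9 (by decide) (by decide) (by decide))
  have h12 := h10.fill (a := 12) (v := 2) (e := badExpr) (by decide) (by decide) rfl rfl
    (fun i => tr_badExpr h10 (by decide) i)
  exact h12.fill (a := 11) (v := 2) (e := conj (rd 10 2) (neg (rd 12 2))) (by decide) (by decide) rfl
    rfl fun i => by
      simp [tr_conj, tr_neg, tr_rd, (h12.vec 10 (by decide) rfl).eq_zero_iff,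
        (h12.vec 12 (by decide) rfl).eq_zero_iff, Instance.Kept]

end Program


/-! ### Writing the new adjacency matrix and tokens. -/

section Output

open TokenSliding.Expr

variable {I : Instance} {l : List ℕ} {s : State}

/-- The position of the vertex in register `v`. -/
def rankExpr (v : ℕ) : Expr := cnt 6 (conj (lt (reg 6) (reg v)) (rd 11 6))

/-- The number of vertices of the kernel. -/
def sizeExpr : Expr := cnt 6 (rd 11 6)

theorem eval_rankExpr {v : ℕ} (hv : v ≠ 6) (hn : s.reg 0 = I.n) (hK : HoldsVec s 11 I.Kept)
    (x : Fin I.n) (hx : s.reg v = x) : (rankExpr v).eval s = rank I.Kept x := by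
  rw [rankExpr, eval_cnt I.n _ _ _ hn, rank]
  congr 1
  ext j
  simp [tr_conj, tr_lt, tr_rd, eval, hv, hx, hK.eq_zero_iff]

theorem eval_sizeExpr (hn : s.reg 0 = I.n) (hK : HoldsVec s 11 I.Kept) :
    sizeExpr.eval s = size I.Kept := by
  rw [sizeExpr, eval_cnt I.n _ _ _ hn, size]
  congr 1
  ext j
  simp [tr_rd, hK.eq_zero_iff]

/-- The position of an entry of the adjacency matrix of the kernel. -/
def entryExpr : Expr := add (mul (rankExpr 2) (add sizeExpr (const 2))) (rankExpr 3)

theorem rank_le (K : Fin I.n → Prop) (x : Fin I.n) : rank K x ≤ I.n :=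
  (Finset.card_le_univ _).trans (Fintype.card_fin _).le

/-- The rank is the first factor of the product because it is at most `n`; the dimension `size
I.Kept + 2` may exceed `n`. -/
theorem eval_entryExpr (hn : s.reg 0 = I.n) (hK : HoldsVec s 11 I.Kept)
    (x y : Fin I.n) (hx : s.reg 2 = x) (hy : s.reg 3 = y) :
    entryExpr.eval s = (size I.Kept + 2) * rank I.Kept x + rank I.Kept y := by
  have r2 := eval_rankExpr (v := 2) (by decide) hn hK x hx
  have r3 := eval_rankExpr (v := 3) (by decide) hn hK y hy
  have r2' := fun i => eval_rankExpr (s := s.setReg 31 i) (v := 2) (by decide) hn hK x (by simpa)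
  have z := eval_sizeExpr hn hK
  have z' := fun i => eval_sizeExpr (s := s.setReg 31 i) hn hK
  simp only [entryExpr, eval]
  rw [eval_mul (fun i => by rw [r2', r2]) (fun i => by simp only [eval]; rw [z', z])
    (by rw [r2, hn]; exact rank_le _ _), r2, r3]
  simp only [eval, z]
  ring

/-- Write the adjacency matrix of the kernel. -/
def graphStmt : Stmt :=
  .iter 2 (.iter 3 (.ite (conj (rd2 13 2 3) (conj (rd 11 2) (rd 11 3)))
    (.store 0 entryExpr (const 1))))

/-- Write the tokens in array `b` to array `a`. -/
def tokenStmt (a b : ℕ) : Stmt :=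
  .iter 2 (.ite (conj (rd b 2) (rd 11 2)) (.store a (rankExpr 2) (const 1)))

open Classical in
theorem graphStmt_spec (hn : s.reg 0 = I.n) (hH : HoldsMat s 13 I.core.Adj)
    (hK : HoldsVec s 11 I.Kept) : (graphStmt.run s).reg = s.reg ∧
      (∀ b ≠ 0, (graphStmt.run s).arr b = s.arr b) ∧
      ∀ c, (graphStmt.run s).arr 0 c = if ∃ x y, I.Kept x ∧ I.Kept y ∧ I.core.Adj x y ∧
        c = (size I.Kept + 2) * rank I.Kept x + rank I.Kept y then 1 else s.arr 0 c := by
  have e0 : ∀ j : Fin I.n, (j : ℕ) ≤ I.n := fun j => j.2.le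
  have h : graphStmt.Sets 0 s _ (fun _ => 1) :=
    Stmt.Sets.iter (fun i _ => Stmt.Sets.iter (fun j _ => (sets_store rfl rfl _).ite rfl)
      (fun _ _ _ _ => rfl)) (fun _ _ _ _ => rfl)
  obtain ⟨h1, h2, h3⟩ := h.run
  refine ⟨h1, h2, fun c => (h3 c).trans (if_congr ?_ rfl rfl)⟩
  have key : ∀ x y : Fin I.n, ((conj (rd2 13 2 3) (conj (rd 11 2) (rd 11 3))).tr
      ((s.setReg 2 x).setReg 3 y) ∧ c = entryExpr.eval ((s.setReg 2 x).setReg 3 y)) ↔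
      (I.Kept x ∧ I.Kept y ∧ I.core.Adj x y ∧
        c = (size I.Kept + 2) * rank I.Kept x + rank I.Kept y) := by
    intro x y
    rw [eval_entryExpr (s := (s.setReg 2 x).setReg 3 y) hn hK x y (by simp) (by simp)]
    simp [tr_conj, tr_rd, tr_rd2 I.n, hn, e0, hH.eq_zero_iff, hK.eq_zero_iff]
    tauto
  have hn2 : ∀ i, (s.setReg 2 i).reg 0 = I.n := fun i => hn
  simp only [hn, hn2]
  constructor
  · rintro ⟨i, hi, j, hj, h⟩
    exact ⟨⟨i, hi⟩, ⟨j, hj⟩, (key ⟨i, hi⟩ ⟨j, hj⟩).1 h⟩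
  · rintro ⟨x, y, h⟩
    exact ⟨x, x.2, y, y.2, (key x y).2 h⟩

open Classical in
theorem tokenStmt_spec {a b : ℕ} {A : Finset (Fin I.n)} (ha : a ≠ 11) (hab : b ≠ a)
    (hn : s.reg 0 = I.n) (hA : HoldsVec s b (· ∈ A)) (hK : HoldsVec s 11 I.Kept) :
    ((tokenStmt a b).run s).reg = s.reg ∧
      (∀ b' ≠ a, ((tokenStmt a b).run s).arr b' = s.arr b') ∧
      ∀ c, ((tokenStmt a b).run s).arr a c =
        if ∃ x, I.Kept x ∧ x ∈ A ∧ c = rank I.Kept x then 1 else s.arr a c := by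
  have n1 : (rankExpr 2).noArr a = true := by
    simp [rankExpr, cnt, ind, conj, lt, rd, noArr, ha.symm]
  have n2 : (conj (rd b 2) (rd 11 2)).noArr a = true := by simp [conj, rd, noArr, hab, ha.symm]
  have h : (tokenStmt a b).Sets a s _ (fun _ => 1) :=
    Stmt.Sets.iter (fun i _ => (sets_store n1 rfl _).ite n2) (fun _ _ _ _ => rfl)
  obtain ⟨h1, h2, h3⟩ := h.run
  refine ⟨h1, h2, fun c => (h3 c).trans (if_congr ?_ rfl rfl)⟩
  have key : ∀ x : Fin I.n, ((conj (rd b 2) (rd 11 2)).tr (s.setReg 2 x) ∧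
      c = (rankExpr 2).eval (s.setReg 2 x)) ↔ (I.Kept x ∧ x ∈ A ∧ c = rank I.Kept x) := by
    intro x
    rw [eval_rankExpr (s := s.setReg 2 x) (by decide) hn hK x (by simp)]
    simp [tr_conj, tr_rd, hA.eq_zero_iff, hK.eq_zero_iff]
    tauto
  rw [hn]
  constructor
  · rintro ⟨i, hi, h⟩
    exact ⟨⟨i, hi⟩, (key ⟨i, hi⟩).1 h⟩
  · rintro ⟨x, h⟩
    exact ⟨x, x.2, (key x).2 h⟩

end Output


/-! ### The complete program and its correctness. -/

section Kernelization

open TokenSliding.Expr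

variable {I : Instance} {l : List ℕ} {s : State}

open Classical in
/-- The state holds all that the output depends on. -/
structure Source (I : Instance) (s : State) : Prop where
  reg_zero : s.reg 0 = I.n
  core : HoldsMat s 13 I.core.Adj
  kept : HoldsVec s 11 I.Kept
  start : HoldsVec s 14 (· ∈ I.S)
  target : HoldsVec s 15 (· ∈ I.T)
  bad : s.arr 12 0 = if I.IsBad then 1 else 0

theorem Source.frame (h : Source I s) {s' : State} (hf : Frame [0, 1, 2] s s') : Source I s' where
  reg_zero := by rw [hf.1, h.reg_zero]
  core := h.core.congr (hf.2 13 (by decide))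
  kept := h.kept.congr (hf.2 11 (by decide))
  start := h.start.congr (hf.2 14 (by decide))
  target := h.target.congr (hf.2 15 (by decide))
  bad := by rw [hf.2 12 (by decide), h.bad]

theorem Ready.source (h : Ready I l s) (hl : [11, 12, 13, 14, 15] ⊆ l) : Source I s where
  reg_zero := h.reg_zero
  core := h.mat 13 (hl (by decide)) rfl
  kept := h.vec 11 (hl (by decide)) rfl
  start := h.vec 14 (hl (by decide)) rfl
  target := h.vec 15 (hl (by decide)) rfl
  -- Every entry of array `12` holds the same truth value; entry `0` exists because `1 ≤ k ≤ n`.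
  bad := h.vec 12 (hl (by decide)) rfl ⟨0, I.one_le_k.trans (k_le_n I)⟩

/-- Clear the first three arrays. -/
def clearStmt : Stmt :=
  .seq (fill2 0 2 3 (const 0)) <| .seq (fill 1 2 (const 0)) (fill 2 2 (const 0))

theorem clearStmt_spec (h : Ready I l s) : Frame [0, 1, 2] s (clearStmt.run s) ∧
    ∀ a ≤ 2, ∀ c, (clearStmt.run s).arr a c = 0 := by
  obtain ⟨r0, f0, e0⟩ := fill2_spec (a := 0) (v := 2) (w := 3) (e := const 0) rfl (by decide)
    (by decide) (by decide) (by decide) s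
  set s0 := (fill2 0 2 3 (const 0)).run s with hs0
  obtain ⟨r1, f1, e1⟩ := fill_spec (a := 1) (v := 2) (e := const 0) rfl s0
  set s1 := (fill 1 2 (const 0)).run s0 with hs1
  obtain ⟨r2, f2, e2⟩ := fill_spec (a := 2) (v := 2) (e := const 0) rfl s1
  have hrun : clearStmt.run s = (fill 2 2 (const 0)).run s1 := rfl
  rw [hrun]
  refine ⟨⟨by rw [r2, r1, r0], fun b hb => ?_⟩, fun a ha c => ?_⟩
  · simp only [List.mem_cons, List.not_mem_nil, or_false, not_or] at hb
    rw [f2 b hb.2.2, f1 b hb.2.1, f0 b hb.1]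
  · interval_cases a
    · rw [f2 0 (by decide), f1 0 (by decide), e0, h.reg_zero, h.arr_eq 0 (by decide)]
      split_ifs with hc
      · rfl
      -- Entries beyond the input matrix were zero from the start. The output may use them, as it
      -- can have up to `n + 2` vertices.
      · simp only [inputState, if_true]
        refine if_neg ?_
        rintro ⟨i, j, rfl, _⟩
        refine hc ?_
        calc I.n * i + j < I.n * i + I.n := by have := j.2; omega
          _ = I.n * (i + 1) := by ring
          _ ≤ I.n * I.n := Nat.mul_le_mul_left _ i.2
    · rw [f2 1 (by decide), e1, r0, h.reg_zero, f0 1 (by decide), h.arr_eq 1 (by decide)]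
      split_ifs with hc
      · rfl
      · have : ¬ ∃ i ∈ I.S, c = (i : ℕ) := by
          rintro ⟨i, _, rfl⟩
          exact hc i.2
        simp [inputState, this]
    · rw [e2, r1, r0, h.reg_zero, f1 2 (by decide), f0 2 (by decide), h.arr_eq 2 (by decide)]
      split_ifs with hc
      · rfl
      · have : ¬ ∃ i ∈ I.T, c = (i : ℕ) := by
          rintro ⟨i, _, rfl⟩
          exact hc i.2
        simp [inputState, this]

/-- Write the tokens of the kernel that come from array `b` to array `a`. -/
def tokensStmt (a b : ℕ) (e : Expr) : Stmt := .seq (tokenStmt a b) (.store a e (const 1))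

open Classical in
theorem tokensStmt_spec {a b i : ℕ} {A : Finset (Fin I.n)} {e : Expr} (h : Source I s) (ha : a ≤ 2)
    (hab : b ≠ a) (hA : HoldsVec s b (· ∈ A)) (h0 : ∀ c, s.arr a c = 0)
    (he : ∀ s', Source I s' → e.eval s' = size I.Kept + i) :
    ((tokensStmt a b e).run s).reg = s.reg ∧
      (∀ b' ≠ a, ((tokensStmt a b e).run s).arr b' = s.arr b') ∧
      ∀ c, ((tokensStmt a b e).run s).arr a c =
        if (∃ x, I.Kept x ∧ x ∈ A ∧ rank I.Kept x = c) ∨ c = size I.Kept + i then 1 else 0 := by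
  obtain ⟨h1, h2, h3⟩ := tokenStmt_spec (a := a) (by omega) hab h.reg_zero hA h.kept
  set s1 := (tokenStmt a b).run s with hs1
  have hf : Frame [0, 1, 2] s s1 := ⟨h1, fun c hc => h2 c (by
    rintro rfl
    simp only [List.mem_cons, List.not_mem_nil, or_false, not_or] at hc
    omega)⟩
  have hrun : (tokensStmt a b e).run s = s1.setArr a (size I.Kept + i) 1 := by
    rw [← he s1 (h.frame hf)]
    rfl
  rw [hrun]
  refine ⟨h1, fun b' hb' => ?_, fun c => ?_⟩
  · rw [← h2 b' hb']
    funext c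
    rw [State.setArr_arr, if_neg fun h => hb' h.1]
  · rw [State.setArr_arr, h3, h0]
    by_cases hc : c = size I.Kept + i
    · rw [if_pos ⟨rfl, hc⟩, if_pos (Or.inr hc)]
    · rw [if_neg fun h => hc h.2]
      refine if_congr ?_ rfl rfl
      simp only [hc, or_false, eq_comm]

/-- Write the kernel, except for the registers `0` and `1`. -/
def outStmt : Stmt :=
  .seq clearStmt <| .seq graphStmt <| .seq (tokensStmt 1 14 sizeExpr) <|
  .seq (tokensStmt 2 15 (add sizeExpr (arr 12 (const 0)))) <|
  .seq (.assign 20 (add sizeExpr (const 2)))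
    (.assign 21 (add (cnt 3 (conj (rd 14 3) (rd 11 3))) (const 1)))

open Classical in
theorem outStmt_spec (h : Ready I l s) (hl : [11, 12, 13, 14, 15] ⊆ l) :
    (outStmt.run s).reg 20 = I.kernel.n ∧ (outStmt.run s).reg 21 = I.kernel.k ∧
    (∀ c, (outStmt.run s).arr 0 c = if ∃ x y, I.Kept x ∧ I.Kept y ∧ I.core.Adj x y ∧
      c = (size I.Kept + 2) * rank I.Kept x + rank I.Kept y then 1 else 0) ∧
    (∀ c, (outStmt.run s).arr 1 c =
      if (∃ x, I.Kept x ∧ x ∈ I.S ∧ rank I.Kept x = c) ∨ c = size I.Kept + 0 then 1 else 0) ∧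
    ∀ c, (outStmt.run s).arr 2 c = if (∃ x, I.Kept x ∧ x ∈ I.T ∧ rank I.Kept x = c) ∨
      c = size I.Kept + (if I.IsBad then 1 else 0) then 1 else 0 := by
  obtain ⟨f1, z1⟩ := clearStmt_spec h
  set s1 := clearStmt.run s with hs1
  have h1 := (h.source hl).frame f1
  obtain ⟨r2, g2, e2⟩ := graphStmt_spec h1.reg_zero h1.core h1.kept
  set s2 := graphStmt.run s1 with hs2
  have h2 : Source I s2 := h1.frame ⟨r2, fun b hb => g2 b (by rintro rfl; simp at hb)⟩
  obtain ⟨r3, g3, e3⟩ := tokensStmt_spec (a := 1) (b := 14) (i := 0) (e := sizeExpr) h2 (by decide)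
    (by decide) h2.start (fun c => by rw [g2 1 (by decide), z1 1 (by decide)])
    (fun s' h' => eval_sizeExpr h'.reg_zero h'.kept)
  set s3 := (tokensStmt 1 14 sizeExpr).run s2 with hs3
  have h3 : Source I s3 := h2.frame ⟨r3, fun b hb => g3 b (by rintro rfl; simp at hb)⟩
  obtain ⟨r4, g4, e4⟩ := tokensStmt_spec (a := 2) (b := 15) (i := if I.IsBad then 1 else 0)
    (e := add sizeExpr (arr 12 (const 0))) h3 (by decide) (by decide) h3.target
    (fun c => by rw [g3 2 (by decide), g2 2 (by decide), z1 2 (by decide)])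
    (fun s' h' => by
      simp only [eval, eval_sizeExpr h'.reg_zero h'.kept]
      rw [← h'.bad])
  set s4 := (tokensStmt 2 15 (add sizeExpr (arr 12 (const 0)))).run s3 with hs4
  have h4 : Source I s4 := h3.frame ⟨r4, fun b hb => g4 b (by rintro rfl; simp at hb)⟩
  have hrun : outStmt.run s = (s4.setReg 20 ((add sizeExpr (const 2)).eval s4)).setReg 21
      ((add (cnt 3 (conj (rd 14 3) (rd 11 3))) (const 1)).eval
        (s4.setReg 20 ((add sizeExpr (const 2)).eval s4))) := rfl
  rw [hrun]
  simp only [State.setReg_arr, State.setReg_reg]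
  refine ⟨?_, ?_, fun c => ?_, fun c => ?_, e4⟩
  · simp [eval, eval_sizeExpr h4.reg_zero h4.kept, Instance.kernel]
  · have hn : ∀ x, (s4.setReg 20 x).reg 0 = I.n := fun x => h4.reg_zero
    simp only [if_true, eval]
    rw [eval_cnt I.n _ _ _ (hn _)]
    change _ = (I.S.filter I.Kept).card + 1
    congr 2
    ext j
    simp [tr_conj, tr_rd, h4.start.eq_zero_iff, h4.kept.eq_zero_iff]
  · rw [g4 0 (by decide), g3 0 (by decide), e2, z1 0 (by decide)]
  · rw [g4 1 (by decide), e3]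

theorem holds_kernel {s' : State} (h : Ready I l s) (hl : [11, 12, 13, 14, 15] ⊆ l)
    (ha : s'.arr = (outStmt.run s).arr) (h0 : s'.reg 0 = (outStmt.run s).reg 20)
    (h1 : s'.reg 1 = (outStmt.run s).reg 21) : Holds s' I.kernel := by
  classical
  obtain ⟨e0, e1, e2, e3, e4⟩ := outStmt_spec h hl
  refine ⟨h0.trans e0, h1.trans e1, fun i j => ?_, fun i => ?_, fun i => ?_⟩
  · rw [ha, e2]
    refine if_congr ⟨?_, ?_⟩ rfl rfl
    · rintro ⟨x, y, hx, hy, hxy, he⟩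
      -- Row and column are recovered from the position because both columns are less than the
      -- dimension of the new matrix.
      obtain ⟨hi, hj⟩ := entry_injective j.2 ((rank_lt_size hy).trans_le (by simp [Instance.kernel])) he
      exact ⟨x, y, hx, hy, hxy, hi.symm, hj.symm⟩
    · rintro ⟨x, y, hx, hy, hxy, hi, hj⟩
      exact ⟨x, y, hx, hy, hxy, by rw [hi, hj]; rfl⟩
  · have hi : i ∈ I.kernel.S ↔ _ := Finset.mem_filter_univ i
    rw [ha, e3]
    simp only [hi]
  · have hi : i ∈ I.kernel.T ↔ _ := Finset.mem_filter_univ i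
    rw [ha, e4]
    simp only [hi]

/-- The computation of the kernel, except for the registers `0` and `1`. -/
def kernelStmt : Stmt := .seq keptStmt outStmt

/-- The computation of the kernel. -/
def kernelProg : Prog := .seq (kernelStmt.compile 32) (.seq (.copy 0 20) (.copy 1 21))

theorem exec_kernelProg (I : Instance) : ∃ s t, Exec kernelProg (inputState I) s t ∧
    t ≤ (kernelStmt.cost + 2).eval I.n ∧ Holds s I.kernel := by
  have hwf : kernelStmt.wf = true := by decide
  obtain ⟨s, t, he, ha, ht⟩ := Stmt.exec_compile hwf 32 le_rfl (inputState I)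
  have h := ready_keptStmt I
  refine ⟨_, _, Exec.seq he (Exec.seq (Exec.copy s 0 20) (Exec.copy _ 1 21)), ?_, ?_⟩
  · have : (inputState I).reg 0 = I.n := rfl
    rw [this] at ht
    simp only [Polynomial.eval_add, Polynomial.eval_ofNat]
    omega
  · refine holds_kernel h (by decide) ha.1 ?_ ?_
    · simpa [kernelStmt, Stmt.run] using ha.2 20 (by decide)
    · simpa [kernelStmt, Stmt.run] using ha.2 21 (by decide)

end Kernelization

end TokenSliding

theorem mainTheorem4 :
    (∃ C : ℕ, TokenSliding.AdmitsKernel TokenSliding.Instance.BipartiteC4Free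
      (fun k => C * k ^ 12)) ∧
    (∀ I : TokenSliding.Instance, I.BipartiteC4Free → I.graph.Connected →
      TokenSliding.Unlocked I.graph I.S → TokenSliding.Unlocked I.graph I.T →
      TokenSliding.AtMostOnePendant I.graph →
      (∃ v, I.k ^ 2 + I.k + 1 ≤ TokenSliding.deg I.graph v) → I.IsYes) := by
  refine ⟨⟨42, TokenSliding.kernelProg, TokenSliding.kernelStmt.cost + 2, fun I hI => ?_⟩,
    fun I hI hconn hS hT hpend hdeg =>
      TokenSliding.isYes_of_large_degree I hI hconn hS hT hpend hdeg⟩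
  obtain ⟨s, t, he, ht, hs⟩ := TokenSliding.exec_kernelProg I
  exact ⟨s, t, I.kernel, he, ht, hs, TokenSliding.kernel_bipartiteC4Free I hI,
    TokenSliding.kernel_isYes_iff I hI, TokenSliding.kernel_n_le I⟩
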